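/- Let $2\le k\le n$ be integers and let $p\le 1$ be a real number. A (closed, smooth, star-shaped) hypersurface is a radial graph $M=\{\rho(x)x : x\in\mathbb S^n\}\subset\mathbb R^{n+1}$ with $\rho$ smooth and positive on $\mathbb S^n$; $\nu$ is its outer unit normal, $u=\langle X,\nu\rangle$ its support function, $A$ its second fundamental form $h(v,w)=\langle D_v\nu,w\rangle$, with principal curvatures $\lambda_1,\dots,\lambda_n$, and $\sigma_l(A)=\sum_{i_1<\dots<i_l}\lambda_{i_1}\cdots\lambda_{i_l}$. $M$ is an admissible solution of $$\sigma_k(A)=\langle X,\nu\rangle^p\,\phi(X)\qquad(\ast)$$ if $(\ast)$ holds on $M$ and $\sigma_l(A)>0$ on $M$ for all $1\le l\le k$. Let $m>0$ and $K$ be real numbers. (1) Suppose that $k<n$ or $p<1$. There is a constant $C=C(n,k,p,m,K)$ such that, for every $f\in C^2(\mathbb S^n)$ with $\min_{\mathbb S^n} f\ge m$ and $\|f\|_{C^2(\mathbb S^n)}\le K$, every admissible solution $M$ of $(\ast)$ with $$\phi(X)=|X|^{-(n+1)}f\!\left(\frac{X}{|X|}\right)$$ satisfies $\sigma_1(A)\le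 C$ on $M$. Here $\|f\|_{C^2(\mathbb S^n)}\le K$ means that $X\mapsto f(X/|X|)$ and its first and second derivatives have norm at most $K$ at every point of $\mathbb S^n$. (2) For all $r>0$ and $R$ there is a constant $C=C(n,k,p,m,K,r,R)$ such that the following holds. Let $M$ be an admissible solution of $(\ast)$, where $\phi$ is a function that is $C^2$ near $M$, with $\phi\ge m$ on $M$ and with $\phi$, $D\phi$, $D^2\phi$ of norm at most $K$ at every point of $M$. Suppose that $r\le|X|\le R$ on $M$ and, only in the case $p=0$, that also $u\ge r$ on $M$. Then $\sigma_1(A)\le C$ on $M$. -/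

import Mathlib

open scoped ContDiff InnerProductSpace

noncomputable section

namespace CurvatureMeasure

/-- The ambient Euclidean space `ℝⁿ⁺¹`. -/
abbrev E (n : ℕ) : Type := EuclideanSpace ℝ (Fin (n + 1))

/-- The unit sphere `𝕊ⁿ ⊂ ℝⁿ⁺¹`. -/
abbrev S (n : ℕ) : Type := Metric.sphere (0 : E n) 1

/-- The extension of a function on `𝕊ⁿ` to `ℝⁿ⁺¹ ∖ {0}` that is constant along rays,
`X ↦ f (X / |X|)` (the value at the origin is irrelevant). -/
def radialExt {n : ℕ} (f : S n → ℝ) (X : E n) : ℝ :=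
  if h : X = 0 then 0
  else f ⟨‖X‖⁻¹ • X, by
    rw [mem_sphere_zero_iff_norm, norm_smul, norm_inv, norm_norm,
      inv_mul_cancel₀ (norm_ne_zero_iff.mpr h)]⟩

/-- `f` is of class `C^r` on the sphere: its extension along rays is `C^r` off the origin. -/
def IsCSphere {n : ℕ} (r : WithTop ℕ∞) (f : S n → ℝ) : Prop :=
  ContDiffOn ℝ r (radialExt f) {0}ᶜ

/-- `‖f‖_{C²(𝕊ⁿ)} ≤ K`. At a point `x` of the sphere the first derivative of the extension along
rays is the gradient of `f` on `𝕊ⁿ`; its second derivative is the covariant Hessian on tangent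
vectors, minus the gradient in the mixed directions `(x, v)`, and `0` on `(x, x)`. -/
def C2BoundSphere {n : ℕ} (f : S n → ℝ) (K : ℝ) : Prop :=
  ∀ x : S n, ∀ j : ℕ, j ≤ 2 → ‖iteratedFDeriv ℝ j (radialExt f) (x : E n)‖ ≤ K

/-- A smooth closed hypersurface of `ℝⁿ⁺¹` that is a graph `X(x) = ρ(x) x` over the sphere `𝕊ⁿ`,
given by its positive smooth radial function `ρ`. -/
structure RadialGraph (n : ℕ) where
  /-- the radial function `ρ` -/
  radius : S n → ℝ
  radius_pos : ∀ x, 0 < radius x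
  smooth : IsCSphere ∞ radius

namespace RadialGraph

variable {n : ℕ} (M : RadialGraph n)

/-- The points `ρ(x) x`, `x ∈ 𝕊ⁿ`, of the hypersurface. -/
def carrier : Set (E n) := Set.range fun x : S n => M.radius x • (x : E n)

/-- The defining function `G(X) = |X| / ρ(X/|X|)`: the hypersurface is the level set `G = 1`, it
encloses the region `G < 1`, and `G` is smooth with nonzero gradient off the origin. -/
def defining (X : E n) : ℝ := ‖X‖ / radialExt M.radius X

/-- The outer unit normal `ν = ∇G / |∇G|` (extended off the hypersurface by the same formula). -/
def normal (X : E n) : E n :=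
  ‖gradient M.defining X‖⁻¹ • gradient M.defining X

/-- The support function `u = ⟨X, ν⟩`. -/
def support (X : E n) : ℝ := ⟪X, M.normal X⟫_ℝ

/-- The tangent space at the point `X`: the orthogonal complement of the normal. -/
def tangent (X : E n) : Submodule ℝ (E n) := (ℝ ∙ M.normal X)ᗮ

/-- The Weingarten map `v ↦ D_v ν` of the tangent space at `X`, so that the second fundamental
form is `h(v, w) = ⟨D_v ν, w⟩` (positive for round spheres). -/
def weingarten (X : E n) : M.tangent X →ₗ[ℝ] M.tangent X :=
  ((M.tangent X).orthogonalProjectionOnto ∘L fderiv ℝ M.normal X ∘L (M.tangent X).subtypeL).toLinearMap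

/-- The principal curvatures at `X`: the eigenvalues of the (self-adjoint) Weingarten map, counted
with multiplicity. -/
def principalCurvatures (X : E n) : Multiset ℝ := (M.weingarten X).charpoly.roots

/-- `σ_l(A)`, the `l`-th elementary symmetric function of the principal curvatures at `X`. -/
def sigma (l : ℕ) (X : E n) : ℝ := (M.principalCurvatures X).esymm l

/-- The hypersurface is `k`-admissible: `σ_l(A) > 0` for `l = 1, …, k`, that is, the principal
curvatures lie in the cone `Γ_k` at every point. -/
def Admissible (k : ℕ) : Prop :=
  ∀ X ∈ M.carrier, ∀ l : ℕ, 1 ≤ l → l ≤ k → 0 < M.sigma l X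

/-- The hypersurface solves `σ_k(A) = ⟨X, ν⟩ ^ p φ(X)`. -/
def Solves (k : ℕ) (p : ℝ) (φ : E n → ℝ) : Prop :=
  ∀ X ∈ M.carrier, M.sigma k X = M.support X ^ p * φ X

end RadialGraph

/-- The right-hand side `φ(X) = |X|^{-(n+1)} f(X/|X|)` belonging to a density `f` on `𝕊ⁿ`. -/
def densityRHS {n : ℕ} (f : S n → ℝ) (X : E n) : ℝ :=
  (‖X‖ ^ (n + 1))⁻¹ * radialExt f X

end CurvatureMeasure

end

/-! The curvature bound is the maximum principle for H/u, where H = σ_1(A). Write F = σ_k(A), and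
let a_s, e_s be the logarithmic derivatives of u and φ in the s-th principal direction. At a maximum
of H/u one has H_s/H = a_s, and the equation gives F_s/F = p a_s + e_s. Compare the linearized
operator Σ F^{ii}∇_i∇_i applied to H with the Laplacian of F. They differ by curvature terms and by
the second derivative of σ_k along ∇_s A. Concavity of log(σ_k/σ_1) on the Gårding cone
(`Cone.hessian_le`) bounds the latter by F((F_s/F)² - (H_s/H)²). Combined with the second derivative
of u^p, the total coefficient of Σ a_s² is p(p-1) - (p²-1) = 1 - p ≥ 0, so this sum can be
discarded. The terms with Σ F^{ii}λ_i² cancel because H = (H/u)u. What is left (`key_inequality`)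
bounds (k-p)|A|² by an expression linear in |A|, once u is bounded below. Since k ≥ 2 and p ≤ 1, the
factor k-p is at least 1, and |A| is bounded at the maximum point.

The concavity comes from Newton's inequality: σ_{k+1}/σ_k is superadditive on Γ_k (`Cone.add`), and
σ_k/σ_1 is a telescoping product of such quotients (`Cone.midpoint`).

The lower bound for u comes from a minimum of u exp(N|X|²/2) (`gradient_inequality`). For p < 0 a
negative N works. For p > 0 a large positive N works, because then the principal curvature is -Nu <
0 wherever the position vector has a tangential component, and F^{ii} is comparable to its trace
there. For p = 0 the useful term pN|X^T|² vanishes, and the bound is assumed. For a density, φ is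
homogeneous of degree -(n+1), and N = 0 suffices for every p (`div_le_support_of_density`). In that
case |X| is controlled by comparison with centred spheres at the nearest and farthest points. The
relevant power |X|^{n+1-k-p} has positive exponent because k < n or p < 1; for k = n, p = 1 the
equation is invariant under scaling.

All geometry is done in flat space with the signed distance d from M near one point. There D²d has
eigenvalues 0 and the λ_i. H = Δd, u = ⟨X,∇d⟩ and F = σ_k(D²d) are ordinary functions, the Codazzi
equations are the symmetry of D³d, and the commutation formulas follow by differentiating |∇d|² = 1
(`third_zero`, `fourth_zero`). -/

noncomputable section
namespace CurvatureMeasure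

set_option linter.unusedSectionVars false

/-! ### Elementary symmetric functions -/

/-- The `k`-th elementary symmetric function of the numbers `x i`, `i ∈ s`. -/
def es {ι : Type*} (s : Finset ι) (x : ι → ℝ) (k : ℕ) : ℝ :=
  ∑ t ∈ s.powersetCard k, ∏ i ∈ t, x i

section es

variable {ι : Type*}

@[simp] lemma es_zero (s : Finset ι) (x : ι → ℝ) : es s x 0 = 1 := by simp [es]

lemma es_one (s : Finset ι) (x : ι → ℝ) : es s x 1 = ∑ i ∈ s, x i := by
  simp [es, Finset.powersetCard_one]

lemma es_empty (x : ι → ℝ) (k : ℕ) : es ∅ x (k + 1) = 0 := by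
  rw [es, Finset.powersetCard_eq_empty.2 (by simp), Finset.sum_empty]

lemma es_eq_esymm (s : Finset ι) (x : ι → ℝ) (k : ℕ) : es s x k = (s.val.map x).esymm k :=
  (Finset.esymm_map_val x s k).symm

lemma es_smul (s : Finset ι) (x : ι → ℝ) (a : ℝ) (k : ℕ) :
    es s (a • x) k = a ^ k * es s x k := by
  simp only [es, Finset.mul_sum]
  refine Finset.sum_congr rfl fun t ht => ?_
  rw [← (Finset.mem_powersetCard.1 ht).2, ← Finset.prod_const, ← Finset.prod_mul_distrib]
  rfl

variable [DecidableEq ι]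

lemma es_insert {s : Finset ι} {a : ι} (ha : a ∉ s) (x : ι → ℝ) (k : ℕ) :
    es (insert a s) x (k + 1) = x a * es s x k + es s x (k + 1) := by
  unfold es
  rw [Finset.powersetCard_succ_insert ha, Finset.sum_union, add_comm, Finset.sum_image,
    Finset.mul_sum]
  · congr 1
    refine Finset.sum_congr rfl fun t ht => ?_
    rw [Finset.prod_insert fun h => ha ((Finset.mem_powersetCard.1 ht).1 h)]
  · intro t ht t' ht' h
    have h1 : a ∉ t := fun h => ha ((Finset.mem_powersetCard.1 ht).1 h)
    have h2 : a ∉ t' := fun h => ha ((Finset.mem_powersetCard.1 ht').1 h)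
    rw [← Finset.erase_insert h1, ← Finset.erase_insert h2, h]
  · rw [Finset.disjoint_left]
    intro t ht ht'
    obtain ⟨t', -, rfl⟩ := Finset.mem_image.1 ht'
    exact ha ((Finset.mem_powersetCard.1 ht).1 (Finset.mem_insert_self a t'))

lemma es_erase {s : Finset ι} {a : ι} (ha : a ∈ s) (x : ι → ℝ) (k : ℕ) :
    es s x (k + 1) = x a * es (s.erase a) x k + es (s.erase a) x (k + 1) := by
  conv_lhs => rw [← Finset.insert_erase ha]
  exact es_insert (Finset.notMem_erase a s) x k

/-- The function is affine in each variable, and σ_k of the remaining variables is its slope in the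
i-th one. -/
lemma hasDerivAt_es (s : Finset ι) (x y : ι → ℝ) (k : ℕ) (t : ℝ) :
    HasDerivAt (fun t : ℝ => es s (x + t • y) (k + 1))
      (∑ i ∈ s, y i * es (s.erase i) (x + t • y) k) t := by
  induction s using Finset.induction_on generalizing k with
  | empty => simpa [es_empty] using hasDerivAt_const t (0 : ℝ)
  | insert a s ha ih =>
    have hx : HasDerivAt (fun t : ℝ => (x + t • y) a) (y a) t := by
      simpa using ((hasDerivAt_id t).mul_const (y a)).const_add (x a)
    -- The last factor corrects truncated subtraction: for k = 0 the function is constant although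
    -- index k - 1 would read 0.
    have h0 : HasDerivAt (fun t : ℝ => es s (x + t • y) k)
        (∑ i ∈ s, y i * (es (s.erase i) (x + t • y) (k - 1) * if k = 0 then 0 else 1)) t := by
      rcases k with _ | k
      · simpa using hasDerivAt_const t (1 : ℝ)
      · simpa using ih k
    have key := (hx.mul h0).add (ih k)
    have e : (fun t : ℝ => es (insert a s) (x + t • y) (k + 1)) =
        fun t : ℝ => (x + t • y) a * es s (x + t • y) k + es s (x + t • y) (k + 1) := by
      funext t; exact es_insert ha _ _
    rw [e]
    refine key.congr_deriv ?_
    rw [Finset.sum_insert ha, Finset.erase_insert ha, add_assoc, Finset.mul_sum,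
      ← Finset.sum_add_distrib]
    congr 1
    refine Finset.sum_congr rfl fun i hi => ?_
    have hia : a ≠ i := fun h => ha (h ▸ hi)
    have hn : a ∉ s.erase i := fun h => ha (Finset.mem_of_mem_erase h)
    rw [Finset.erase_insert_of_ne hia]
    rcases k with _ | k
    · simp
    · rw [es_insert hn]; simp; ring

/-- Euler's relation for homogeneity of degree k + 1, obtained by differentiating σ_{k+1}(t x) at t
= 1 in two ways. -/
lemma sum_mul_es_erase (s : Finset ι) (x : ι → ℝ) (k : ℕ) :
    ∑ i ∈ s, x i * es (s.erase i) x k = (k + 1) * es s x (k + 1) := by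
  have h1 := hasDerivAt_es s (0 : ι → ℝ) x k 1
  have h2 : HasDerivAt (fun t : ℝ => es s ((0 : ι → ℝ) + t • x) (k + 1))
      ((k + 1 : ℕ) * (1 : ℝ) ^ k * es s x (k + 1)) 1 := by
    have e : (fun t : ℝ => es s ((0 : ι → ℝ) + t • x) (k + 1)) =
        fun t : ℝ => t ^ (k + 1) * es s x (k + 1) := by
      funext t; rw [zero_add, es_smul]
    rw [e]
    simpa using (hasDerivAt_pow (k + 1) (1 : ℝ)).mul_const (es s x (k + 1))
  have h := h1.unique h2
  simpa using h

lemma sum_es_erase (s : Finset ι) (x : ι → ℝ) (k : ℕ) :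
    ∑ i ∈ s, es (s.erase i) x k = ((s.card : ℝ) - k) * es s x k := by
  rcases k with _ | k
  · simp
  · have h := sum_mul_es_erase s x k
    have h' : ∀ i ∈ s, es (s.erase i) x (k + 1) = es s x (k + 1) - x i * es (s.erase i) x k :=
      fun i hi => by rw [es_erase hi]; ring
    rw [Finset.sum_congr rfl h', Finset.sum_sub_distrib, h]
    simp; ring

open Polynomial in
/-- The polynomial `∏ (1 + x i T)`. -/
def esPoly (s : Finset ι) (x : ι → ℝ) : ℝ[X] := ∏ i ∈ s, (C (x i) * X + 1)

open Polynomial in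
lemma coeff_esPoly (s : Finset ι) (x : ι → ℝ) (k : ℕ) : (esPoly s x).coeff k = es s x k := by
  induction s using Finset.induction_on generalizing k with
  | empty =>
    rcases k with _ | k
    · simp [esPoly]
    · simp [esPoly, es_empty, coeff_one]
  | insert a s ha ih =>
    have e : esPoly (insert a s) x = C (x a) * (X * esPoly s x) + esPoly s x := by
      rw [esPoly, Finset.prod_insert ha]; unfold esPoly; ring
    rw [e, coeff_add, coeff_C_mul]
    rcases k with _ | k
    · simp [ih]
    · rw [coeff_X_mul, ih, ih, es_insert ha]

open Polynomial in
lemma natDegree_esPoly (s : Finset ι) (x : ι → ℝ) : (esPoly s x).natDegree ≤ s.card := by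
  unfold esPoly
  refine (natDegree_prod_le _ _).trans ?_
  refine (Finset.sum_le_sum (g := fun _ => 1) fun i _ => ?_).trans (by simp)
  exact natDegree_linear_le

open Polynomial in
lemma splits_esPoly (s : Finset ι) (x : ι → ℝ) : (esPoly s x).Splits := by
  unfold esPoly
  refine Splits.prod fun i _ => ?_
  exact Splits.of_natDegree_le_one natDegree_linear_le

open Polynomial in
-- By Rolle's theorem, differentiation costs at most one real root counted with multiplicity, which
-- is the drop in degree.
lemma splits_derivative {p : ℝ[X]} (hp : p.Splits) : (derivative p).Splits := by
  rw [splits_iff_card_roots] at hp ⊢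
  refine le_antisymm (card_roots' _) ?_
  have := card_roots_le_derivative p
  have := natDegree_derivative_le p
  omega

open Polynomial in
/-- Laguerre's inequality. -/
lemma laguerre {p : ℝ[X]} (hp : p.Splits) (t : ℝ) :
    p.eval t * (derivative (derivative p)).eval t ≤ (derivative p).eval t ^ 2 := by
  have key : ∀ m : Multiset ℝ, ((m.map fun a => X - C a).prod).eval t *
      (derivative (derivative (m.map fun a => X - C a).prod)).eval t ≤
      (derivative (m.map fun a => X - C a).prod).eval t ^ 2 := by
    intro m
    induction m using Multiset.induction_on with
    | empty => simp
    | cons a m ih =>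
      simp only [Multiset.map_cons, Multiset.prod_cons, derivative_mul, derivative_sub,
        derivative_X, derivative_C, derivative_add, eval_add, eval_mul, eval_sub, eval_X, eval_C,
        sub_zero, one_mul]
      -- For p = (X - a) q the difference of the two sides is q² + (t - a)² (q'² - q q'').
      nlinarith [mul_le_mul_of_nonneg_left ih (sq_nonneg (t - a)),
        sq_nonneg (eval t (m.map fun a => X - C a).prod)]
  rw [hp.eq_prod_roots]
  simp only [derivative_C_mul, eval_mul, eval_C]
  nlinarith [mul_le_mul_of_nonneg_left (key p.roots) (sq_nonneg p.leadingCoeff)]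

open Polynomial in
/-- Newton's inequality, without the binomial factors. -/
lemma newton_ineq (s : Finset ι) (x : ι → ℝ) (k : ℕ) :
    es s x k * es s x (k + 2) ≤ es s x (k + 1) ^ 2 := by
  have hs : ∀ j : ℕ, (derivative^[j] (esPoly s x)).Splits := by
    intro j
    induction j with
    | zero => simpa using splits_esPoly s x
    | succ j ih => rw [Function.iterate_succ_apply']; exact splits_derivative ih
  have hc : ∀ j : ℕ, (derivative^[j] (esPoly s x)).eval 0 = j.factorial * es s x j := by
    intro j
    rw [← coeff_zero_eq_eval_zero, coeff_iterate_derivative, coeff_esPoly]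
    simp [Nat.descFactorial_self]
  -- The k-th derivative of the real-rooted polynomial ∏ (1 + x_i T) takes the value k! σ_k at 0.
  have h := laguerre (hs k) 0
  rw [← Function.iterate_succ_apply' derivative, ← Function.iterate_succ_apply' derivative, hc, hc,
    hc] at h
  simp only [Nat.factorial_succ] at h
  push_cast at h
  set c : ℝ := (k.factorial : ℝ)
  have hcpos : 0 < c := by positivity
  have hk : (0 : ℝ) ≤ k := by positivity
  set a := es s x k
  set b := es s x (k + 1)
  set d := es s x (k + 2)
  have h2 : (k + 2) * (a * d) ≤ (k + 1) * b ^ 2 := by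
    have h1 : (c ^ 2 * (k + 1)) * ((k + 2) * (a * d)) ≤ (c ^ 2 * (k + 1)) * ((k + 1) * b ^ 2) := by
      nlinarith [h]
    exact le_of_mul_le_mul_left h1 (by positivity)
  rcases le_or_gt (a * d) 0 with h0 | h0
  · exact h0.trans (sq_nonneg b)
  · nlinarith

/-! ### The Gårding cones -/

/-- The cone `Γ_k` in the variables indexed by `s`. -/
def Cone (s : Finset ι) (k : ℕ) (x : ι → ℝ) : Prop := ∀ j ≤ k, 0 < es s x j

lemma Cone.mono {s : Finset ι} {k l : ℕ} {x : ι → ℝ} (h : Cone s k x) (hl : l ≤ k) :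
    Cone s l x := fun j hj => h j (hj.trans hl)

lemma cone_zero (s : Finset ι) (x : ι → ℝ) : Cone s 0 x := fun j hj => by
  rw [Nat.le_zero.1 hj]; simp

lemma cone_succ {s : Finset ι} {k : ℕ} {x : ι → ℝ} :
    Cone s (k + 1) x ↔ Cone s k x ∧ 0 < es s x (k + 1) := by
  refine ⟨fun h => ⟨h.mono k.le_succ, h _ le_rfl⟩, fun h j hj => ?_⟩
  rcases Nat.le_succ_iff.1 hj with h' | rfl
  · exact h.1 j h'
  · exact h.2

/-- If the next function B of the shorter tuple were nonpositive, with neighbours A > 0 and D,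
positivity of σ_{k+1} and σ_{k+2} of the full tuple would force A D > B², against Newton's
inequality. -/
lemma Cone.erase {s : Finset ι} {k : ℕ} {x : ι → ℝ} (h : Cone s (k + 1) x) {a : ι} (ha : a ∈ s) :
    Cone (s.erase a) k x := by
  induction k with
  | zero => exact cone_zero _ _
  | succ k ih =>
    have hk := ih (h.mono (Nat.le_succ _))
    refine cone_succ.2 ⟨hk, ?_⟩
    by_contra hneg
    have h0 := hk k le_rfl
    have h1 := h (k + 1) (Nat.le_succ _)
    have h2 := h (k + 2) le_rfl
    rw [es_erase ha] at h1 h2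
    have hN := newton_ineq (s.erase a) x k
    set A := es (s.erase a) x k
    set B := es (s.erase a) x (k + 1)
    set D := es (s.erase a) x (k + 2)
    have h3 : 0 < A * (x a * B + D) := mul_pos h0 h2
    have h4 : 0 ≤ -B * (x a * A + B) := mul_nonneg (by linarith) h1.le
    nlinarith

lemma Cone.es_erase_pos {s : Finset ι} {k : ℕ} {x : ι → ℝ} (h : Cone s (k + 1) x) {a : ι}
    (ha : a ∈ s) : 0 < es (s.erase a) x k := h.erase ha k le_rfl

/-- The function a²/c is convex and homogeneous of degree one, hence subadditive, and it decreases
in the denominator. -/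
lemma add_sq_div_add_le {a b c d e : ℝ} (hc : 0 < c) (hd : 0 < d) (he : c + d ≤ e) :
    (a + b) ^ 2 / e ≤ a ^ 2 / c + b ^ 2 / d := by
  have h1 : (a + b) ^ 2 / e ≤ (a + b) ^ 2 / (c + d) :=
    div_le_div_of_nonneg_left (sq_nonneg _) (by positivity) he
  refine h1.trans ?_
  rw [div_add_div _ _ hc.ne' hd.ne', div_le_div_iff₀ (by positivity) (by positivity)]
  nlinarith [sq_nonneg (a * d - b * c), mul_pos hc hd]

/-- The quotient `σ_{k+1} / σ_k` in terms of the quotients `σ_k / σ_{k-1}` in one variable less. -/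
lemma es_quotient {s : Finset ι} {k : ℕ} {x : ι → ℝ} (h : Cone s (k + 1) x) :
    (k + 2) * (es s x (k + 2) / es s x (k + 1)) = es s x 1 -
      ∑ i ∈ s, x i ^ 2 / (x i + es (s.erase i) x (k + 1) / es (s.erase i) x k) := by
  have hpos := h (k + 1) le_rfl
  -- The denominator equals σ_{k+1}(x) / σ_k(x without i), and x_i σ_k(x without i) = σ_{k+1}(x) -
  -- σ_{k+1}(x without i). Summation then uses Euler's relation.
  have h1 : ∀ i ∈ s, x i ^ 2 / (x i + es (s.erase i) x (k + 1) / es (s.erase i) x k) =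
      x i - x i * es (s.erase i) x (k + 1) / es s x (k + 1) := by
    intro i hi
    have h0 := h.es_erase_pos hi
    have h2 := es_erase hi x k
    have h3 : x i + es (s.erase i) x (k + 1) / es (s.erase i) x k =
        es s x (k + 1) / es (s.erase i) x k := by
      rw [h2]; field_simp
    rw [h3, h2]
    rw [h2] at hpos
    field_simp
    ring
  rw [Finset.sum_congr rfl h1, Finset.sum_sub_distrib, es_one, ← Finset.sum_div,
    sum_mul_es_erase]
  push_cast
  ring

/-- `Γ_k` is closed under addition and `σ_{k+1} / σ_k` is superadditive on it. -/
lemma Cone.add {k : ℕ} : ∀ {s : Finset ι} {x y : ι → ℝ}, Cone s k x → Cone s k y →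
    Cone s k (x + y) ∧ es s x (k + 1) / es s x k + es s y (k + 1) / es s y k ≤
      es s (x + y) (k + 1) / es s (x + y) k := by
  induction k with
  | zero =>
    intro s x y _ _
    refine ⟨cone_zero _ _, ?_⟩
    simp [es_one, Finset.sum_add_distrib]
  | succ k ih =>
    intro s x y hx hy
    obtain ⟨h1, h2⟩ := ih (hx.mono k.le_succ) (hy.mono k.le_succ)
    -- The inductive inequality has positive quotients on the left, so the numerator σ_{k+1}(x + y)
    -- is positive too.
    have hxy : Cone s (k + 1) (x + y) := by
      refine cone_succ.2 ⟨h1, ?_⟩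
      have := div_pos (hx (k + 1) le_rfl) (hx k k.le_succ)
      have := div_pos (hy (k + 1) le_rfl) (hy k k.le_succ)
      have h3 : 0 < es s (x + y) (k + 1) / es s (x + y) k := by linarith
      exact (div_pos_iff_of_pos_right (h1 k le_rfl)).1 h3
    refine ⟨hxy, ?_⟩
    have hk : (0 : ℝ) < k + 2 := by positivity
    refine le_of_mul_le_mul_left ?_ hk
    rw [mul_add, es_quotient hx, es_quotient hy, es_quotient hxy]
    have h1' : es s (x + y) 1 = es s x 1 + es s y 1 := by
      simp [es_one, Finset.sum_add_distrib]
    have hq : ∀ z : ι → ℝ, Cone s (k + 1) z → ∀ i ∈ s,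
        0 < z i + es (s.erase i) z (k + 1) / es (s.erase i) z k := by
      intro z hz i hi
      have h0 := hz.es_erase_pos hi
      have : z i + es (s.erase i) z (k + 1) / es (s.erase i) z k =
          es s z (k + 1) / es (s.erase i) z k := by
        rw [es_erase hi]; field_simp
      rw [this]
      exact div_pos (hz _ le_rfl) h0
    -- By induction the quotients in one variable less are superadditive, so each denominator on the
    -- left dominates the sum of the two on the right.
    have hsum : ∑ i ∈ s, (x + y) i ^ 2 /
        ((x + y) i + es (s.erase i) (x + y) (k + 1) / es (s.erase i) (x + y) k) ≤
        ∑ i ∈ s, (x i ^ 2 / (x i + es (s.erase i) x (k + 1) / es (s.erase i) x k) +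
          y i ^ 2 / (y i + es (s.erase i) y (k + 1) / es (s.erase i) y k)) := by
      refine Finset.sum_le_sum fun i hi => ?_
      refine add_sq_div_add_le (hq x hx i hi) (hq y hy i hi) ?_
      have := (ih (hx.erase hi) (hy.erase hi)).2
      simp only [Pi.add_apply]
      linarith
    rw [Finset.sum_add_distrib] at hsum
    linarith

/-- Midpoint form of the log-concavity of `σ_k / σ_1`. -/
lemma Cone.midpoint {k : ℕ} {s : Finset ι} {x y z : ι → ℝ} (hk : 1 ≤ k) (hx : Cone s k x)
    (hy : Cone s k y) (hz : Cone s k z) (h : x + y = (2 : ℝ) • z) :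
    es s x k * es s y k * es s z 1 ^ 2 ≤ es s z k ^ 2 * (es s x 1 * es s y 1) := by
  induction k, hk using Nat.le_induction with
  | base => exact le_of_eq (by ring)
  | succ k hk ih =>
    have ih := ih (hx.mono k.le_succ) (hy.mono k.le_succ) (hz.mono k.le_succ)
    have hs := ((hx.mono k.le_succ).add (hy.mono k.le_succ)).2
    rw [h, es_smul, es_smul] at hs
    have px := hx k k.le_succ
    have py := hy k k.le_succ
    have pz := hz k k.le_succ
    have px' := hx (k + 1) le_rfl
    have py' := hy (k + 1) le_rfl
    have pz' := hz (k + 1) le_rfl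
    have px1 := hx 1 (by omega)
    have py1 := hy 1 (by omega)
    set a := es s x (k + 1) / es s x k with ha
    set b := es s y (k + 1) / es s y k with hb
    set c := es s z (k + 1) / es s z k with hc
    have hc2 : 2 ^ (k + 1) * es s z (k + 1) / (2 ^ k * es s z k) = 2 * c := by
      rw [hc]; field_simp; ring
    rw [hc2] at hs
    have ha0 : 0 < a := div_pos px' px
    have hb0 : 0 < b := div_pos py' py
    -- Superadditivity at x + y = 2z says a + b ≤ 2c; the product bound follows from the
    -- arithmetic-geometric mean.
    have hab : a * b ≤ c ^ 2 := by nlinarith [sq_nonneg (a - b)]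
    have ea : es s x (k + 1) = a * es s x k := by rw [ha]; field_simp
    have eb : es s y (k + 1) = b * es s y k := by rw [hb]; field_simp
    have ec : es s z (k + 1) = c * es s z k := by rw [hc]; field_simp
    rw [ea, eb, ec]
    calc a * es s x k * (b * es s y k) * es s z 1 ^ 2
        = (a * b) * (es s x k * es s y k * es s z 1 ^ 2) := by ring
      _ ≤ c ^ 2 * (es s z k ^ 2 * (es s x 1 * es s y 1)) :=
        mul_le_mul hab ih (by positivity) (by positivity)
      _ = (c * es s z k) ^ 2 * (es s x 1 * es s y 1) := by ring

/-- The second derivative is nonnegative at a local minimum. -/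
lemma _root_.IsLocalMin.deriv_deriv_nonneg {f : ℝ → ℝ} {a : ℝ} (h : IsLocalMin f a)
    (hc : ContinuousAt f a) : 0 ≤ deriv (deriv f) a := by
  by_contra hneg
  -- With a negative second derivative the point is a maximum as well, so f is locally constant, a
  -- contradiction.
  have hmax : IsLocalMax f a := isLocalMax_of_deriv_deriv_neg (not_le.1 hneg) h.deriv_eq_zero hc
  have hconst : f =ᶠ[nhds a] fun _ => f a := by
    filter_upwards [h, hmax] with t h1 h2 using le_antisymm h2 h1
  have h2 := hconst.deriv.deriv_eq
  simp at h2
  rw [h2] at hneg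
  exact hneg le_rfl

/-- Concavity of `log (σ_k / σ_1)` on `Γ_k`, in infinitesimal form. -/
lemma Cone.hessian_le {k : ℕ} {s : Finset ι} {x : ι → ℝ} (hx : Cone s (k + 2) x) (y : ι → ℝ) :
    es s x (k + 2) * es s x 1 ^ 2 *
        ∑ i ∈ s, y i * ∑ j ∈ s.erase i, y j * es ((s.erase i).erase j) x k ≤
      (es s x 1 * ∑ i ∈ s, y i * es (s.erase i) x (k + 1)) ^ 2 -
        (es s x (k + 2) * ∑ i ∈ s, y i) ^ 2 := by
  set p : ℝ → ℝ := fun t => es s (x + t • y) (k + 2) with hp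
  set p1 : ℝ → ℝ := fun t => ∑ i ∈ s, y i * es (s.erase i) (x + t • y) (k + 1) with hp1
  set p2 : ℝ → ℝ := fun t => ∑ i ∈ s, y i *
    ∑ j ∈ s.erase i, y j * es ((s.erase i).erase j) (x + t • y) k with hp2
  set q : ℝ → ℝ := fun t => es s (x + t • y) 1 with hq
  set S := ∑ i ∈ s, y i with hS
  have dp : ∀ t, HasDerivAt p (p1 t) t := fun t => hasDerivAt_es s x y (k + 1) t
  have dp1 : ∀ t, HasDerivAt p1 (p2 t) t := fun t =>
    HasDerivAt.fun_sum fun i _ => (hasDerivAt_es (s.erase i) x y k t).const_mul (y i)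
  have dq : ∀ t, HasDerivAt q S t := fun t => by
    simpa [hS] using hasDerivAt_es s x y 0 t
  have dneg : ∀ {f : ℝ → ℝ} {f' t : ℝ}, HasDerivAt f f' (-t) →
      HasDerivAt (fun t => f (-t)) (-f') t := by
    intro f f' t hf
    exact (hf.scomp t (hasDerivAt_neg t)).congr_deriv (by simp)
  set a := es s x (k + 2) with ha
  set b := es s x 1 with hb
  -- `Cone.midpoint` for the points x ± t y makes g nonnegative near 0, where it vanishes. The claim
  -- is g''(0) ≥ 0.
  set g : ℝ → ℝ := fun t => a ^ 2 * (q t * q (-t)) - p t * p (-t) * b ^ 2 with hg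
  set g1 : ℝ → ℝ := fun t => a ^ 2 * (S * q (-t) + q t * (-S)) -
    (p1 t * p (-t) + p t * (-p1 (-t))) * b ^ 2 with hg1
  have dg : ∀ t, HasDerivAt g (g1 t) t := fun t =>
    (((dq t).mul (dneg (dq (-t)))).const_mul (a ^ 2)).sub
      (((dp t).mul (dneg (dp (-t)))).mul_const (b ^ 2))
  have dg1 : HasDerivAt g1 (a ^ 2 * (S * (-S) + S * (-S)) -
      ((p2 0 * p (-0) + p1 0 * (-p1 (-0))) + (p1 0 * (-p1 (-0)) + p 0 * (-(-p2 (-0))))) * b ^ 2) 0 :=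
    ((((dneg (dq (-0))).const_mul S).add ((dq 0).mul_const (-S))).const_mul (a ^ 2)).sub
      ((((dp1 0).mul (dneg (dp (-0)))).add
        ((dp 0).mul (dneg (dp1 (-0))).neg)).mul_const (b ^ 2))
  have hcont : ∀ j, Continuous fun t : ℝ => es s (x + t • y) j := by
    intro j
    rcases j with _ | j
    · simpa using continuous_const
    · exact continuous_iff_continuousAt.2 fun t => (hasDerivAt_es s x y j t).continuousAt
  have hcone : ∀ᶠ t in nhds (0 : ℝ), Cone s (k + 2) (x + t • y) := by
    have : ∀ᶠ t in nhds (0 : ℝ), ∀ j ∈ Finset.range (k + 3), 0 < es s (x + t • y) j := by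
      rw [Filter.eventually_all_finset]
      intro j hj
      refine (hcont j).continuousAt.eventually_const_lt ?_
      simpa using hx j (by have := Finset.mem_range.1 hj; omega)
    filter_upwards [this] with t ht j hj using ht j (Finset.mem_range.2 (by omega))
  have hcone' : ∀ᶠ t in nhds (0 : ℝ), Cone s (k + 2) (x + (-t) • y) := by
    have : Filter.Tendsto (fun t : ℝ => -t) (nhds 0) (nhds 0) := by
      simpa using (continuous_neg (G := ℝ)).tendsto 0
    exact this.eventually hcone
  have hmin : IsLocalMin g 0 := by
    have g0 : g 0 = 0 := by simp [hg, hq, hp, ha, hb]; ring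
    filter_upwards [hcone, hcone'] with t h1 h2
    rw [g0]
    have := Cone.midpoint (by omega) h1 h2 hx (by ext i; simp; ring)
    simp only [hg, hp, hq, ha, hb]
    linarith
  have h2 := hmin.deriv_deriv_nonneg (dg 0).continuousAt
  have e1 : deriv g = g1 := funext fun t => (dg t).deriv
  rw [e1, dg1.deriv] at h2
  have ep : p 0 = a := by simp [hp, ha]
  have ep1 : p1 0 = ∑ i ∈ s, y i * es (s.erase i) x (k + 1) := by simp [hp1]
  have ep2 : p2 0 = ∑ i ∈ s, y i * ∑ j ∈ s.erase i, y j * es ((s.erase i).erase j) x k := by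
    simp [hp2]
  rw [neg_zero, ep] at h2
  rw [← ep1, ← ep2]
  nlinarith [h2]

end es

/-! ### Partial derivatives -/

section pd

variable {V : Type*} [NormedAddCommGroup V] [NormedSpace ℝ V]

/-- The derivative of `f` in the direction `v`. -/
def pd (v : V) (f : V → ℝ) (X : V) : ℝ := fderiv ℝ f X v

variable {v w : V} {f g : V → ℝ} {X : V}

lemma pd_congr (h : f =ᶠ[nhds X] g) : pd v f =ᶠ[nhds X] pd v g := by
  filter_upwards [h.eventuallyEq_nhds] with Y hY
  simp [pd, hY.fderiv_eq]

lemma pd_congr_point (h : f =ᶠ[nhds X] g) : pd v f X = pd v g X := (pd_congr h).eq_of_nhds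

@[simp] lemma pd_const (a : ℝ) : pd v (fun _ => a) X = 0 := by
  simp [pd]

lemma pd_add (hf : DifferentiableAt ℝ f X) (hg : DifferentiableAt ℝ g X) :
    pd v (fun Y => f Y + g Y) X = pd v f X + pd v g X := by
  simp [pd, fderiv_fun_add hf hg]

lemma pd_mul (hf : DifferentiableAt ℝ f X) (hg : DifferentiableAt ℝ g X) :
    pd v (fun Y => f Y * g Y) X = f X * pd v g X + pd v f X * g X := by
  simp [pd, fderiv_fun_mul hf hg]; ring

lemma pd_const_mul (a : ℝ) (hf : DifferentiableAt ℝ f X) :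
    pd v (fun Y => a * f Y) X = a * pd v f X := by
  simp [pd, fderiv_const_mul hf]

lemma pd_sum {κ : Type*} {s : Finset κ} {f : κ → V → ℝ} (hf : ∀ i ∈ s, DifferentiableAt ℝ (f i) X) :
    pd v (fun Y => ∑ i ∈ s, f i Y) X = ∑ i ∈ s, pd v (f i) X := by
  simp [pd, fderiv_fun_sum hf]

lemma contDiffAt_pd {m n : WithTop ℕ∞} (hf : ContDiffAt ℝ n f X) (hmn : m + 1 ≤ n) :
    ContDiffAt ℝ m (pd v f) X :=
  (hf.fderiv_right hmn).clm_apply contDiffAt_const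

lemma pd_comm (hf : ContDiffAt ℝ 2 f X) : pd v (pd w f) X = pd w (pd v f) X := by
  have h1 : DifferentiableAt ℝ (fderiv ℝ f) X :=
    (hf.fderiv_right (m := 1) (by norm_num)).differentiableAt (by norm_num)
  have h2 : ∀ a b : V, pd a (pd b f) X = fderiv ℝ (fderiv ℝ f) X a b := by
    intro a b
    have : pd b f = fun Y => fderiv ℝ f Y b := rfl
    rw [pd, this, fderiv_clm_apply h1 (differentiableAt_const b)]
    simp
  rw [h2, h2]
  exact hf.isSymmSndFDerivAt (by simp) v w

lemma differentiableAt_prod {κ : Type*} [DecidableEq κ] {s : Finset κ} {f : κ → V → ℝ}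
    (hf : ∀ i ∈ s, DifferentiableAt ℝ (f i) X) :
    DifferentiableAt ℝ (fun Y => ∏ i ∈ s, f i Y) X :=
  (HasFDerivAt.finsetProd fun i hi => (hf i hi).hasFDerivAt).differentiableAt

lemma pd_prod {κ : Type*} [DecidableEq κ] {s : Finset κ} {f : κ → V → ℝ}
    (hf : ∀ i ∈ s, DifferentiableAt ℝ (f i) X) :
    pd v (fun Y => ∏ i ∈ s, f i Y) X = ∑ i ∈ s, pd v (f i) X * ∏ j ∈ s.erase i, f j X := by
  have h := HasFDerivAt.finsetProd fun i hi => (hf i hi).hasFDerivAt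
  rw [pd, h.fderiv]
  simp [pd, mul_comm]

end pd

/-! ### Derivatives of determinants -/

section det

variable {V : Type*} [NormedAddCommGroup V] [NormedSpace ℝ V]
variable {ι : Type*} [Fintype ι] [DecidableEq ι]

lemma pd_det {v : V} {M : V → Matrix ι ι ℝ} {X : V}
    (hM : ∀ i j, DifferentiableAt ℝ (fun Y => M Y i j) X) :
    pd v (fun Y => (M Y).det) X =
      ∑ i, ((M X).updateCol i fun r => pd v (fun Y => M Y r i) X).det := by
  have hP : ∀ σ : Equiv.Perm ι, DifferentiableAt ℝ (fun Y => ∏ i, M Y (σ i) i) X := fun σ =>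
    differentiableAt_prod (f := fun i Y => M Y (σ i) i) fun i _ => hM _ _
  have e : (fun Y => (M Y).det) =
      fun Y => ∑ σ : Equiv.Perm ι, ((Equiv.Perm.sign σ : ℤ) : ℝ) * ∏ i, M Y (σ i) i :=
    funext fun Y => Matrix.det_apply' _
  rw [e, pd_sum (f := fun (σ : Equiv.Perm ι) Y =>
    ((Equiv.Perm.sign σ : ℤ) : ℝ) * ∏ i, M Y (σ i) i) fun σ _ => (hP σ).const_mul _]
  simp only [Matrix.det_apply']
  rw [Finset.sum_comm]
  refine Finset.sum_congr rfl fun σ _ => ?_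
  refine (pd_const_mul _ (hP σ)).trans ?_
  rw [pd_prod (f := fun i Y => M Y (σ i) i) fun i _ => hM _ _, Finset.mul_sum]
  refine Finset.sum_congr rfl fun i _ => ?_
  rw [← Finset.mul_prod_erase Finset.univ _ (Finset.mem_univ i)]
  congr 2
  · simp
  · refine Finset.prod_congr rfl fun j hj => ?_
    rw [Matrix.updateCol_ne (Finset.ne_of_mem_erase hj)]

lemma differentiableAt_det {M : V → Matrix ι ι ℝ} {X : V}
    (hM : ∀ i j, DifferentiableAt ℝ (fun Y => M Y i j) X) :
    DifferentiableAt ℝ (fun Y => (M Y).det) X := by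
  have e : (fun Y => (M Y).det) =
      fun Y => ∑ σ : Equiv.Perm ι, ((Equiv.Perm.sign σ : ℤ) : ℝ) * ∏ i, M Y (σ i) i :=
    funext fun Y => Matrix.det_apply' _
  rw [e]
  exact DifferentiableAt.fun_sum fun σ _ => (differentiableAt_prod
    (f := fun i Y => M Y (σ i) i) fun i _ => hM _ _).const_mul _

lemma contDiffAt_det {n : WithTop ℕ∞} {M : V → Matrix ι ι ℝ} {X : V}
    (hM : ∀ i j, ContDiffAt ℝ n (fun Y => M Y i j) X) :
    ContDiffAt ℝ n (fun Y => (M Y).det) X := by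
  simp only [Matrix.det_apply']
  exact ContDiffAt.sum fun σ _ => contDiffAt_const.mul (contDiffAt_prod fun i _ => hM _ _)

lemma det_diagonal_updateCol (m : ι → ℝ) (i : ι) (c : ι → ℝ) :
    ((Matrix.diagonal m).updateCol i c).det = c i * ∏ l ∈ Finset.univ.erase i, m l := by
  rw [← Matrix.cramer_apply, Matrix.cramer_eq_adjugate_mulVec, Matrix.adjugate_diagonal,
    Matrix.mulVec_diagonal, mul_comm]

/-- In the Leibniz expansion a permutation that moves an index outside {i, j} meets an off-diagonal
zero. Only the identity and the transposition survive, giving a 2 × 2 minor. -/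
lemma det_diagonal_updateCol_updateCol (m : ι → ℝ) {i j : ι} (hij : i ≠ j) (c c' : ι → ℝ) :
    (((Matrix.diagonal m).updateCol i c).updateCol j c').det =
      (c i * c' j - c j * c' i) * ∏ l ∈ (Finset.univ.erase i).erase j, m l := by
  set M := ((Matrix.diagonal m).updateCol i c).updateCol j c' with hM
  have hMj : ∀ r, M r j = c' r := fun r => by simp [hM]
  have hMi : ∀ r, M r i = c r := fun r => by simp [hM, Matrix.updateCol_ne hij]
  have hMl : ∀ r l, l ≠ i → l ≠ j → M r l = Matrix.diagonal m r l := fun r l h1 h2 => by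
    rw [hM, Matrix.updateCol_ne h2, Matrix.updateCol_ne h1]
  have hji : j ∈ Finset.univ.erase i := Finset.mem_erase.2 ⟨hij.symm, Finset.mem_univ j⟩
  have hprod : ∀ σ : Equiv.Perm ι, ∏ l, M (σ l) l =
      c (σ i) * (c' (σ j) * ∏ l ∈ (Finset.univ.erase i).erase j, M (σ l) l) := by
    intro σ
    rw [← Finset.mul_prod_erase Finset.univ _ (Finset.mem_univ i),
      ← Finset.mul_prod_erase (Finset.univ.erase i) _ hji, hMi, hMj]
  have hrest : ∀ σ : Equiv.Perm ι, (∀ l, l ≠ i → l ≠ j → σ l = l) →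
      ∏ l ∈ (Finset.univ.erase i).erase j, M (σ l) l =
      ∏ l ∈ (Finset.univ.erase i).erase j, m l := by
    intro σ hσ
    refine Finset.prod_congr rfl fun l hl => ?_
    have h1 := Finset.ne_of_mem_erase hl
    have h2 := Finset.ne_of_mem_erase (Finset.mem_of_mem_erase hl)
    rw [hσ l h2 h1, hMl l l h2 h1, Matrix.diagonal_apply_eq]
  rw [Matrix.det_apply', Finset.sum_eq_add (1 : Equiv.Perm ι) (Equiv.swap i j)]
  · rw [hprod, hprod, hrest 1 (by simp), hrest _ fun l h1 h2 => Equiv.swap_apply_of_ne_of_ne h1 h2,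
      Equiv.Perm.sign_swap hij]
    simp
    ring
  · intro h
    have := congrArg (fun σ => σ i) h
    simp at this
    exact hij this
  · rintro σ - ⟨h1, h2⟩
    have : ∃ l, l ≠ i ∧ l ≠ j ∧ σ l ≠ l := by
      by_contra hcon
      push Not at hcon
      have hi : σ i = i ∨ σ i = j := by
        by_contra h
        push Not at h
        have := hcon _ h.1 h.2
        exact h.1 (σ.injective this)
      have hj : σ j = i ∨ σ j = j := by
        by_contra h
        push Not at h
        have := hcon _ h.1 h.2
        exact h.2 (σ.injective this)
      rcases hi with hi | hi
      · have hj' : σ j = j := hj.resolve_left fun h => hij (σ.injective (hi.trans h.symm))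
        apply h1
        ext l
        by_cases hl : l = i
        · rw [hl, hi]; rfl
        by_cases hl' : l = j
        · rw [hl', hj']; rfl
        exact hcon l hl hl'
      · have hj' : σ j = i := hj.resolve_right fun h => hij (σ.injective (hi.trans h.symm))
        apply h2
        ext l
        by_cases hl : l = i
        · rw [hl, hi, Equiv.swap_apply_left]
        by_cases hl' : l = j
        · rw [hl', hj', Equiv.swap_apply_right]
        rw [hcon l hl hl', Equiv.swap_apply_of_ne_of_ne hl hl']
    obtain ⟨l, hl1, hl2, hl3⟩ := this
    rw [Finset.prod_eq_zero (Finset.mem_univ l), mul_zero]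
    rw [hMl _ l hl1 hl2, Matrix.diagonal_apply_ne _ hl3]
  · simp
  · simp

lemma pd_pd_det {v : V} {M : V → Matrix ι ι ℝ} {X : V} {m : ι → ℝ}
    (hM : ∀ i j, ContDiffAt ℝ 2 (fun Y => M Y i j) X) (hX : M X = Matrix.diagonal m) :
    pd v (pd v fun Y => (M Y).det) X =
      ∑ i, (pd v (pd v fun Y => M Y i i) X * ∏ l ∈ Finset.univ.erase i, m l +
        ∑ j ∈ Finset.univ.erase i,
          (pd v (fun Y => M Y i i) X * pd v (fun Y => M Y j j) X -
            pd v (fun Y => M Y j i) X * pd v (fun Y => M Y i j) X) *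
          ∏ l ∈ (Finset.univ.erase i).erase j, m l) := by
  have h1 : (pd v fun Y => (M Y).det) =ᶠ[nhds X]
      fun Y => ∑ i, ((M Y).updateCol i fun r => pd v (fun Z => M Z r i) Y).det := by
    have : ∀ᶠ Y in nhds X, ∀ i j, ContDiffAt ℝ 2 (fun Z => M Z i j) Y := by
      rw [Filter.eventually_all]; intro i
      rw [Filter.eventually_all]; intro j
      exact (hM i j).eventually (by simp)
    filter_upwards [this] with Y hY
    exact pd_det fun i j => (hY i j).differentiableAt (by norm_num)
  have hM1 : ∀ i j, DifferentiableAt ℝ (fun Y => M Y i j) X := fun i j =>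
    (hM i j).differentiableAt (by norm_num)
  have hM2 : ∀ i j, DifferentiableAt ℝ (pd v fun Y => M Y i j) X := fun i j =>
    (contDiffAt_pd (m := 1) (hM i j) (by norm_num)).differentiableAt (by norm_num)
  have hU : ∀ i r l, DifferentiableAt ℝ
      (fun Y => (M Y).updateCol i (fun r => pd v (fun Z => M Z r i) Y) r l) X := by
    intro i r l
    by_cases hl : l = i
    · subst hl; simpa using hM2 r l
    · simpa [Matrix.updateCol_ne hl] using hM1 r l
  rw [pd_congr_point h1, pd_sum]
  · refine Finset.sum_congr rfl fun i _ => ?_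
    rw [pd_det (hU i), ← Finset.add_sum_erase Finset.univ _ (Finset.mem_univ i)]
    congr 1
    · rw [hX]
      simp only [Matrix.updateCol_self, Matrix.updateCol_idem]
      rw [det_diagonal_updateCol]
    · refine Finset.sum_congr rfl fun j hj => ?_
      have hj' := Finset.ne_of_mem_erase hj
      rw [hX]
      simp only [Matrix.updateCol_ne hj']
      rw [det_diagonal_updateCol_updateCol _ hj'.symm]
  · intro i _
    have := contDiffAt_det (n := 1) (X := X)
      (M := fun Y => (M Y).updateCol i fun r => pd v (fun Z => M Z r i) Y) ?_
    · exact this.differentiableAt (by norm_num)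
    intro r l
    by_cases hl : l = i
    · subst hl; simpa using contDiffAt_pd (hM r l) (by norm_num)
    · simpa [Matrix.updateCol_ne hl] using (hM r l).of_le (by norm_num)

/-! ### Elementary symmetric functions of a matrix -/

/-- The Lagrange weights that extract the `k`-th coefficient of a polynomial of degree at most `N`
from its values at `0, …, N`. -/
def coeffWeight (N k i : ℕ) : ℝ :=
  (Lagrange.basis (Finset.range (N + 1)) (fun j : ℕ => (j : ℝ)) i).coeff k

open Polynomial in
-- Writing σ_k as a fixed linear combination of the determinants det (1 + z A), z = 0, …, N,
-- transfers smoothness and derivative formulas from determinants to σ_k.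
lemma sum_coeffWeight {N : ℕ} (k : ℕ) {p : ℝ[X]} (hp : p.natDegree ≤ N) :
    ∑ i ∈ Finset.range (N + 1), coeffWeight N k i * p.eval (i : ℝ) = p.coeff k := by
  have hinj : Set.InjOn (fun j : ℕ => (j : ℝ)) (Finset.range (N + 1)) :=
    fun a _ b _ h => Nat.cast_injective h
  have hdeg : p.degree < (Finset.range (N + 1)).card := by
    refine degree_le_natDegree.trans_lt ?_
    rw [Finset.card_range]
    exact_mod_cast Nat.lt_succ_of_le hp
  conv_rhs => rw [Lagrange.eq_interpolate hinj hdeg]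
  rw [Lagrange.interpolate_apply, finsetSum_coeff]
  refine Finset.sum_congr rfl fun i _ => ?_
  rw [coeff_C_mul, coeffWeight, mul_comm]

/-- The `k`-th elementary symmetric function of the eigenvalues of a matrix: the coefficient of
`z ^ k` in `det (1 + z A)`. -/
def sigmaMat (k : ℕ) (A : Matrix ι ι ℝ) : ℝ :=
  ∑ i ∈ Finset.range (Fintype.card ι + 1),
    coeffWeight (Fintype.card ι) k i * (1 + (i : ℝ) • A).det

lemma eval_esPoly (s : Finset ι) (x : ι → ℝ) (z : ℝ) :
    (esPoly s x).eval z = ∏ i ∈ s, (1 + z * x i) := by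
  rw [esPoly, Polynomial.eval_prod]
  refine Finset.prod_congr rfl fun i _ => ?_
  simp only [Polynomial.eval_add, Polynomial.eval_mul, Polynomial.eval_C, Polynomial.eval_X,
    Polynomial.eval_one]
  ring

lemma sigmaMat_eq_es {A : Matrix ι ι ℝ} {x : ι → ℝ}
    (h : ∀ z : ℝ, (1 + z • A).det = ∏ i, (1 + z * x i)) (k : ℕ) :
    sigmaMat k A = es Finset.univ x k := by
  rw [← coeff_esPoly, ← sum_coeffWeight k (natDegree_esPoly Finset.univ x)]
  simp only [sigmaMat, h, eval_esPoly, Finset.card_univ]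

lemma contDiffAt_sigmaMat {n : WithTop ℕ∞} (k : ℕ) {A : V → Matrix ι ι ℝ} {X : V}
    (hA : ∀ i j, ContDiffAt ℝ n (fun Y => A Y i j) X) :
    ContDiffAt ℝ n (fun Y => sigmaMat k (A Y)) X := by
  refine ContDiffAt.sum fun z _ => contDiffAt_const.mul (contDiffAt_det fun i j => ?_)
  simp only [Matrix.add_apply, Matrix.smul_apply, smul_eq_mul]
  exact contDiffAt_const.add (contDiffAt_const.mul (hA i j))

open Polynomial in
-- Differentiating j columns of 1 + z A produces the factor z ^ j. The cardinality condition keeps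
-- the degree within the range of the interpolation.
lemma sum_coeffWeight_mul_prod (s : Finset ι) (x : ι → ℝ) (j k : ℕ)
    (hs : s.card + j ≤ Fintype.card ι) :
    ∑ i ∈ Finset.range (Fintype.card ι + 1), coeffWeight (Fintype.card ι) (k + j) i *
      ((i : ℝ) ^ j * ∏ l ∈ s, (1 + (i : ℝ) * x l)) = es s x k := by
  have hdeg : (esPoly s x * X ^ j).natDegree ≤ Fintype.card ι := by
    refine natDegree_mul_le.trans ?_
    have := natDegree_esPoly s x
    have := natDegree_X_pow_le (R := ℝ) j
    omega
  have h := sum_coeffWeight (k + j) hdeg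
  rw [coeff_mul_X_pow, coeff_esPoly] at h
  rw [← h]
  refine Finset.sum_congr rfl fun i _ => ?_
  rw [eval_mul, eval_esPoly, eval_pow, eval_X]
  ring

variable {v : V} {A : V → Matrix ι ι ℝ} {X : V} {x : ι → ℝ}

lemma one_add_smul_diagonal (z : ℝ) (x : ι → ℝ) :
    1 + z • Matrix.diagonal x = Matrix.diagonal fun i => 1 + z * x i := by
  ext i j
  by_cases h : i = j
  · subst h; simp
  · simp [h]

lemma pd_sigmaMat (k : ℕ) (hA : ∀ i j, DifferentiableAt ℝ (fun Y => A Y i j) X)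
    (hX : A X = Matrix.diagonal x) :
    pd v (fun Y => sigmaMat (k + 1) (A Y)) X =
      ∑ i, pd v (fun Y => A Y i i) X * es (Finset.univ.erase i) x k := by
  have hM : ∀ z : ℝ, ∀ i j, DifferentiableAt ℝ (fun Y => (1 + z • A Y) i j) X := by
    intro z i j
    simp only [Matrix.add_apply, Matrix.smul_apply, smul_eq_mul]
    exact (differentiableAt_const _).add ((hA i j).const_mul z)
  have hd : ∀ z : ℝ, DifferentiableAt ℝ (fun Y => (1 + z • A Y).det) X := fun z =>
    differentiableAt_det (hM z)
  have hp : ∀ z : ℝ, ∀ i j, pd v (fun Y => (1 + z • A Y) i j) X =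
      z * pd v (fun Y => A Y i j) X := by
    intro z i j
    simp only [Matrix.add_apply, Matrix.smul_apply, smul_eq_mul]
    rw [pd_add (differentiableAt_const _) ((hA i j).const_mul z), pd_const, zero_add,
      pd_const_mul _ (hA i j)]
  unfold sigmaMat
  rw [pd_sum (f := fun (z : ℕ) Y => coeffWeight (Fintype.card ι) (k + 1) z *
    (1 + (z : ℝ) • A Y).det) fun z _ => (hd z).const_mul _]
  have h1 : ∀ z : ℕ, pd v (fun Y => coeffWeight (Fintype.card ι) (k + 1) z *
      (1 + (z : ℝ) • A Y).det) X = ∑ i, pd v (fun Y => A Y i i) X *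
      (coeffWeight (Fintype.card ι) (k + 1) z *
        ((z : ℝ) ^ 1 * ∏ l ∈ Finset.univ.erase i, (1 + (z : ℝ) * x l))) := by
    intro z
    rw [pd_const_mul _ (hd z), pd_det (hM z), Finset.mul_sum]
    refine Finset.sum_congr rfl fun i _ => ?_
    rw [hX, one_add_smul_diagonal, det_diagonal_updateCol, hp]
    ring
  rw [Finset.sum_congr rfl fun z _ => h1 z, Finset.sum_comm]
  refine Finset.sum_congr rfl fun i _ => ?_
  rw [← Finset.mul_sum, sum_coeffWeight_mul_prod]
  rw [Finset.card_erase_of_mem (Finset.mem_univ i), Finset.card_univ]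
  have := Fintype.card_pos_iff.2 ⟨i⟩
  omega

lemma pd_pd_sigmaMat (k : ℕ) (hA : ∀ i j, ContDiffAt ℝ 2 (fun Y => A Y i j) X)
    (hX : A X = Matrix.diagonal x) :
    pd v (pd v fun Y => sigmaMat (k + 2) (A Y)) X =
      ∑ i, (pd v (pd v fun Y => A Y i i) X * es (Finset.univ.erase i) x (k + 1) +
        ∑ j ∈ Finset.univ.erase i,
          (pd v (fun Y => A Y i i) X * pd v (fun Y => A Y j j) X -
            pd v (fun Y => A Y j i) X * pd v (fun Y => A Y i j) X) *
          es ((Finset.univ.erase i).erase j) x k) := by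
  have hM : ∀ z : ℝ, ∀ i j, ContDiffAt ℝ 2 (fun Y => (1 + z • A Y) i j) X := by
    intro z i j
    simp only [Matrix.add_apply, Matrix.smul_apply, smul_eq_mul]
    exact contDiffAt_const.add (contDiffAt_const.mul (hA i j))
  have hd : ∀ z : ℝ, ContDiffAt ℝ 2 (fun Y => (1 + z • A Y).det) X := fun z =>
    contDiffAt_det (hM z)
  have hev : ∀ i j, ∀ᶠ Y in nhds X, ContDiffAt ℝ 2 (fun Y => A Y i j) Y := fun i j =>
    (hA i j).eventually (by simp)
  have hp : ∀ z : ℝ, ∀ i j, (pd v fun Y => (1 + z • A Y) i j) =ᶠ[nhds X]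
      fun Y => z * pd v (fun Y => A Y i j) Y := by
    intro z i j
    filter_upwards [hev i j] with Y hY
    have hY' := hY.differentiableAt (by norm_num)
    simp only [Matrix.add_apply, Matrix.smul_apply, smul_eq_mul]
    rw [pd_add (differentiableAt_const _) (hY'.const_mul z), pd_const, zero_add,
      pd_const_mul _ hY']
  have hpp : ∀ z : ℝ, ∀ i j, pd v (pd v fun Y => (1 + z • A Y) i j) X =
      z * pd v (pd v fun Y => A Y i j) X := by
    intro z i j
    rw [pd_congr_point (hp z i j)]
    exact pd_const_mul _ ((contDiffAt_pd (m := 1) (hA i j) (by norm_num)).differentiableAt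
      (by norm_num))
  have hS : (pd v fun Y => sigmaMat (k + 2) (A Y)) =ᶠ[nhds X] fun Y =>
      ∑ z ∈ Finset.range (Fintype.card ι + 1),
        coeffWeight (Fintype.card ι) (k + 2) z * pd v (fun Y => (1 + (z : ℝ) • A Y).det) Y := by
    have : ∀ᶠ Y in nhds X, ∀ z ∈ Finset.range (Fintype.card ι + 1),
        ContDiffAt ℝ 2 (fun Y => (1 + (z : ℝ) • A Y).det) Y := by
      rw [Filter.eventually_all_finset]
      exact fun z _ => (hd z).eventually (by simp)
    filter_upwards [this] with Y hY
    unfold sigmaMat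
    rw [pd_sum fun z hz => ((hY z hz).differentiableAt (by norm_num)).const_mul _]
    exact Finset.sum_congr rfl fun z hz =>
      pd_const_mul _ ((hY z hz).differentiableAt (by norm_num))
  have hdd : ∀ z : ℝ, DifferentiableAt ℝ (pd v fun Y => (1 + z • A Y).det) X := fun z =>
    (contDiffAt_pd (m := 1) (hd z) (by norm_num)).differentiableAt (by norm_num)
  rw [pd_congr_point hS, pd_sum (f := fun (z : ℕ) Y => coeffWeight (Fintype.card ι) (k + 2) z *
    pd v (fun Y => (1 + (z : ℝ) • A Y).det) Y) fun z _ => (hdd z).const_mul _]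
  have h1 : ∀ z : ℕ, pd v (fun Y => coeffWeight (Fintype.card ι) (k + 2) z *
        pd v (fun Y => (1 + (z : ℝ) • A Y).det) Y) X =
      ∑ i, (pd v (pd v fun Y => A Y i i) X * (coeffWeight (Fintype.card ι) (k + 1 + 1) z *
        ((z : ℝ) ^ 1 * ∏ l ∈ Finset.univ.erase i, (1 + (z : ℝ) * x l))) +
        ∑ j ∈ Finset.univ.erase i,
          (pd v (fun Y => A Y i i) X * pd v (fun Y => A Y j j) X -
            pd v (fun Y => A Y j i) X * pd v (fun Y => A Y i j) X) *
          (coeffWeight (Fintype.card ι) (k + 2) z *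
            ((z : ℝ) ^ 2 * ∏ l ∈ (Finset.univ.erase i).erase j, (1 + (z : ℝ) * x l)))) := by
    intro z
    rw [pd_const_mul _ (hdd z), pd_pd_det (hM z) (m := fun i => 1 + (z : ℝ) * x i)
      (by rw [hX, one_add_smul_diagonal]), Finset.mul_sum]
    refine Finset.sum_congr rfl fun i _ => ?_
    rw [hpp, mul_add, Finset.mul_sum]
    congr 1
    · ring
    · refine Finset.sum_congr rfl fun j _ => ?_
      rw [(hp z i i).eq_of_nhds, (hp z j j).eq_of_nhds, (hp z i j).eq_of_nhds,
        (hp z j i).eq_of_nhds]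
      ring
  rw [Finset.sum_congr rfl fun z _ => h1 z, Finset.sum_comm]
  refine Finset.sum_congr rfl fun i _ => ?_
  have hi := Fintype.card_pos_iff.2 ⟨i⟩
  have hci : (Finset.univ.erase i).card = Fintype.card ι - 1 := by
    rw [Finset.card_erase_of_mem (Finset.mem_univ i), Finset.card_univ]
  rw [Finset.sum_add_distrib]
  congr 1
  · rw [← Finset.mul_sum, sum_coeffWeight_mul_prod _ _ 1 (k + 1) (by omega)]
  · rw [Finset.sum_comm]
    refine Finset.sum_congr rfl fun j hj => ?_
    have hcj := Finset.card_pos.2 ⟨j, hj⟩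
    rw [← Finset.mul_sum, sum_coeffWeight_mul_prod _ _ 2 k]
    rw [Finset.card_erase_of_mem hj]
    omega

end det

open Filter Topology

/-! ### Extensions along rays -/

lemma radialExt_smul {n : ℕ} (f : S n → ℝ) {c : ℝ} (hc : 0 < c) (X : E n) :
    radialExt f (c • X) = radialExt f X := by
  unfold radialExt
  by_cases h : X = 0
  · simp [h]
  · have h' : c • X ≠ 0 := smul_ne_zero hc.ne' h
    rw [dif_neg h, dif_neg h']
    congr 2
    rw [norm_smul, smul_smul, Real.norm_of_nonneg hc.le]
    congr 1
    field_simp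

lemma radialExt_coe {n : ℕ} (f : S n → ℝ) (x : S n) : radialExt f (x : E n) = f x := by
  have hx : ‖(x : E n)‖ = 1 := mem_sphere_zero_iff_norm.1 x.2
  have h0 : (x : E n) ≠ 0 := by
    intro h; rw [h, norm_zero] at hx; exact zero_ne_one hx
  unfold radialExt
  rw [dif_neg h0]
  congr 1
  ext1
  simp [hx]

lemma exists_radialExt_eq {n : ℕ} (f : S n → ℝ) {X : E n} (hX : X ≠ 0) :
    ∃ x : S n, radialExt f X = f x ∧ (x : E n) = ‖X‖⁻¹ • X := by
  unfold radialExt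
  rw [dif_neg hX]
  exact ⟨_, rfl, rfl⟩

lemma IsCSphere.contDiffAt {n : ℕ} {r : WithTop ℕ∞} {f : S n → ℝ} (hf : IsCSphere r f)
    {X : E n} (hX : X ≠ 0) : ContDiffAt ℝ r (radialExt f) X :=
  ContDiffOn.contDiffAt hf (isOpen_compl_singleton.mem_nhds hX)

namespace RadialGraph

variable {n : ℕ} (M : RadialGraph n)

/-! ### The defining function -/

lemma radialExt_radius_pos {X : E n} (hX : X ≠ 0) : 0 < radialExt M.radius X := by
  obtain ⟨x, hx, -⟩ := exists_radialExt_eq M.radius hX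
  rw [hx]; exact M.radius_pos x

lemma defining_pos {X : E n} (hX : X ≠ 0) : 0 < M.defining X :=
  div_pos (norm_pos_iff.2 hX) (M.radialExt_radius_pos hX)

lemma defining_smul {c : ℝ} (hc : 0 < c) (X : E n) : M.defining (c • X) = c * M.defining X := by
  unfold defining
  rw [radialExt_smul _ hc, norm_smul, Real.norm_of_nonneg hc.le, mul_div_assoc]

lemma contDiffAt_defining {X : E n} (hX : X ≠ 0) : ContDiffAt ℝ ∞ M.defining X :=
  (contDiffAt_norm ℝ hX).div (M.smooth.contDiffAt hX) (M.radialExt_radius_pos hX).ne'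

lemma differentiableAt_defining {X : E n} (hX : X ≠ 0) : DifferentiableAt ℝ M.defining X :=
  (M.contDiffAt_defining hX).differentiableAt (by simp)

lemma mem_carrier_iff {X : E n} : X ∈ M.carrier ↔ X ≠ 0 ∧ M.defining X = 1 := by
  constructor
  · rintro ⟨x, rfl⟩
    have hx : ‖(x : E n)‖ = 1 := mem_sphere_zero_iff_norm.1 x.2
    have h0 : (x : E n) ≠ 0 := by
      intro h; rw [h, norm_zero] at hx; exact zero_ne_one hx
    have hp := M.radius_pos x
    refine ⟨smul_ne_zero hp.ne' h0, ?_⟩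
    simp only [defining]
    rw [radialExt_smul _ hp, radialExt_coe, norm_smul, hx, Real.norm_of_nonneg hp.le, mul_one,
      div_self hp.ne']
  · rintro ⟨h0, h1⟩
    obtain ⟨x, hx, hx'⟩ := exists_radialExt_eq M.radius h0
    refine ⟨x, ?_⟩
    have : ‖X‖ = M.radius x := by
      rw [defining, hx, div_eq_one_iff_eq (M.radius_pos x).ne'] at h1
      exact h1
    simp only [hx', ← this, smul_smul]
    rw [mul_inv_cancel₀ (norm_ne_zero_iff.2 h0), one_smul]

variable {M}

lemma ne_zero_of_mem {X : E n} (hX : X ∈ M.carrier) : X ≠ 0 := (M.mem_carrier_iff.1 hX).1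

lemma defining_eq_one {X : E n} (hX : X ∈ M.carrier) : M.defining X = 1 :=
  (M.mem_carrier_iff.1 hX).2

variable (M)

/-- Euler's relation for the defining function. -/
lemma fderiv_defining_self {X : E n} (hX : X ≠ 0) :
    fderiv ℝ M.defining X X = M.defining X := by
  have h1 : HasDerivAt (fun t : ℝ => M.defining (t • X)) (fderiv ℝ M.defining X X) 1 := by
    have hc : HasDerivAt (fun t : ℝ => t • X) X 1 := by
      simpa using (hasDerivAt_id (1 : ℝ)).smul_const X
    have hd : HasFDerivAt M.defining (fderiv ℝ M.defining X) ((1 : ℝ) • X) := by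
      rw [one_smul]; exact (M.differentiableAt_defining hX).hasFDerivAt
    exact hd.comp_hasDerivAt 1 hc
  have h2 : HasDerivAt (fun t : ℝ => M.defining (t • X)) (M.defining X) 1 := by
    have : HasDerivAt (fun t : ℝ => t * M.defining X) (M.defining X) 1 := by
      simpa using (hasDerivAt_id (1 : ℝ)).mul_const (M.defining X)
    refine this.congr_of_eventuallyEq ?_
    filter_upwards [eventually_gt_nhds (zero_lt_one' ℝ)] with t ht
    exact M.defining_smul ht X
  exact h1.unique h2

lemma inner_gradient_defining (X v : E n) :
    ⟪gradient M.defining X, v⟫_ℝ = fderiv ℝ M.defining X v := by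
  rw [gradient, InnerProductSpace.toDual_symm_apply]

lemma gradient_defining_ne_zero {X : E n} (hX : X ≠ 0) : gradient M.defining X ≠ 0 := by
  intro h
  have h1 := M.inner_gradient_defining X X
  rw [h, inner_zero_left, M.fderiv_defining_self hX] at h1
  exact (M.defining_pos hX).ne h1

lemma norm_gradient_defining_pos {X : E n} (hX : X ≠ 0) : 0 < ‖gradient M.defining X‖ :=
  norm_pos_iff.2 (M.gradient_defining_ne_zero hX)

lemma inner_normal (X v : E n) :
    ⟪M.normal X, v⟫_ℝ = ‖gradient M.defining X‖⁻¹ * fderiv ℝ M.defining X v := by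
  rw [normal, real_inner_smul_left, inner_gradient_defining]

lemma norm_normal {X : E n} (hX : X ≠ 0) : ‖M.normal X‖ = 1 := by
  rw [normal, norm_smul, norm_inv, norm_norm,
    inv_mul_cancel₀ (M.norm_gradient_defining_pos hX).ne']

lemma support_eq {X : E n} (hX : X ≠ 0) :
    M.support X = ‖gradient M.defining X‖⁻¹ * M.defining X := by
  rw [support, real_inner_comm, inner_normal, M.fderiv_defining_self hX]

/-- This is star-shapedness: by Euler's relation ⟨X, ∇G⟩ = G > 0. -/
lemma support_pos {X : E n} (hX : X ≠ 0) : 0 < M.support X := by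
  rw [M.support_eq hX]
  exact mul_pos (inv_pos.2 (M.norm_gradient_defining_pos hX)) (M.defining_pos hX)

lemma contDiffAt_normal {X : E n} (hX : X ≠ 0) : ContDiffAt ℝ ∞ M.normal X := by
  have h1 : ContDiffAt ℝ ∞ (gradient M.defining) X := by
    have h2 : ContDiffAt ℝ ∞ (fderiv ℝ M.defining) X :=
      (M.contDiffAt_defining hX).fderiv_right (by simp)
    exact ((InnerProductSpace.toDual ℝ (E n)).symm.toContinuousLinearEquiv.contDiff.contDiffAt).comp
      X h2
  exact ((h1.norm ℝ (M.gradient_defining_ne_zero hX)).inv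
    (M.norm_gradient_defining_pos hX).ne').smul h1

lemma inner_fderiv_normal_normal {X : E n} (hX : X ≠ 0) (v : E n) :
    ⟪M.normal X, fderiv ℝ M.normal X v⟫_ℝ = 0 := by
  have hd : DifferentiableAt ℝ M.normal X := (M.contDiffAt_normal hX).differentiableAt (by simp)
  have h1 : (fun Y => ⟪M.normal Y, M.normal Y⟫_ℝ) =ᶠ[𝓝 X] fun _ => (1 : ℝ) := by
    filter_upwards [isOpen_compl_singleton.mem_nhds hX] with Y hY
    rw [real_inner_self_eq_norm_sq, M.norm_normal hY, one_pow]
  have h2 := congrArg (fun L : E n →L[ℝ] ℝ => L v) h1.fderiv_eq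
  simp only [fderiv_inner_apply ℝ hd hd, fderiv_fun_const, Pi.zero_apply,
    zero_apply] at h2
  rw [real_inner_comm (M.normal X) (fderiv ℝ M.normal X v)] at h2
  linarith

/-- The radial projection onto the hypersurface. -/
def proj (X : E n) : E n := (M.defining X)⁻¹ • X

lemma proj_mem {X : E n} (hX : X ≠ 0) : M.proj X ∈ M.carrier := by
  have h := inv_pos.2 (M.defining_pos hX)
  rw [mem_carrier_iff, proj, M.defining_smul h]
  exact ⟨smul_ne_zero h.ne' hX, inv_mul_cancel₀ (M.defining_pos hX).ne'⟩

variable {M} in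
lemma proj_eq {X : E n} (hX : X ∈ M.carrier) : M.proj X = X := by
  rw [proj, defining_eq_one hX, inv_one, one_smul]

lemma contDiffAt_proj {X : E n} (hX : X ≠ 0) : ContDiffAt ℝ ∞ M.proj X :=
  ((M.contDiffAt_defining hX).inv (M.defining_pos hX).ne').smul contDiffAt_id

lemma fderiv_proj {X : E n} (hX : X ≠ 0) (v : E n) :
    fderiv ℝ M.proj X v = (M.defining X)⁻¹ • v -
      ((M.defining X)⁻¹ ^ 2 * fderiv ℝ M.defining X v) • X := by
  have h := (((hasDerivAt_inv (M.defining_pos hX).ne').comp_hasFDerivAt X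
    (M.differentiableAt_defining hX).hasFDerivAt).smul (hasFDerivAt_id X)).fderiv
  have e' : fderiv ℝ M.proj X = _ := h
  rw [e']
  simp [sub_eq_add_neg]

lemma inner_normal_fderiv_proj {X : E n} (hX : X ≠ 0) (v : E n) :
    ⟪M.normal X, fderiv ℝ M.proj X v⟫_ℝ = 0 := by
  have := M.defining_pos hX
  rw [M.fderiv_proj hX, inner_sub_right, real_inner_smul_right, real_inner_smul_right,
    inner_normal, inner_normal, M.fderiv_defining_self hX]
  field_simp
  ring

variable {M} in
lemma fderiv_proj_tangent {X : E n} (hX : X ∈ M.carrier) {v : E n} (hv : ⟪M.normal X, v⟫_ℝ = 0) :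
    fderiv ℝ M.proj X v = v := by
  have h0 := ne_zero_of_mem hX
  have h1 : fderiv ℝ M.defining X v = 0 := by
    rw [inner_normal] at hv
    exact (mul_eq_zero.1 hv).resolve_left (inv_pos.2 (M.norm_gradient_defining_pos h0)).ne'
  rw [M.fderiv_proj h0, h1, defining_eq_one hX]
  simp

variable {M} in
lemma tendsto_proj {X : E n} (hX : X ∈ M.carrier) : Tendsto M.proj (𝓝 X) (𝓝 X) := by
  have h := (M.contDiffAt_proj (ne_zero_of_mem hX)).continuousAt.tendsto
  rwa [proj_eq hX] at h

/-! ### The signed distance -/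

/-- `d` is, near the point `X₀`, the signed distance from the hypersurface. -/
structure IsDist (X₀ : E n) (d : E n → ℝ) : Prop where
  smooth : ContDiffAt ℝ ∞ d X₀
  unit : ∀ᶠ X in 𝓝 X₀, ∃ N : E n, ‖N‖ = 1 ∧ ∀ v, pd v d X = ⟪N, v⟫_ℝ
  zero : ∀ᶠ X in 𝓝 X₀, X ∈ M.carrier → d X = 0
  normal : ∀ᶠ X in 𝓝 X₀, X ∈ M.carrier → ∀ v, pd v d X = ⟪M.normal X, v⟫_ℝ

/-- The tubular map, sending the radial projection `Y` and the value `1 + t` of the defining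
function to `Y + t ν(Y)`. -/
def tube (Z : E n) : E n := M.proj Z + (M.defining Z - 1) • M.normal Z

lemma contDiffAt_tube {Z : E n} (hZ : Z ≠ 0) : ContDiffAt ℝ ∞ M.tube Z :=
  (M.contDiffAt_proj hZ).add
    (((M.contDiffAt_defining hZ).sub contDiffAt_const).smul (M.contDiffAt_normal hZ))

lemma fderiv_tube {Z : E n} (hZ : Z ≠ 0) (v : E n) :
    fderiv ℝ M.tube Z v = fderiv ℝ M.proj Z v + ((M.defining Z - 1) • fderiv ℝ M.normal Z v +
      fderiv ℝ M.defining Z v • M.normal Z) := by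
  have h1 := ((M.contDiffAt_proj hZ).differentiableAt (by simp)).hasFDerivAt
  have h2 := (M.differentiableAt_defining hZ).hasFDerivAt.sub_const (1 : ℝ)
  have h3 := ((M.contDiffAt_normal hZ).differentiableAt (by simp)).hasFDerivAt
  have h : fderiv ℝ M.tube Z = _ := (h1.add (h2.smul h3)).fderiv
  rw [h]
  simp

/-- The other terms of the differential are tangential. This identity forces the gradient of the
distance to be exactly the unit normal, also off the hypersurface. -/
lemma inner_normal_fderiv_tube {Z : E n} (hZ : Z ≠ 0) (v : E n) :
    ⟪M.normal Z, fderiv ℝ M.tube Z v⟫_ℝ = fderiv ℝ M.defining Z v := by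
  rw [M.fderiv_tube hZ, inner_add_right, inner_add_right, M.inner_normal_fderiv_proj hZ,
    real_inner_smul_right, real_inner_smul_right, M.inner_fderiv_normal_normal hZ,
    real_inner_self_eq_norm_sq, M.norm_normal hZ]
  simp

variable {M} in
lemma tube_eq {X : E n} (hX : X ∈ M.carrier) : M.tube X = X := by
  rw [tube, proj_eq hX, defining_eq_one hX]; simp

variable {M} in
-- With φ a local inverse of the tubular map, given by the inverse function theorem, take d = G ∘ φ
-- - 1. Since tube ∘ φ = id, `inner_normal_fderiv_tube` identifies ∇d with ν ∘ φ, which has length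
-- one.
lemma exists_isDist {X₀ : E n} (hX₀ : X₀ ∈ M.carrier) : ∃ d, M.IsDist X₀ d := by
  have h0 := ne_zero_of_mem hX₀
  -- A kernel vector pairs to zero with the normal, so it is tangent, and on tangent vectors the
  -- differential is the identity.
  have hinj : Function.Injective (fderiv ℝ M.tube X₀ : E n →ₗ[ℝ] E n) := by
    rw [injective_iff_map_eq_zero]
    intro v hv
    have hv' : fderiv ℝ M.tube X₀ v = 0 := hv
    have h1 := M.inner_normal_fderiv_tube h0 v
    rw [hv', inner_zero_right] at h1
    have h2 := M.fderiv_tube h0 v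
    rw [hv', ← h1, fderiv_proj_tangent hX₀ (by rw [inner_normal, ← h1, mul_zero]),
      defining_eq_one hX₀] at h2
    simpa using h2.symm
  set e : E n ≃L[ℝ] E n := (LinearEquiv.ofInjectiveEndo _ hinj).toContinuousLinearEquiv with he
  have he' : HasFDerivAt M.tube (e : E n →L[ℝ] E n) X₀ := by
    have := ((M.contDiffAt_tube h0).differentiableAt (by simp)).hasFDerivAt
    have e1 : (e : E n →L[ℝ] E n) = fderiv ℝ M.tube X₀ := by ext1 v; rfl
    rwa [e1]
  have hC := M.contDiffAt_tube h0
  have hs := hC.hasStrictFDerivAt' he' (by simp)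
  set φ := hC.localInverse he' (by simp) with hφ
  have hφ0 : φ X₀ = X₀ := by
    have := hC.localInverse_apply_image he' (by simp)
    rwa [tube_eq hX₀] at this
  have hφC : ContDiffAt ℝ ∞ φ X₀ := by
    have := hC.to_localInverse he' (by simp)
    rwa [tube_eq hX₀] at this
  have hleft : ∀ᶠ X in 𝓝 X₀, φ (M.tube X) = X := hs.eventually_left_inverse
  have hright : ∀ᶠ X in 𝓝 X₀, M.tube (φ X) = X := by
    have := hs.eventually_right_inverse
    rwa [tube_eq hX₀] at this
  have hM : ∀ᶠ X in 𝓝 X₀, X ∈ M.carrier → φ X = X := by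
    filter_upwards [hleft] with X h hX
    rwa [tube_eq hX] at h
  have hd : ∀ᶠ X in 𝓝 X₀, ∀ v, pd v (fun Y => M.defining (φ Y) - 1) X = ⟪M.normal (φ X), v⟫_ℝ := by
    have hne : ∀ᶠ X in 𝓝 X₀, φ X ≠ 0 :=
      hφC.continuousAt.eventually_ne (by rwa [hφ0])
    have hdiff : ∀ᶠ X in 𝓝 X₀, DifferentiableAt ℝ φ X := by
      filter_upwards [(hφC.of_le (m := 1) (by simp)).eventually (by simp)]
        with X hX using hX.differentiableAt (by simp)
    filter_upwards [hne, hdiff, hright.eventually_nhds] with X h1 h2 h3 v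
    have h4 : fderiv ℝ (fun Y => M.tube (φ Y)) X v = v := by
      have : (fun Y => M.tube (φ Y)) =ᶠ[𝓝 X] id := h3
      rw [this.fderiv_eq, fderiv_id]; rfl
    have h5 : fderiv ℝ (fun Y => M.tube (φ Y)) X v = fderiv ℝ M.tube (φ X) (fderiv ℝ φ X v) := by
      have := fderiv_comp X ((M.contDiffAt_tube h1).differentiableAt (by simp)) h2
      exact congrArg (fun L => L v) this
    have h6 : pd v (fun Y => M.defining (φ Y) - 1) X =
        fderiv ℝ M.defining (φ X) (fderiv ℝ φ X v) := by
      rw [pd, fderiv_sub_const]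
      exact congrArg (fun L => L v) (fderiv_comp X (M.differentiableAt_defining h1) h2)
    rw [h6, ← M.inner_normal_fderiv_tube h1, ← h5, h4]
  refine ⟨fun X => M.defining (φ X) - 1, ?_, ?_, ?_, ?_⟩
  · have : ContDiffAt ℝ ∞ M.defining (φ X₀) := by rw [hφ0]; exact M.contDiffAt_defining h0
    exact (this.comp X₀ hφC).sub contDiffAt_const
  · have hne : ∀ᶠ X in 𝓝 X₀, φ X ≠ 0 :=
      hφC.continuousAt.eventually_ne (by rwa [hφ0])
    filter_upwards [hd, hne] with X h1 h2
    exact ⟨_, M.norm_normal h2, h1⟩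
  · filter_upwards [hM] with X h hX
    rw [h hX, defining_eq_one hX, sub_self]
  · filter_upwards [hM, hd] with X h h' hX v
    rw [h' v, h hX]

/-! ### The maximum principle on the hypersurface -/

section comp

variable {V : Type*} [NormedAddCommGroup V] [NormedSpace ℝ V]

/-- The extra term is the derivative of f along the acceleration of P. That vector does not depend
on f, so comparison with another function can eliminate it. -/
lemma pd_pd_comp {f : V → ℝ} {P : V → V} {X v : V} (hf : ContDiffAt ℝ 2 f X)
    (hP : ContDiffAt ℝ 2 P X) (hX : P X = X) (hv : fderiv ℝ P X v = v) :
    pd v (pd v fun Y => f (P Y)) X = pd v (pd v f) X +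
      fderiv ℝ f X (fderiv ℝ (fun Y => fderiv ℝ P Y v) X v) := by
  have hfP : ∀ᶠ Y in 𝓝 X, ContDiffAt ℝ 2 f (P Y) :=
    hP.continuousAt.eventually (by rw [hX]; exact hf.eventually (by simp))
  have h1 : (pd v fun Y => f (P Y)) =ᶠ[𝓝 X] fun Y => fderiv ℝ f (P Y) (fderiv ℝ P Y v) := by
    filter_upwards [hfP, hP.eventually (by simp)] with Y h1 h2
    exact congrArg (fun L => L v) (fderiv_comp Y (h1.differentiableAt (by simp))
      (h2.differentiableAt (by simp)))
  have hf' : DifferentiableAt ℝ (fderiv ℝ f) (P X) := by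
    rw [hX]
    exact (hf.fderiv_right (m := 1) (by norm_num)).differentiableAt (by norm_num)
  have hP0 : DifferentiableAt ℝ P X := hP.differentiableAt (by simp)
  have hP' : DifferentiableAt ℝ (fun Y => fderiv ℝ P Y v) X :=
    ((hP.fderiv_right (m := 1) (by norm_num)).differentiableAt (by norm_num)).clm_apply
      (differentiableAt_const v)
  have hf'' : DifferentiableAt ℝ (fderiv ℝ f) X := by rwa [hX] at hf'
  have e2 : pd v (pd v f) X = fderiv ℝ (fderiv ℝ f) X v v := by
    have : pd v f = fun Y => fderiv ℝ f Y v := rfl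
    rw [pd, this, fderiv_clm_apply hf'' (differentiableAt_const v)]
    simp
  rw [pd_congr_point h1, e2, pd, fderiv_clm_apply (c := fun Y => fderiv ℝ f (P Y))
    (DifferentiableAt.comp (g := fderiv ℝ f) X hf' hP0) hP']
  have e3 : fderiv ℝ (fun Y => fderiv ℝ f (P Y)) X = (fderiv ℝ (fderiv ℝ f) X).comp (fderiv ℝ P X) := by
    have := fderiv_comp X hf' hP0
    rwa [hX] at this
  rw [e3]
  simp [hX, hv]
  ring

lemma pd_pd_nonpos_of_isLocalMax {f : V → ℝ} {X v : V} (hf : ContDiffAt ℝ 2 f X)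
    (h : IsLocalMax f X) : pd v (pd v f) X ≤ 0 := by
  have hline : ∀ t : ℝ, HasDerivAt (fun t : ℝ => X + t • v) v t := fun t => by
    simpa using ((hasDerivAt_id t).smul_const v).const_add X
  have hX : X + (0 : ℝ) • v = X := by simp
  have hcont : ContinuousAt (fun t : ℝ => X + t • v) 0 := (hline 0).continuousAt
  have htend : Tendsto (fun t : ℝ => X + t • v) (𝓝 0) (𝓝 X) := by
    have := hcont.tendsto; rwa [hX] at this
  set g : ℝ → ℝ := fun t => -f (X + t • v) with hg
  have hmin : IsLocalMin g 0 := by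
    filter_upwards [htend.eventually h] with t ht
    simp only [hg, hX]
    linarith
  have hgc : ContinuousAt g 0 := by
    have : ContinuousAt f (X + (0 : ℝ) • v) := by rw [hX]; exact hf.continuousAt
    exact (ContinuousAt.comp (f := fun t : ℝ => X + t • v) (x := (0 : ℝ)) this hcont).neg
  have hder : ∀ {k : V → ℝ} {t : ℝ}, DifferentiableAt ℝ k (X + t • v) →
      HasDerivAt (fun t : ℝ => k (X + t • v)) (pd v k (X + t • v)) t := fun hk =>
    hk.hasFDerivAt.comp_hasDerivAt _ (hline _)
  have h1 : deriv g =ᶠ[𝓝 0] fun t => -pd v f (X + t • v) := by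
    filter_upwards [htend.eventually (hf.eventually (by simp))] with t ht
    exact (hder (ht.differentiableAt (by simp))).neg.deriv
  have h2 := hmin.deriv_deriv_nonneg hgc
  rw [h1.deriv_eq] at h2
  have h3 : DifferentiableAt ℝ (pd v f) (X + (0 : ℝ) • v) := by
    rw [hX]
    exact (contDiffAt_pd (m := 1) hf (by norm_num)).differentiableAt (by norm_num)
  have h4 := (hder h3).fun_neg.deriv
  rw [h4, hX] at h2
  linarith

end comp

variable {M}

/-- Composing with the radial projection makes the maximum unconstrained. Only the normal component
of the projection's acceleration matters, as f is critical along M, and it is read off from d ∘ proj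
= 0. -/
lemma IsDist.max_principle {X₀ : E n} (hX₀ : X₀ ∈ M.carrier) {d : E n → ℝ} (hd : M.IsDist X₀ d)
    {f : E n → ℝ} (hf : ContDiffAt ℝ 2 f X₀)
    (hmax : ∀ᶠ X in 𝓝 X₀, X ∈ M.carrier → f X ≤ f X₀) {v : E n}
    (hv : ⟪M.normal X₀, v⟫_ℝ = 0) :
    pd v f X₀ = 0 ∧
      pd v (pd v f) X₀ - pd v (pd v d) X₀ * pd (M.normal X₀) f X₀ ≤ 0 := by
  have h0 := ne_zero_of_mem hX₀
  have hP : ContDiffAt ℝ 2 M.proj X₀ :=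
    (M.contDiffAt_proj h0).of_le ENat.LEInfty.out
  have hPX := proj_eq hX₀
  have hPd : DifferentiableAt ℝ M.proj X₀ := hP.differentiableAt (by simp)
  have hmem : ∀ᶠ X in 𝓝 X₀, M.proj X ∈ M.carrier := by
    filter_upwards [isOpen_compl_singleton.mem_nhds h0] with X hX using M.proj_mem hX
  have hFmax : IsLocalMax (fun Y => f (M.proj Y)) X₀ := by
    filter_upwards [hmem, (tendsto_proj hX₀).eventually hmax] with X h1 h2
    rw [hPX]; exact h2 h1
  have hfX : ContDiffAt ℝ 2 f (M.proj X₀) := by rwa [hPX]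
  have hgrad : ∀ w, ⟪M.normal X₀, w⟫_ℝ = 0 → fderiv ℝ f X₀ w = 0 := by
    intro w hw
    have h1 := fderiv_comp X₀ (hfX.differentiableAt (by simp)) hPd
    have h2 : fderiv ℝ (f ∘ M.proj) X₀ = 0 := hFmax.fderiv_eq_zero
    rw [h2, hPX] at h1
    have h3 := congrArg (fun L => L w) h1
    simp only [zero_apply, ContinuousLinearMap.comp_apply,
      fderiv_proj_tangent hX₀ hw] at h3
    exact h3.symm
  refine ⟨hgrad v hv, ?_⟩
  have hF2 : pd v (pd v fun Y => f (M.proj Y)) X₀ ≤ 0 :=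
    pd_pd_nonpos_of_isLocalMax (hfX.comp X₀ hP) hFmax
  have hd2 : ContDiffAt ℝ 2 d X₀ := hd.smooth.of_le ENat.LEInfty.out
  have hD : pd v (pd v fun Y => d (M.proj Y)) X₀ = 0 := by
    have h1 : (fun Y => d (M.proj Y)) =ᶠ[𝓝 X₀] fun _ => 0 := by
      filter_upwards [hmem, (tendsto_proj hX₀).eventually hd.zero] with X h1 h2 using h2 h1
    rw [pd_congr_point (pd_congr h1)]
    have : pd v (fun _ : E n => (0 : ℝ)) = fun _ => 0 := funext fun Y => pd_const 0
    rw [this, pd_const]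
  rw [pd_pd_comp hf hP hPX (fderiv_proj_tangent hX₀ hv)] at hF2
  rw [pd_pd_comp hd2 hP hPX (fderiv_proj_tangent hX₀ hv)] at hD
  set a := fderiv ℝ (fun Y => fderiv ℝ M.proj Y v) X₀ v
  have hda : fderiv ℝ d X₀ a = ⟪M.normal X₀, a⟫_ℝ := hd.normal.self_of_nhds hX₀ a
  have hfa : fderiv ℝ f X₀ a = ⟪M.normal X₀, a⟫_ℝ * pd (M.normal X₀) f X₀ := by
    have h1 := hgrad (a - ⟪M.normal X₀, a⟫_ℝ • M.normal X₀) (by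
      rw [inner_sub_right, real_inner_smul_right, real_inner_self_eq_norm_sq, M.norm_normal h0]
      ring)
    rw [map_sub, map_smul, smul_eq_mul] at h1
    rw [pd]; linarith
  rw [hfa, ← hda] at hF2
  have : fderiv ℝ d X₀ a = - pd v (pd v d) X₀ := by linarith
  rw [this] at hF2
  linarith

end RadialGraph

/-! ### The Hessian of the distance and the principal curvatures -/

section second

variable {V : Type*} [NormedAddCommGroup V] [NormedSpace ℝ V]

lemma pd_pd_eq {f : V → ℝ} {X : V} (hf : ContDiffAt ℝ 2 f X) (v w : V) :
    pd v (pd w f) X = fderiv ℝ (fderiv ℝ f) X v w := by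
  have h1 : DifferentiableAt ℝ (fderiv ℝ f) X :=
    (hf.fderiv_right (m := 1) (by norm_num)).differentiableAt (by norm_num)
  have : pd w f = fun Y => fderiv ℝ f Y w := rfl
  rw [pd, this, fderiv_clm_apply h1 (differentiableAt_const w)]
  simp

end second

/-- The matrix of second derivatives in an orthonormal basis. -/
def hessMat {n : ℕ} (b : OrthonormalBasis (Fin (n + 1)) ℝ (E n)) (d : E n → ℝ) (X : E n) :
    Matrix (Fin (n + 1)) (Fin (n + 1)) ℝ :=
  Matrix.of fun i j => pd (b i) (pd (b j) d) X

lemma exists_hessMat_eq {n : ℕ} (b b' : OrthonormalBasis (Fin (n + 1)) ℝ (E n)) {d : E n → ℝ}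
    {X : E n} (hd : ContDiffAt ℝ 2 d X) :
    ∃ P : Matrix (Fin (n + 1)) (Fin (n + 1)) ℝ, P * P.transpose = 1 ∧
      hessMat b' d X = P * hessMat b d X * P.transpose := by
  refine ⟨Matrix.of fun i k => ⟪b' i, b k⟫_ℝ, ?_, ?_⟩
  · ext i j
    rw [Matrix.mul_apply]
    simp only [Matrix.of_apply, Matrix.transpose_apply]
    have : ∀ k, ⟪b' i, b k⟫_ℝ * ⟪b' j, b k⟫_ℝ = ⟪b' i, b k⟫_ℝ * ⟪b k, b' j⟫_ℝ := fun k => by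
      rw [real_inner_comm (b' j)]
    rw [Finset.sum_congr rfl fun k _ => this k, b.sum_inner_mul_inner,
      orthonormal_iff_ite.1 b'.orthonormal i j, Matrix.one_apply]
  · ext i j
    have hb : ∀ v, v = ∑ k, ⟪b k, v⟫_ℝ • b k := fun v => (b.sum_repr' v).symm
    simp only [hessMat, Matrix.mul_apply, Matrix.of_apply, Matrix.transpose_apply, pd_pd_eq hd]
    conv_lhs => rw [hb (b' i), hb (b' j)]
    simp only [map_sum, map_smul, sum_apply, smul_apply,
      smul_eq_mul, Finset.mul_sum, Finset.sum_mul]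
    refine Finset.sum_congr rfl fun k _ => Finset.sum_congr rfl fun l _ => ?_
    rw [real_inner_comm (b' i), real_inner_comm (b' j)]
    ring

lemma es_cons_zero {n : ℕ} (x : Fin n → ℝ) (k : ℕ) :
    es Finset.univ (Fin.cons 0 x : Fin (n + 1) → ℝ) k = es Finset.univ x k := by
  rw [← coeff_esPoly, ← coeff_esPoly]
  congr 1
  simp [esPoly, Fin.prod_univ_succ]

namespace RadialGraph

variable {n : ℕ} {M : RadialGraph n}

lemma mem_tangent {X v : E n} : v ∈ M.tangent X ↔ ⟪M.normal X, v⟫_ℝ = 0 :=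
  Submodule.mem_orthogonal_singleton_iff_inner_right

lemma coe_weingarten {X : E n} (hX : X ≠ 0) (v : M.tangent X) :
    (M.weingarten X v : E n) = fderiv ℝ M.normal X v := by
  have h : fderiv ℝ M.normal X v ∈ M.tangent X :=
    mem_tangent.2 (M.inner_fderiv_normal_normal hX _)
  have : M.weingarten X v = (M.tangent X).orthogonalProjectionOnto (fderiv ℝ M.normal X v) := rfl
  rw [this]
  exact Submodule.starProjection_eq_self_iff.2 h

/-- The identity ∇d = ν is known only on the hypersurface. Precomposing with the radial projection
stays there and fixes tangent directions to first order. -/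
lemma pd_pd_eq_inner_fderiv_normal {X : E n} (hX : X ∈ M.carrier) {d : E n → ℝ}
    (hd : ContDiffAt ℝ 2 d X)
    (hn : ∀ᶠ Y in 𝓝 X, Y ∈ M.carrier → ∀ v, pd v d Y = ⟪M.normal Y, v⟫_ℝ)
    {v : E n} (hv : v ∈ M.tangent X) (w : E n) :
    pd v (pd w d) X = ⟪fderiv ℝ M.normal X v, w⟫_ℝ := by
  have h0 := ne_zero_of_mem hX
  have hmem : ∀ᶠ Y in 𝓝 X, M.proj Y ∈ M.carrier := by
    filter_upwards [isOpen_compl_singleton.mem_nhds h0] with Y hY using M.proj_mem hY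
  have h1 : (fun Y => pd w d (M.proj Y)) =ᶠ[𝓝 X] fun Y => ⟪M.normal (M.proj Y), w⟫_ℝ := by
    filter_upwards [hmem, (tendsto_proj hX).eventually hn] with Y h1 h2 using h2 h1 w
  have hP : DifferentiableAt ℝ M.proj X := (M.contDiffAt_proj h0).differentiableAt (by simp)
  have hPv := fderiv_proj_tangent hX (mem_tangent.1 hv)
  have hPX := proj_eq hX
  have e1 : fderiv ℝ (fun Y => pd w d (M.proj Y)) X v = pd v (pd w d) X := by
    have hg : DifferentiableAt ℝ (pd w d) (M.proj X) := by
      rw [hPX]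
      exact (contDiffAt_pd (m := 1) hd (by norm_num)).differentiableAt (by simp)
    have := congrArg (fun L : E n →L[ℝ] ℝ => L v) (fderiv_comp X hg hP)
    simp only [ContinuousLinearMap.comp_apply, hPv, hPX] at this
    exact this
  have e2 : fderiv ℝ (fun Y => ⟪M.normal (M.proj Y), w⟫_ℝ) X v =
      ⟪fderiv ℝ M.normal X v, w⟫_ℝ := by
    have hg : DifferentiableAt ℝ M.normal (M.proj X) := by
      rw [hPX]
      exact (M.contDiffAt_normal h0).differentiableAt (by simp)
    have h3 : DifferentiableAt ℝ (fun Y => M.normal (M.proj Y)) X := hg.comp X hP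
    have h4 := congrArg (fun L : E n →L[ℝ] E n => L v) (fderiv_comp X hg hP)
    simp only [ContinuousLinearMap.comp_apply, hPv, hPX] at h4
    rw [fderiv_inner_apply ℝ h3 (differentiableAt_const w)]
    simp only [fderiv_fun_const, Pi.zero_apply, zero_apply, inner_zero_right, zero_add]
    rw [← h4]; rfl
  rw [← e1, h1.fderiv_eq, e2]

/-- The Weingarten map is symmetric because it is the tangential part of D²d. Its eigenvectors
together with the normal diagonalize D²d. -/
lemma exists_frame_at {X : E n} (hX : X ∈ M.carrier) {d : E n → ℝ} (hd : ContDiffAt ℝ 2 d X)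
    (hu : ∀ᶠ Y in 𝓝 X, ∃ N : E n, ‖N‖ = 1 ∧ ∀ v, pd v d Y = ⟪N, v⟫_ℝ)
    (hn : ∀ᶠ Y in 𝓝 X, Y ∈ M.carrier → ∀ v, pd v d Y = ⟪M.normal Y, v⟫_ℝ) :
    ∃ (b : OrthonormalBasis (Fin (n + 1)) ℝ (E n)) (μ : Fin n → ℝ), b 0 = M.normal X ∧
      hessMat b d X = Matrix.diagonal (Fin.cons 0 μ : Fin (n + 1) → ℝ) ∧
      M.principalCurvatures X = Finset.univ.val.map μ := by
  have h0 := ne_zero_of_mem hX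
  have hN := M.norm_normal h0
  have hpd := fun {v : E n} (hv : v ∈ M.tangent X) (w : E n) =>
    pd_pd_eq_inner_fderiv_normal hX hd hn hv w
  have hsym : (M.weingarten X).IsSymmetric := by
    intro v w
    have h1 := hpd v.2 (w : E n)
    have h2 := hpd w.2 (v : E n)
    rw [pd_comm hd, h2] at h1
    rw [Submodule.coe_inner, Submodule.coe_inner, coe_weingarten h0, coe_weingarten h0, ← h1,
      real_inner_comm]
  have hfin : Module.finrank ℝ (M.tangent X) = n := by
    have : Fact (Module.finrank ℝ (E n) = n + 1) := ⟨by simp⟩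
    exact Submodule.finrank_orthogonal_span_singleton (by
      intro h; rw [h, norm_zero] at hN; exact zero_ne_one hN)
  set e := hsym.eigenvectorBasis hfin with he
  set μ := hsym.eigenvalues hfin with hμ
  set f : Fin (n + 1) → E n := Fin.cons (M.normal X) fun i => (e i : E n) with hf
  have he0 : ∀ i, ⟪M.normal X, (e i : E n)⟫_ℝ = 0 := fun i => mem_tangent.1 (e i).2
  have hee : ∀ i j, ⟪(e i : E n), (e j : E n)⟫_ℝ = if i = j then (1 : ℝ) else 0 := fun i j => by
    rw [← Submodule.coe_inner]; exact orthonormal_iff_ite.1 e.orthonormal i j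
  have hon : Orthonormal ℝ f := by
    rw [orthonormal_iff_ite]
    intro i j
    refine Fin.cases ?_ (fun i => ?_) i <;> refine Fin.cases ?_ (fun j => ?_) j
    · simp [hf, hN]
    · simp [hf, he0, (Fin.succ_ne_zero j).symm]
    · simp only [hf, Fin.cons_succ, Fin.cons_zero, Fin.succ_ne_zero, if_false]
      rw [real_inner_comm]; exact he0 i
    · simp [hf, hee]
  have hcard : Fintype.card (Fin (n + 1)) = Module.finrank ℝ (E n) := by simp
  have hcoe : ⇑(basisOfOrthonormalOfCardEqFinrank hon hcard) = f :=
    coe_basisOfOrthonormalOfCardEqFinrank hon hcard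
  set b := (basisOfOrthonormalOfCardEqFinrank hon hcard).toOrthonormalBasis (by rwa [hcoe]) with hb
  have hbf : ∀ i, b i = f i := fun i => by
    rw [hb, Module.Basis.coe_toOrthonormalBasis, hcoe]
  have hb0 : b 0 = M.normal X := by rw [hbf]; rfl
  have hbs : ∀ i : Fin n, b i.succ = e i := fun i => by rw [hbf]; rfl
  have hsucc : ∀ (i : Fin n) (w : E n), pd (b i.succ) (pd w d) X = μ i * ⟪b i.succ, w⟫_ℝ := by
    intro i w
    rw [hbs, hpd (e i).2, ← coe_weingarten h0, hsym.apply_eigenvectorBasis hfin]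
    simp [real_inner_smul_left, hμ, he]
  -- Differentiating |∇d|² = 1 shows that the normal lies in the kernel of D²d.
  have hzero : ∀ w : E n, pd w (pd (M.normal X) d) X = 0 := by
    intro w
    have h1 : (fun Y => ∑ i, pd (b i) d Y * pd (b i) d Y) =ᶠ[𝓝 X] fun _ => 1 := by
      filter_upwards [hu] with Y hY
      obtain ⟨N, hN1, hN2⟩ := hY
      have := b.sum_sq_norm_inner_left N
      simp only [hN2]
      rw [hN1] at this
      simpa [← pow_two] using this
    have hdi : ∀ i, DifferentiableAt ℝ (pd (b i) d) X := fun i =>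
      (contDiffAt_pd (m := 1) hd (by norm_num)).differentiableAt (by simp)
    have h2 := pd_congr_point (v := w) h1
    rw [pd_const, pd_sum fun i _ => (hdi i).fun_mul (hdi i)] at h2
    have h3 : ∀ i, pd w (fun Y => pd (b i) d Y * pd (b i) d Y) X =
        2 * (⟪b i, M.normal X⟫_ℝ * fderiv ℝ (fderiv ℝ d) X w (b i)) := fun i => by
      rw [pd_mul (hdi i) (hdi i), hn.self_of_nhds hX, pd_pd_eq hd, real_inner_comm]; ring
    rw [Finset.sum_congr rfl fun i _ => h3 i, ← Finset.mul_sum] at h2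
    rw [pd_pd_eq hd]
    conv_lhs => rw [← b.sum_repr' (M.normal X)]
    rw [map_sum]
    simp only [map_smul, smul_eq_mul]
    linarith
  refine ⟨b, μ, hb0, ?_, ?_⟩
  · ext i j
    rw [hessMat, Matrix.of_apply, Matrix.diagonal_apply]
    refine Fin.cases ?_ (fun i => ?_) i
    · rw [pd_comm hd, hb0, hzero]; simp
    · rw [hsucc, orthonormal_iff_ite.1 b.orthonormal]
      simp
  · rw [principalCurvatures, hsym.roots_charpoly_eq_eigenvalues hfin]
    rfl

lemma sigma_eq_es {X : E n} {μ : Fin n → ℝ}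
    (h : M.principalCurvatures X = Finset.univ.val.map μ) (l : ℕ) :
    M.sigma l X = es Finset.univ (Fin.cons 0 μ : Fin (n + 1) → ℝ) l := by
  rw [es_cons_zero, es_eq_esymm, sigma, h]

/-- The basis b is fixed while the point varies. An orthogonal change to the principal frame at that
point preserves every det (1 + z D²d) and the trace. -/
lemma sigma_eq_sigmaMat {X : E n} (hX : X ∈ M.carrier) {d : E n → ℝ} (hd : ContDiffAt ℝ 2 d X)
    (hu : ∀ᶠ Y in 𝓝 X, ∃ N : E n, ‖N‖ = 1 ∧ ∀ v, pd v d Y = ⟪N, v⟫_ℝ)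
    (hn : ∀ᶠ Y in 𝓝 X, Y ∈ M.carrier → ∀ v, pd v d Y = ⟪M.normal Y, v⟫_ℝ)
    (b : OrthonormalBasis (Fin (n + 1)) ℝ (E n)) :
    (∀ l, M.sigma l X = sigmaMat l (hessMat b d X)) ∧
      M.sigma 1 X = ∑ i, pd (b i) (pd (b i) d) X := by
  obtain ⟨b', μ, -, h2, h3⟩ := exists_frame_at hX hd hu hn
  obtain ⟨P, hP, hPb⟩ := exists_hessMat_eq b' b hd
  rw [h2] at hPb
  constructor
  · intro l
    rw [sigma_eq_es h3, sigmaMat_eq_es]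
    intro z
    have : 1 + z • hessMat b d X =
        P * (1 + z • Matrix.diagonal (Fin.cons 0 μ : Fin (n + 1) → ℝ)) * P.transpose := by
      rw [hPb, mul_add, add_mul, mul_one, hP]; simp
    rw [this, Matrix.det_mul, Matrix.det_mul, mul_right_comm, ← Matrix.det_mul, hP,
      one_add_smul_diagonal, Matrix.det_diagonal]
    simp
  · have : ∑ i, pd (b i) (pd (b i) d) X = (hessMat b d X).trace := rfl
    rw [this, hPb, Matrix.trace_mul_cycle, mul_eq_one_comm.1 hP, one_mul, sigma_eq_es h3, es_one,
      Matrix.trace_diagonal]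

/-- A signed distance near a point of the hypersurface, with an orthonormal basis that consists of
the normal and of principal directions at that point. -/
structure Frame (M : RadialGraph n) (X₀ : E n) where
  d : E n → ℝ
  b : OrthonormalBasis (Fin (n + 1)) ℝ (E n)
  x : Fin (n + 1) → ℝ
  mem : X₀ ∈ M.carrier
  dist : M.IsDist X₀ d
  b_zero : b 0 = M.normal X₀
  x_zero : x 0 = 0
  hess : hessMat b d X₀ = Matrix.diagonal x
  sigma_eq : ∀ l, M.sigma l X₀ = es Finset.univ x l
  sigma_near : ∀ᶠ X in 𝓝 X₀, X ∈ M.carrier → ∀ l, M.sigma l X = sigmaMat l (hessMat b d X)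
  trace_near : ∀ᶠ X in 𝓝 X₀, X ∈ M.carrier → M.sigma 1 X = ∑ i, pd (b i) (pd (b i) d) X

lemma exists_frame {X₀ : E n} (hX₀ : X₀ ∈ M.carrier) : Nonempty (M.Frame X₀) := by
  obtain ⟨d, hd⟩ := exists_isDist hX₀
  have hd2 : ContDiffAt ℝ 2 d X₀ := hd.smooth.of_le ENat.LEInfty.out
  obtain ⟨b, μ, h1, h2, h3⟩ := exists_frame_at hX₀ hd2 hd.unit hd.normal
  have hev : ∀ᶠ X in 𝓝 X₀, X ∈ M.carrier → (∀ l, M.sigma l X = sigmaMat l (hessMat b d X)) ∧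
      M.sigma 1 X = ∑ i, pd (b i) (pd (b i) d) X := by
    filter_upwards [hd2.eventually (by simp), hd.unit.eventually_nhds, hd.normal.eventually_nhds]
      with X hX1 hX2 hX3 hX
    exact sigma_eq_sigmaMat hX hX1 hX2 hX3 b
  exact ⟨⟨d, b, Fin.cons 0 μ, hX₀, hd, h1, rfl, h2, sigma_eq_es h3,
    hev.mono fun X h hX => (h hX).1, hev.mono fun X h hX => (h hX).2⟩⟩

end RadialGraph

/-! ### Commutation and Leibniz rules for higher derivatives -/

section smooth

variable {V : Type*} [NormedAddCommGroup V] [NormedSpace ℝ V] {f : V → ℝ} {X v w : V}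

lemma contDiffAt_pd_infty (hf : ContDiffAt ℝ ∞ f X) : ContDiffAt ℝ ∞ (pd v f) X :=
  contDiffAt_pd hf (by simp)

lemma pd_comm_eventually (hf : ContDiffAt ℝ ∞ f X) : pd v (pd w f) =ᶠ[𝓝 X] pd w (pd v f) := by
  filter_upwards [(hf.of_le (m := 2) ENat.LEInfty.out).eventually (by simp)] with Y hY
    using pd_comm hY

lemma differentiableAt_eventually (hf : ContDiffAt ℝ ∞ f X) :
    ∀ᶠ Y in 𝓝 X, DifferentiableAt ℝ f Y := by
  filter_upwards [(hf.of_le (m := 2) ENat.LEInfty.out).eventually (by simp)] with Y hY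
    using hY.differentiableAt (by simp)

lemma _root_.ContDiffAt.differentiableAt_of_infty (hf : ContDiffAt ℝ ∞ f X) : DifferentiableAt ℝ f X :=
  hf.differentiableAt (by simp)

lemma pd_pd_pd_pd_comm (hf : ContDiffAt ℝ ∞ f X) :
    pd v (pd v (pd w (pd w f))) X = pd w (pd w (pd v (pd v f))) X := by
  have h1 : ∀ u, ContDiffAt ℝ ∞ (pd u f) X := fun u => contDiffAt_pd_infty hf
  have h2 : ∀ u u', ContDiffAt ℝ ∞ (pd u' (pd u f)) X := fun u u' => contDiffAt_pd_infty (h1 u)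
  have e1 : pd v (pd w (pd w f)) =ᶠ[𝓝 X] pd w (pd v (pd w f)) := pd_comm_eventually (h1 w)
  have e2 : pd w (pd v (pd w f)) =ᶠ[𝓝 X] pd w (pd w (pd v f)) :=
    pd_congr (pd_comm_eventually hf)
  have e3 : pd v (pd w (pd w (pd v f))) =ᶠ[𝓝 X] pd w (pd v (pd w (pd v f))) :=
    pd_comm_eventually (h2 v w)
  have e4 : pd v (pd w (pd v f)) =ᶠ[𝓝 X] pd w (pd v (pd v f)) := pd_comm_eventually (h1 v)
  rw [pd_congr_point (e1.trans e2), e3.eq_of_nhds, pd_congr_point e4]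

/-- Second derivative of a product. -/
lemma pd_pd_mul {g : V → ℝ} (hf : ContDiffAt ℝ 2 f X) (hg : ContDiffAt ℝ 2 g X) :
    pd v (pd v fun Y => f Y * g Y) X =
      f X * pd v (pd v g) X + 2 * (pd v f X * pd v g X) + pd v (pd v f) X * g X := by
  have h1 : (pd v fun Y => f Y * g Y) =ᶠ[𝓝 X] fun Y => f Y * pd v g Y + pd v f Y * g Y := by
    filter_upwards [hf.eventually (by simp), hg.eventually (by simp)] with Y h1 h2
    exact pd_mul (h1.differentiableAt (by simp)) (h2.differentiableAt (by simp))
  have hf1 := hf.differentiableAt (by simp)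
  have hg1 := hg.differentiableAt (by simp)
  have hf2 : DifferentiableAt ℝ (pd v f) X :=
    (contDiffAt_pd (m := 1) hf (by norm_num)).differentiableAt (by simp)
  have hg2 : DifferentiableAt ℝ (pd v g) X :=
    (contDiffAt_pd (m := 1) hg (by norm_num)).differentiableAt (by simp)
  rw [pd_congr_point h1, pd_add (hf1.fun_mul hg2) (hf2.fun_mul hg1), pd_mul hf1 hg2,
    pd_mul hf2 hg1]
  ring

lemma pd_pd_add {g : V → ℝ} (hf : ContDiffAt ℝ 2 f X) (hg : ContDiffAt ℝ 2 g X) :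
    pd v (pd v fun Y => f Y + g Y) X = pd v (pd v f) X + pd v (pd v g) X := by
  have h1 : (pd v fun Y => f Y + g Y) =ᶠ[𝓝 X] fun Y => pd v f Y + pd v g Y := by
    filter_upwards [hf.eventually (by simp), hg.eventually (by simp)] with Y h1 h2
    exact pd_add (h1.differentiableAt (by simp)) (h2.differentiableAt (by simp))
  rw [pd_congr_point h1]
  exact pd_add ((contDiffAt_pd (m := 1) hf (by norm_num)).differentiableAt (by simp))
    ((contDiffAt_pd (m := 1) hg (by norm_num)).differentiableAt (by simp))

lemma pd_pd_const_mul (a : ℝ) (hf : ContDiffAt ℝ 2 f X) :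
    pd v (pd v fun Y => a * f Y) X = a * pd v (pd v f) X := by
  have h1 : (pd v fun Y => a * f Y) =ᶠ[𝓝 X] fun Y => a * pd v f Y := by
    filter_upwards [hf.eventually (by simp)] with Y h1
    exact pd_const_mul a (h1.differentiableAt (by simp))
  rw [pd_congr_point h1]
  exact pd_const_mul a ((contDiffAt_pd (m := 1) hf (by norm_num)).differentiableAt (by simp))

lemma pd_pd_sum {κ : Type*} {s : Finset κ} {f : κ → V → ℝ}
    (hf : ∀ i ∈ s, ContDiffAt ℝ 2 (f i) X) :
    pd v (pd v fun Y => ∑ i ∈ s, f i Y) X = ∑ i ∈ s, pd v (pd v (f i)) X := by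
  have h1 : (pd v fun Y => ∑ i ∈ s, f i Y) =ᶠ[𝓝 X] fun Y => ∑ i ∈ s, pd v (f i) Y := by
    have : ∀ᶠ Y in 𝓝 X, ∀ i ∈ s, ContDiffAt ℝ 2 (f i) Y := by
      rw [Filter.eventually_all_finset]
      exact fun i hi => (hf i hi).eventually (by simp)
    filter_upwards [this] with Y hY
    exact pd_sum fun i hi => (hY i hi).differentiableAt (by simp)
  rw [pd_congr_point h1]
  exact pd_sum fun i hi =>
    (contDiffAt_pd (m := 1) (hf i hi) (by norm_num)).differentiableAt (by simp)

lemma pd_inner {W : Type*} [NormedAddCommGroup W] [InnerProductSpace ℝ W] (a v X : W) :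
    pd v (fun Y => ⟪a, Y⟫_ℝ) X = ⟪a, v⟫_ℝ := by
  rw [pd, fderiv_inner_apply ℝ (differentiableAt_const a) differentiableAt_fun_id]
  simp

lemma contDiffAt_inner_left {W : Type*} [NormedAddCommGroup W] [InnerProductSpace ℝ W] (a X : W)
    {m : WithTop ℕ∞} : ContDiffAt ℝ m (fun Y => ⟪a, Y⟫_ℝ) X :=
  contDiffAt_const.inner ℝ contDiffAt_id

end smooth

/-! ### Derivatives of the distance in a principal frame -/

namespace RadialGraph

namespace Frame

variable {n : ℕ} {M : RadialGraph n} {X₀ : E n} (fr : M.Frame X₀)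

lemma ne_zero (fr : M.Frame X₀) : X₀ ≠ 0 := ne_zero_of_mem fr.mem

lemma smooth : ContDiffAt ℝ ∞ fr.d X₀ := fr.dist.smooth

lemma smooth_fst (v : E n) : ContDiffAt ℝ ∞ (pd v fr.d) X₀ := contDiffAt_pd_infty fr.smooth

lemma smooth_snd (v w : E n) : ContDiffAt ℝ ∞ (pd v (pd w fr.d)) X₀ :=
  contDiffAt_pd_infty (fr.smooth_fst w)

lemma smooth_trd (u v w : E n) : ContDiffAt ℝ ∞ (pd u (pd v (pd w fr.d))) X₀ :=
  contDiffAt_pd_infty (fr.smooth_snd v w)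

lemma inner_b (i j : Fin (n + 1)) : ⟪fr.b i, fr.b j⟫_ℝ = if i = j then (1 : ℝ) else 0 :=
  orthonormal_iff_ite.1 fr.b.orthonormal i j

lemma norm_b (i : Fin (n + 1)) : ‖fr.b i‖ = 1 := fr.b.orthonormal.1 i

lemma inner_normal_b (s : Fin n) : ⟪M.normal X₀, fr.b s.succ⟫_ℝ = 0 := by
  rw [← fr.b_zero, fr.inner_b, if_neg (Fin.succ_ne_zero s).symm]

lemma pd_d (i : Fin (n + 1)) : pd (fr.b i) fr.d X₀ = if i = 0 then 1 else 0 := by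
  rw [fr.dist.normal.self_of_nhds fr.mem, ← fr.b_zero, fr.inner_b]
  simp [eq_comm]

lemma pd_pd_d (i j : Fin (n + 1)) :
    pd (fr.b i) (pd (fr.b j) fr.d) X₀ = if i = j then fr.x i else 0 := by
  have := congrFun (congrFun fr.hess i) j
  rwa [Matrix.diagonal_apply] at this

/-- The eikonal equation, differentiated once. -/
lemma sum_pd_mul_pd_pd (v : E n) :
    (fun X => ∑ i, pd (fr.b i) fr.d X * pd v (pd (fr.b i) fr.d) X) =ᶠ[𝓝 X₀] fun _ => 0 := by
  have h1 : (fun Y => ∑ i, pd (fr.b i) fr.d Y * pd (fr.b i) fr.d Y) =ᶠ[𝓝 X₀] fun _ => 1 := by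
    filter_upwards [fr.dist.unit] with Y hY
    obtain ⟨N, hN1, hN2⟩ := hY
    have := fr.b.sum_sq_norm_inner_left N
    simp only [hN2]
    rw [hN1] at this
    simpa [← pow_two] using this
  have hd : ∀ᶠ Y in 𝓝 X₀, ∀ i, DifferentiableAt ℝ (pd (fr.b i) fr.d) Y := by
    rw [eventually_all]
    exact fun i => differentiableAt_eventually (fr.smooth_fst _)
  filter_upwards [h1.eventuallyEq_nhds, hd] with Y hY hdY
  have h2 := pd_congr_point (v := v) hY
  rw [pd_const, pd_sum fun i _ => (hdY i).fun_mul (hdY i)] at h2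
  have h3 : ∀ i, pd v (fun Y => pd (fr.b i) fr.d Y * pd (fr.b i) fr.d Y) Y =
      2 * (pd (fr.b i) fr.d Y * pd v (pd (fr.b i) fr.d) Y) := fun i => by
    rw [pd_mul (hdY i) (hdY i)]; ring
  rw [Finset.sum_congr rfl fun i _ => h3 i, ← Finset.mul_sum] at h2
  linarith

/-- The eikonal equation, differentiated twice. -/
lemma sum_pd_mul_pd_pd_pd (v w : E n) :
    (fun X => ∑ i, (pd (fr.b i) fr.d X * pd w (pd v (pd (fr.b i) fr.d)) X +
      pd w (pd (fr.b i) fr.d) X * pd v (pd (fr.b i) fr.d) X)) =ᶠ[𝓝 X₀] fun _ => 0 := by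
  have hd : ∀ᶠ Y in 𝓝 X₀, ∀ i, DifferentiableAt ℝ (pd (fr.b i) fr.d) Y := by
    rw [eventually_all]
    exact fun i => differentiableAt_eventually (fr.smooth_fst _)
  have hd2 : ∀ᶠ Y in 𝓝 X₀, ∀ i, DifferentiableAt ℝ (pd v (pd (fr.b i) fr.d)) Y := by
    rw [eventually_all]
    exact fun i => differentiableAt_eventually (fr.smooth_snd _ _)
  filter_upwards [(fr.sum_pd_mul_pd_pd v).eventuallyEq_nhds, hd, hd2] with Y hY hdY hdY2
  have h2 := pd_congr_point (v := w) hY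
  rw [pd_const, pd_sum fun i _ => (hdY i).fun_mul (hdY2 i)] at h2
  rw [← h2]
  exact Finset.sum_congr rfl fun i _ => (pd_mul (hdY i) (hdY2 i)).symm

/-- Third derivatives of the distance in the normal direction. -/
lemma third_zero (j k : Fin (n + 1)) :
    pd (fr.b k) (pd (fr.b j) (pd (fr.b 0) fr.d)) X₀ = if j = k then -fr.x j ^ 2 else 0 := by
  have h := (fr.sum_pd_mul_pd_pd_pd (fr.b j) (fr.b k)).eq_of_nhds
  simp only [fr.pd_d, fr.pd_pd_d, Finset.sum_add_distrib] at h
  simp only [ite_mul, one_mul, zero_mul, Finset.sum_ite_eq', Finset.mem_univ, if_true] at h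
  have h2 : ∑ i, (if k = i then fr.x k * (if j = i then fr.x j else 0) else 0) =
      if j = k then fr.x j ^ 2 else 0 := by
    rw [Finset.sum_ite_eq, if_pos (Finset.mem_univ k)]
    by_cases hjk : j = k
    · subst hjk; simp; ring
    · simp [hjk]
  rw [h2] at h
  split_ifs at h ⊢ <;> linarith

/-- Fourth derivatives of the distance, twice in the normal direction. -/
lemma fourth_zero (s : Fin (n + 1)) :
    pd (fr.b s) (pd (fr.b s) (pd (fr.b 0) (pd (fr.b 0) fr.d))) X₀ = 2 * fr.x s ^ 3 := by
  have h := pd_congr_point (v := fr.b s) (fr.sum_pd_mul_pd_pd_pd (fr.b 0) (fr.b s))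
  have e1 : ∀ v, DifferentiableAt ℝ (pd v fr.d) X₀ := fun v => (fr.smooth_fst v).differentiableAt_of_infty
  have e2 : ∀ v w, DifferentiableAt ℝ (pd v (pd w fr.d)) X₀ := fun v w =>
    (fr.smooth_snd v w).differentiableAt_of_infty
  have e3 : ∀ u v w, DifferentiableAt ℝ (pd u (pd v (pd w fr.d))) X₀ := fun u v w =>
    (fr.smooth_trd u v w).differentiableAt_of_infty
  rw [pd_const, pd_sum fun i _ => ((e1 _).fun_mul (e3 _ _ _)).fun_add
    ((e2 _ _).fun_mul (e2 _ _))] at h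
  have h3 : ∀ i, pd (fr.b s) (fun X => pd (fr.b i) fr.d X *
      pd (fr.b s) (pd (fr.b 0) (pd (fr.b i) fr.d)) X +
      pd (fr.b s) (pd (fr.b i) fr.d) X * pd (fr.b 0) (pd (fr.b i) fr.d) X) X₀ =
      (if i = 0 then pd (fr.b s) (pd (fr.b s) (pd (fr.b 0) (pd (fr.b 0) fr.d))) X₀ else 0) +
      2 * (if s = i then -fr.x s ^ 3 else 0) := by
    intro i
    have hc : pd (fr.b s) (pd (fr.b 0) (pd (fr.b i) fr.d)) X₀ =
        if i = s then -fr.x i ^ 2 else 0 := by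
      rw [← fr.third_zero i s]
      exact pd_congr_point (pd_comm_eventually fr.smooth)
    rw [pd_add ((e1 _).fun_mul (e3 _ _ _)) ((e2 _ _).fun_mul (e2 _ _)), pd_mul (e1 _) (e3 _ _ _),
      pd_mul (e2 _ _) (e2 _ _), hc]
    simp only [fr.pd_d, fr.pd_pd_d]
    -- The Hessian annihilates the normal, so one of the products drops out; the two that remain
    -- each contribute -x_s³.
    have hx : (if (0 : Fin (n + 1)) = i then fr.x 0 else 0) = 0 := by
      rw [fr.x_zero]; simp
    rw [hx]
    by_cases h0 : i = 0
    · subst h0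
      by_cases hs : s = 0
      · subst hs; simp [fr.x_zero]
      · simp [hs, Ne.symm hs]
    · by_cases hs : s = i
      · subst hs; simp [h0]; ring
      · simp [h0, hs]
  rw [Finset.sum_congr rfl fun i _ => h3 i, Finset.sum_add_distrib, Finset.sum_ite_eq',
    ← Finset.mul_sum, Finset.sum_ite_eq] at h
  simp only [Finset.mem_univ, if_true] at h
  linarith

/-! ### Second order operators along the hypersurface -/

/-- The second derivative of `f` along the hypersurface in a principal direction. -/
def hessian (s : Fin n) (f : E n → ℝ) : ℝ :=
  pd (fr.b s.succ) (pd (fr.b s.succ) f) X₀ - fr.x s.succ * pd (fr.b 0) f X₀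

lemma max_principle {f : E n → ℝ} (hf : ContDiffAt ℝ 2 f X₀)
    (hmax : ∀ᶠ X in 𝓝 X₀, X ∈ M.carrier → f X ≤ f X₀) (s : Fin n) :
    pd (fr.b s.succ) f X₀ = 0 ∧ fr.hessian s f ≤ 0 := by
  have h := fr.dist.max_principle fr.mem hf hmax (fr.inner_normal_b s)
  rwa [fr.pd_pd_d, if_pos rfl, ← fr.b_zero] at h

lemma pd_sub_eq {f g : E n → ℝ} (hf : ContDiffAt ℝ 2 f X₀) (hg : ContDiffAt ℝ 2 g X₀) (c : ℝ)
    (i : Fin (n + 1)) :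
    pd (fr.b i) (fun X => f X + c * g X) X₀ = pd (fr.b i) f X₀ + c * pd (fr.b i) g X₀ := by
  have hg1 := hg.differentiableAt (by simp)
  rw [pd_add (hf.differentiableAt (by simp)) (hg1.const_mul c), pd_const_mul c hg1]

lemma hessian_add_const_mul {f g : E n → ℝ} (hf : ContDiffAt ℝ 2 f X₀)
    (hg : ContDiffAt ℝ 2 g X₀) (c : ℝ) (s : Fin n) :
    fr.hessian s (fun X => f X + c * g X) = fr.hessian s f + c * fr.hessian s g := by
  rw [hessian, pd_pd_add hf (contDiffAt_const.mul hg), pd_pd_const_mul c hg, fr.pd_sub_eq hf hg,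
    hessian, hessian]
  ring

/-- Comparison of two functions that touch along the hypersurface. -/
lemma touching {f g : E n → ℝ} (hf : ContDiffAt ℝ 2 f X₀) (hg : ContDiffAt ℝ 2 g X₀)
    (hle : ∀ᶠ X in 𝓝 X₀, X ∈ M.carrier → f X ≤ g X) (heq : f X₀ = g X₀) (s : Fin n) :
    pd (fr.b s.succ) f X₀ = pd (fr.b s.succ) g X₀ ∧ fr.hessian s f ≤ fr.hessian s g := by
  have h := fr.max_principle (f := fun X => f X + (-1) * g X)
    (hf.add (contDiffAt_const.mul hg)) (by
      filter_upwards [hle] with X hX hXM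
      have := hX hXM
      rw [heq]; linarith) s
  rw [fr.pd_sub_eq hf hg, fr.hessian_add_const_mul hf hg] at h
  constructor <;> linarith [h.1, h.2]

/-- Tangential first derivatives and `hessian` depend only on the values along M, so an equation
valid only on M can be differentiated twice. -/
lemma eq_of_eq_on {f g : E n → ℝ} (hf : ContDiffAt ℝ 2 f X₀) (hg : ContDiffAt ℝ 2 g X₀)
    (h : ∀ᶠ X in 𝓝 X₀, X ∈ M.carrier → f X = g X) (s : Fin n) :
    pd (fr.b s.succ) f X₀ = pd (fr.b s.succ) g X₀ ∧ fr.hessian s f = fr.hessian s g := by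
  have h0 := h.self_of_nhds fr.mem
  have h1 := fr.touching hf hg (h.mono fun X hX hm => (hX hm).le) h0 s
  have h2 := fr.touching hg hf (h.mono fun X hX hm => (hX hm).ge) h0.symm s
  exact ⟨h1.1, le_antisymm h1.2 h2.2⟩

/-- Derivatives of the second fundamental form. -/
def third (i s : Fin (n + 1)) : ℝ := pd (fr.b s) (pd (fr.b i) (pd (fr.b i) fr.d)) X₀

/-- Second derivatives of the second fundamental form. -/
def fourth (i s : Fin (n + 1)) : ℝ :=
  pd (fr.b s) (pd (fr.b s) (pd (fr.b i) (pd (fr.b i) fr.d))) X₀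

lemma fourth_comm (i s : Fin (n + 1)) : fr.fourth i s = fr.fourth s i :=
  pd_pd_pd_pd_comm fr.smooth

lemma third_normal (i : Fin (n + 1)) : fr.third i 0 = -fr.x i ^ 2 := by
  have e1 : pd (fr.b 0) (pd (fr.b i) (pd (fr.b i) fr.d)) X₀ =
      pd (fr.b i) (pd (fr.b i) (pd (fr.b 0) fr.d)) X₀ := by
    rw [(pd_comm_eventually (fr.smooth_fst (fr.b i))).eq_of_nhds]
    exact pd_congr_point (pd_comm_eventually fr.smooth)
  rw [third, e1, fr.third_zero, if_pos rfl]

lemma third_normal_left (s : Fin n) : fr.third 0 s.succ = 0 := by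
  rw [third, fr.third_zero, if_neg (Fin.succ_ne_zero s).symm]

/-! ### The mean curvature -/

/-- The mean curvature of the parallel hypersurfaces. -/
def meanCurv (X : E n) : ℝ := ∑ i, pd (fr.b i) (pd (fr.b i) fr.d) X

lemma smooth_meanCurv : ContDiffAt ℝ ∞ fr.meanCurv X₀ :=
  ContDiffAt.sum fun _ _ => fr.smooth_snd _ _

lemma meanCurv_eq : fr.meanCurv X₀ = ∑ s : Fin n, fr.x s.succ := by
  rw [meanCurv, Fin.sum_univ_succ]
  simp [fr.pd_pd_d, fr.x_zero]

lemma pd_meanCurv (j : Fin (n + 1)) : pd (fr.b j) fr.meanCurv X₀ = ∑ i, fr.third i j :=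
  pd_sum fun _ _ => (fr.smooth_snd _ _).differentiableAt_of_infty

/-- The two extra terms are the normal contributions: 2 x_s³ is the fourth derivative with i = 0,
and the normal derivative of Δd is -|A|². -/
lemma hessian_meanCurv (s : Fin n) :
    fr.hessian s fr.meanCurv = (∑ i : Fin n, fr.fourth i.succ s.succ) + 2 * fr.x s.succ ^ 3 +
      fr.x s.succ * ∑ i : Fin n, fr.x i.succ ^ 2 := by
  have h1 : pd (fr.b s.succ) (pd (fr.b s.succ) fr.meanCurv) X₀ = ∑ i, fr.fourth i s.succ :=
    pd_pd_sum fun _ _ => (fr.smooth_snd _ _).of_le ENat.LEInfty.out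
  have h2 : fr.fourth 0 s.succ = 2 * fr.x s.succ ^ 3 := fr.fourth_zero s.succ
  rw [hessian, h1, fr.pd_meanCurv, Fin.sum_univ_succ, h2, Fin.sum_univ_succ]
  simp only [fr.third_normal, fr.x_zero, Finset.sum_neg_distrib]
  ring

/-! ### The support function -/

/-- The coordinates of the position vector. -/
def y (i : Fin (n + 1)) : ℝ := ⟪fr.b i, X₀⟫_ℝ

/-- The support function of the parallel hypersurfaces. -/
def supp (X : E n) : ℝ := ∑ i, ⟪fr.b i, X⟫_ℝ * pd (fr.b i) fr.d X

lemma smooth_supp : ContDiffAt ℝ ∞ fr.supp X₀ :=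
  ContDiffAt.sum fun _ _ => (contDiffAt_inner_left _ _).mul (fr.smooth_fst _)

lemma support_near : ∀ᶠ X in 𝓝 X₀, X ∈ M.carrier → M.support X = fr.supp X := by
  filter_upwards [fr.dist.normal] with X h hX
  rw [support, supp, ← fr.b.sum_inner_mul_inner X (M.normal X)]
  refine Finset.sum_congr rfl fun i _ => ?_
  rw [h hX, real_inner_comm, real_inner_comm (M.normal X)]

lemma support_eq : M.support X₀ = fr.supp X₀ := fr.support_near.self_of_nhds fr.mem

lemma supp_eq : fr.supp X₀ = fr.y 0 := by
  simp [supp, fr.pd_d, y]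

lemma supp_pos : 0 < fr.supp X₀ := by
  rw [← fr.support_eq]; exact M.support_pos fr.ne_zero

lemma sum_y_sq : fr.y 0 ^ 2 + ∑ s : Fin n, fr.y s.succ ^ 2 = ‖X₀‖ ^ 2 := by
  have := fr.b.sum_sq_norm_inner_right X₀
  rw [Fin.sum_univ_succ] at this
  simpa [y] using this

lemma pd_supp (j : Fin (n + 1)) :
    pd (fr.b j) fr.supp X₀ = (if j = 0 then 1 else 0) + fr.y j * fr.x j := by
  have h1 : ∀ i, pd (fr.b j) (fun X => ⟪fr.b i, X⟫_ℝ * pd (fr.b i) fr.d X) X₀ =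
      (if i = j then fr.y j * fr.x j else 0) + (if i = j then (if j = 0 then 1 else 0) else 0) := by
    intro i
    rw [pd_mul (contDiffAt_inner_left (m := ∞) _ _).differentiableAt_of_infty (fr.smooth_fst _).differentiableAt_of_infty, pd_inner,
      fr.pd_pd_d, fr.pd_d, fr.inner_b]
    by_cases h : i = j
    · subst h; simp [y]
    · simp [h, Ne.symm h]
  have h2 : pd (fr.b j) fr.supp X₀ = _ :=
    pd_sum fun i _ => ((contDiffAt_inner_left (m := ∞) _ _).mul (fr.smooth_fst _)).differentiableAt_of_infty
  rw [h2, Finset.sum_congr rfl fun i _ => h1 i, Finset.sum_add_distrib, Finset.sum_ite_eq',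
    Finset.sum_ite_eq']
  simp [add_comm]

lemma pd_supp_succ (s : Fin n) :
    pd (fr.b s.succ) fr.supp X₀ = fr.y s.succ * fr.x s.succ := by
  rw [fr.pd_supp, if_neg (Fin.succ_ne_zero s), zero_add]

/-- Third derivatives of d commute, which is the Codazzi equation; the normal one equals -x_s² and
yields the term with u. Of the 2 x_s from the product rule, one x_s is cancelled by the normal
derivative of the support function, which is 1. -/
lemma hessian_supp (s : Fin n) :
    fr.hessian s fr.supp = fr.x s.succ - fr.supp X₀ * fr.x s.succ ^ 2 +
      ∑ i : Fin n, fr.y i.succ * fr.third s.succ i.succ := by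
  have hc : ∀ i, pd (fr.b s.succ) (pd (fr.b s.succ) (pd (fr.b i) fr.d)) X₀ =
      fr.third s.succ i := by
    intro i
    have e1 : pd (fr.b s.succ) (pd (fr.b s.succ) (pd (fr.b i) fr.d)) X₀ =
        pd (fr.b s.succ) (pd (fr.b i) (pd (fr.b s.succ) fr.d)) X₀ :=
      pd_congr_point (pd_comm_eventually fr.smooth)
    rw [e1, (pd_comm_eventually (fr.smooth_fst (fr.b s.succ))).eq_of_nhds, third]
  have h1 : ∀ i, pd (fr.b s.succ) (pd (fr.b s.succ)
      fun X => ⟪fr.b i, X⟫_ℝ * pd (fr.b i) fr.d X) X₀ =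
      fr.y i * fr.third s.succ i + (if i = s.succ then 2 * fr.x s.succ else 0) := by
    intro i
    have hp : pd (fr.b s.succ) (fun X : E n => ⟪fr.b i, X⟫_ℝ) = fun _ => ⟪fr.b i, fr.b s.succ⟫_ℝ :=
      funext fun X => pd_inner _ _ _
    rw [pd_pd_mul (contDiffAt_inner_left _ _) ((fr.smooth_fst _).of_le ENat.LEInfty.out), hp,
      pd_const, hc, fr.pd_pd_d, fr.inner_b]
    by_cases h : i = s.succ
    · subst h; simp [y]
    · simp [h, Ne.symm h, y]
  have h2 : pd (fr.b s.succ) (pd (fr.b s.succ) fr.supp) X₀ = _ :=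
    pd_pd_sum fun i _ => ((contDiffAt_inner_left _ _).mul (fr.smooth_fst _)).of_le ENat.LEInfty.out
  rw [hessian, h2, Finset.sum_congr rfl fun i _ => h1 i, Finset.sum_add_distrib, Finset.sum_ite_eq',
    fr.pd_supp, Fin.sum_univ_succ, fr.third_normal, fr.supp_eq]
  simp [fr.x_zero]
  ring

end Frame

end RadialGraph

/-! ### Derivatives of real powers -/

section rpow

variable {V : Type*} [NormedAddCommGroup V] [NormedSpace ℝ V] {g : V → ℝ} {X v : V}

lemma pd_rpow (hg : DifferentiableAt ℝ g X) (h0 : g X ≠ 0) (p : ℝ) :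
    pd v (fun Y => g Y ^ p) X = p * g X ^ (p - 1) * pd v g X := by
  rw [pd, (hg.hasFDerivAt.rpow_const (p := p) (Or.inl h0)).fderiv]
  simp [pd]

lemma pd_pd_rpow (hg : ContDiffAt ℝ 2 g X) (h0 : g X ≠ 0) (p : ℝ) :
    pd v (pd v fun Y => g Y ^ p) X =
      p * (p - 1) * g X ^ (p - 2) * pd v g X ^ 2 + p * g X ^ (p - 1) * pd v (pd v g) X := by
  have h1 : (pd v fun Y => g Y ^ p) =ᶠ[𝓝 X] fun Y => p * (g Y ^ (p - 1) * pd v g Y) := by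
    filter_upwards [hg.eventually (by simp), hg.continuousAt.eventually_ne h0] with Y h1 h2
    rw [pd_rpow (h1.differentiableAt (by simp)) h2]; ring
  have hd := hg.differentiableAt (by simp)
  have hd2 : DifferentiableAt ℝ (pd v g) X :=
    (contDiffAt_pd (m := 1) hg (by norm_num)).differentiableAt (by simp)
  have hd3 : DifferentiableAt ℝ (fun Y => g Y ^ (p - 1)) X := hd.rpow_const (Or.inl h0)
  rw [pd_congr_point h1, pd_const_mul p (hd3.fun_mul hd2), pd_mul hd3 hd2, pd_rpow hd h0,
    show p - 1 - 1 = p - 2 by ring]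
  ring

end rpow

namespace RadialGraph

namespace Frame

variable {n : ℕ} {M : RadialGraph n} {X₀ : E n} (fr : M.Frame X₀)

lemma hessian_mul {f g : E n → ℝ} (hf : ContDiffAt ℝ 2 f X₀) (hg : ContDiffAt ℝ 2 g X₀)
    (s : Fin n) :
    fr.hessian s (fun X => f X * g X) = f X₀ * fr.hessian s g +
      2 * (pd (fr.b s.succ) f X₀ * pd (fr.b s.succ) g X₀) + fr.hessian s f * g X₀ := by
  rw [hessian, pd_pd_mul hf hg, pd_mul (hf.differentiableAt (by simp))
    (hg.differentiableAt (by simp)), hessian, hessian]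
  ring

/-! ### The curvature function -/

/-- The symmetric function `σ_k` of the curvatures of the parallel hypersurfaces. -/
def sig (k : ℕ) (X : E n) : ℝ := sigmaMat k (hessMat fr.b fr.d X)

lemma smooth_sig (k : ℕ) : ContDiffAt ℝ ∞ (fr.sig k) X₀ :=
  contDiffAt_sigmaMat k fun _ _ => fr.smooth_snd _ _

lemma sig_eq (k : ℕ) : fr.sig k X₀ = es Finset.univ fr.x k := by
  rw [← fr.sigma_eq, fr.sigma_near.self_of_nhds fr.mem, sig]

lemma meanCurv_eq_es : fr.meanCurv X₀ = es Finset.univ fr.x 1 := by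
  rw [← fr.sigma_eq, fr.trace_near.self_of_nhds fr.mem, meanCurv]

/-- The derivatives of `σ_{k+1}` with respect to the curvatures. -/
def Q (k : ℕ) (i : Fin (n + 1)) : ℝ := es (Finset.univ.erase i) fr.x k

lemma sum_mul_Q (k : ℕ) :
    ∑ s : Fin n, fr.x s.succ * fr.Q k s.succ = (k + 1) * es Finset.univ fr.x (k + 1) := by
  rw [← sum_mul_es_erase, Fin.sum_univ_succ, fr.x_zero, zero_mul, zero_add]
  rfl

lemma Q_pos {k : ℕ} (h : Cone Finset.univ (k + 1) fr.x) (i : Fin (n + 1)) : 0 < fr.Q k i :=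
  h.es_erase_pos (Finset.mem_univ i)

lemma pd_sig (k : ℕ) (j : Fin (n + 1)) :
    pd (fr.b j) (fr.sig (k + 1)) X₀ = ∑ i, fr.third i j * fr.Q k i :=
  pd_sigmaMat k (fun i j => (fr.smooth_snd (fr.b i) (fr.b j)).differentiableAt_of_infty) fr.hess

lemma pd_sig_succ (k : ℕ) (s : Fin n) :
    pd (fr.b s.succ) (fr.sig (k + 1)) X₀ =
      ∑ i : Fin n, fr.third i.succ s.succ * fr.Q k i.succ := by
  rw [fr.pd_sig, Fin.sum_univ_succ, fr.third_normal_left, zero_mul, zero_add]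

lemma pd_meanCurv_succ (s : Fin n) :
    pd (fr.b s.succ) fr.meanCurv X₀ = ∑ i : Fin n, fr.third i.succ s.succ := by
  rw [fr.pd_meanCurv, Fin.sum_univ_succ, fr.third_normal_left, zero_add]

/-- All off-diagonal products are squares with positive weights. Only the pairs (0, s) and (s, 0)
are kept; each gives x_s⁴ by `third_zero`. -/
lemma offDiagonal_le {k : ℕ} (h : Cone Finset.univ (k + 2) fr.x) (s : Fin n) :
    2 * (fr.x s.succ ^ 4 * es ((Finset.univ.erase 0).erase s.succ) fr.x k) ≤
      ∑ i, ∑ j ∈ Finset.univ.erase i, (pd (fr.b s.succ) (pd (fr.b j) (pd (fr.b i) fr.d)) X₀ *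
        pd (fr.b s.succ) (pd (fr.b i) (pd (fr.b j) fr.d)) X₀) *
          es ((Finset.univ.erase i).erase j) fr.x k := by
  have hc : ∀ i j, pd (fr.b s.succ) (pd (fr.b j) (pd (fr.b i) fr.d)) X₀ =
      pd (fr.b s.succ) (pd (fr.b i) (pd (fr.b j) fr.d)) X₀ := fun i j =>
    pd_congr_point (pd_comm_eventually fr.smooth)
  have hnn : ∀ i, ∀ j ∈ Finset.univ.erase i,
      0 ≤ (pd (fr.b s.succ) (pd (fr.b j) (pd (fr.b i) fr.d)) X₀ *
        pd (fr.b s.succ) (pd (fr.b i) (pd (fr.b j) fr.d)) X₀) *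
          es ((Finset.univ.erase i).erase j) fr.x k := by
    intro i j hj
    rw [hc]
    exact mul_nonneg (mul_self_nonneg _)
      ((h.erase (Finset.mem_univ i)).es_erase_pos hj).le
  have hs0 : s.succ ∈ Finset.univ.erase (0 : Fin (n + 1)) :=
    Finset.mem_erase.2 ⟨Fin.succ_ne_zero s, Finset.mem_univ _⟩
  have h0s : (0 : Fin (n + 1)) ∈ Finset.univ.erase s.succ :=
    Finset.mem_erase.2 ⟨(Fin.succ_ne_zero s).symm, Finset.mem_univ _⟩
  have h1 := Finset.single_le_sum (hnn 0) hs0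
  have h2 := Finset.single_le_sum (hnn s.succ) h0s
  have h3 := Finset.single_le_sum (s := Finset.univ) (f := fun i : Fin n =>
    ∑ j ∈ Finset.univ.erase i.succ, (pd (fr.b s.succ) (pd (fr.b j) (pd (fr.b i.succ) fr.d)) X₀ *
        pd (fr.b s.succ) (pd (fr.b i.succ) (pd (fr.b j) fr.d)) X₀) *
          es ((Finset.univ.erase i.succ).erase j) fr.x k)
    (fun i _ => Finset.sum_nonneg (hnn i.succ)) (Finset.mem_univ s)
  rw [Fin.sum_univ_succ]
  have e1 : pd (fr.b s.succ) (pd (fr.b s.succ) (pd (fr.b 0) fr.d)) X₀ = -fr.x s.succ ^ 2 := by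
    rw [fr.third_zero, if_pos rfl]
  have e2 : pd (fr.b s.succ) (pd (fr.b 0) (pd (fr.b s.succ) fr.d)) X₀ = -fr.x s.succ ^ 2 := by
    rw [hc, e1]
  rw [e1, e2] at h1
  rw [e1, e2, Finset.erase_right_comm] at h2
  linarith [h1, h2, h3]

/-- Concavity of log (σ_k/σ_1) handles the products of diagonal third derivatives. The retained
off-diagonal terms turn 2 x_s³ Q_0, which comes from the normal fourth derivative, into 2 x_s³ Q_s;
this cancels later against `hessian_meanCurv`. -/
lemma hessian_sig_le {k : ℕ} (h : Cone Finset.univ (k + 2) fr.x) (s : Fin n) :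
    fr.hessian s (fr.sig (k + 2)) ≤
      (∑ i : Fin n, fr.fourth i.succ s.succ * fr.Q (k + 1) i.succ) +
        2 * fr.x s.succ ^ 3 * fr.Q (k + 1) s.succ +
        (pd (fr.b s.succ) (fr.sig (k + 2)) X₀ ^ 2 / fr.sig (k + 2) X₀ -
          fr.sig (k + 2) X₀ * (pd (fr.b s.succ) fr.meanCurv X₀ / fr.meanCurv X₀) ^ 2) +
        fr.x s.succ * ∑ i : Fin n, fr.x i.succ ^ 2 * fr.Q (k + 1) i.succ := by
  have h1 : pd (fr.b s.succ) (pd (fr.b s.succ) (fr.sig (k + 2))) X₀ =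
      (∑ i, fr.fourth i s.succ * fr.Q (k + 1) i) +
      (∑ i, fr.third i s.succ * ∑ j ∈ Finset.univ.erase i,
        fr.third j s.succ * es ((Finset.univ.erase i).erase j) fr.x k) -
      ∑ i, ∑ j ∈ Finset.univ.erase i, (pd (fr.b s.succ) (pd (fr.b j) (pd (fr.b i) fr.d)) X₀ *
        pd (fr.b s.succ) (pd (fr.b i) (pd (fr.b j) fr.d)) X₀) *
          es ((Finset.univ.erase i).erase j) fr.x k := by
    have h2 : pd (fr.b s.succ) (pd (fr.b s.succ) (fr.sig (k + 2))) X₀ =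
        ∑ i, (fr.fourth i s.succ * fr.Q (k + 1) i + ∑ j ∈ Finset.univ.erase i,
          (fr.third i s.succ * fr.third j s.succ -
            pd (fr.b s.succ) (pd (fr.b j) (pd (fr.b i) fr.d)) X₀ *
              pd (fr.b s.succ) (pd (fr.b i) (pd (fr.b j) fr.d)) X₀) *
          es ((Finset.univ.erase i).erase j) fr.x k) :=
      pd_pd_sigmaMat (v := fr.b s.succ) k
        (fun i j => (fr.smooth_snd (fr.b i) (fr.b j)).of_le ENat.LEInfty.out) fr.hess
    rw [h2]
    rw [← Finset.sum_add_distrib, ← Finset.sum_sub_distrib]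
    refine Finset.sum_congr rfl fun i _ => ?_
    rw [Finset.mul_sum, add_sub_assoc, ← Finset.sum_sub_distrib]
    refine congrArg₂ (· + ·) rfl (Finset.sum_congr rfl fun j _ => ?_)
    ring
  have h2 := fr.offDiagonal_le h s
  have h3 := h.hessian_le fun i => fr.third i s.succ
  have hF : 0 < fr.sig (k + 2) X₀ := by rw [fr.sig_eq]; exact h _ le_rfl
  have hH : 0 < fr.meanCurv X₀ := by rw [fr.meanCurv_eq_es]; exact h 1 (by omega)
  have e1 : ∑ i, fr.third i s.succ * es (Finset.univ.erase i) fr.x (k + 1) =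
      pd (fr.b s.succ) (fr.sig (k + 2)) X₀ := (fr.pd_sig (k + 1) s.succ).symm
  rw [e1, ← fr.pd_meanCurv, ← fr.sig_eq, ← fr.meanCurv_eq_es] at h3
  set Φ := ∑ i, fr.third i s.succ * ∑ j ∈ Finset.univ.erase i,
        fr.third j s.succ * es ((Finset.univ.erase i).erase j) fr.x k
  set F := fr.sig (k + 2) X₀
  set H := fr.meanCurv X₀
  set Fs := pd (fr.b s.succ) (fr.sig (k + 2)) X₀
  set Hs := pd (fr.b s.succ) fr.meanCurv X₀
  have h4 : Φ ≤ Fs ^ 2 / F - F * (Hs / H) ^ 2 := by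
    have : Fs ^ 2 / F - F * (Hs / H) ^ 2 = ((H * Fs) ^ 2 - (F * Hs) ^ 2) / (F * H ^ 2) := by
      field_simp
    rw [this, le_div_iff₀ (by positivity)]
    linarith
  have e2 : pd (fr.b 0) (fr.sig (k + 2)) X₀ =
      -∑ i : Fin n, fr.x i.succ ^ 2 * fr.Q (k + 1) i.succ := by
    rw [fr.pd_sig, Fin.sum_univ_succ]
    simp [fr.third_normal, fr.x_zero]
  have e3 : fr.Q (k + 1) 0 = fr.Q (k + 1) s.succ +
      fr.x s.succ * es ((Finset.univ.erase 0).erase s.succ) fr.x k := by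
    have hs0 : s.succ ∈ Finset.univ.erase (0 : Fin (n + 1)) :=
      Finset.mem_erase.2 ⟨Fin.succ_ne_zero s, Finset.mem_univ _⟩
    have h0s : (0 : Fin (n + 1)) ∈ Finset.univ.erase s.succ :=
      Finset.mem_erase.2 ⟨(Fin.succ_ne_zero s).symm, Finset.mem_univ _⟩
    rw [Q, Q, es_erase hs0, es_erase h0s, fr.x_zero, Finset.erase_right_comm]
    ring
  have e4 : fr.fourth 0 s.succ = 2 * fr.x s.succ ^ 3 := fr.fourth_zero s.succ
  rw [hessian, h1, e2, Fin.sum_univ_succ (f := fun i => fr.fourth i s.succ * fr.Q (k + 1) i), e4,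
    e3]
  linarith

lemma contDiffAt_supp_rpow (p : ℝ) : ContDiffAt ℝ 2 (fun X => fr.supp X ^ p) X₀ :=
  (fr.smooth_supp.of_le ENat.LEInfty.out).rpow_const_of_ne fr.supp_pos.ne'

section equation

variable {k : ℕ} {p : ℝ} {φ : E n → ℝ} (hφ : ContDiffAt ℝ 2 φ X₀) (hφ0 : 0 < φ X₀)
  (heq : ∀ᶠ X in 𝓝 X₀, X ∈ M.carrier → fr.sig k X = fr.supp X ^ p * φ X)

include heq

lemma sig_eq_rhs : fr.sig k X₀ = fr.supp X₀ ^ p * φ X₀ := heq.self_of_nhds fr.mem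

include hφ hφ0

/-- The equation, differentiated once along the hypersurface. -/
lemma pd_sig_eq (s : Fin n) : pd (fr.b s.succ) (fr.sig k) X₀ =
    fr.sig k X₀ * (p * (pd (fr.b s.succ) fr.supp X₀ / fr.supp X₀) +
      pd (fr.b s.succ) φ X₀ / φ X₀) := by
  have hU := fr.contDiffAt_supp_rpow p
  have hu0 := fr.supp_pos
  rw [(fr.eq_of_eq_on ((fr.smooth_sig k).of_le ENat.LEInfty.out) (hU.mul hφ) heq s).1,
    pd_mul (hU.differentiableAt (by simp)) (hφ.differentiableAt (by simp)),
    pd_rpow fr.smooth_supp.differentiableAt_of_infty hu0.ne', fr.sig_eq_rhs heq,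
    Real.rpow_sub_one hu0.ne']
  field_simp
  ring

/-- The equation, differentiated twice along the hypersurface. -/
lemma hessian_sig_eq (s : Fin n) : fr.hessian s (fr.sig k) =
    fr.sig k X₀ * (p * (fr.hessian s fr.supp / fr.supp X₀) +
      p * (p - 1) * (pd (fr.b s.succ) fr.supp X₀ / fr.supp X₀) ^ 2 +
      2 * p * ((pd (fr.b s.succ) fr.supp X₀ / fr.supp X₀) * (pd (fr.b s.succ) φ X₀ / φ X₀)) +
      fr.hessian s φ / φ X₀) := by
  have hU := fr.contDiffAt_supp_rpow p
  have hu0 := fr.supp_pos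
  have hS : ContDiffAt ℝ 2 fr.supp X₀ := fr.smooth_supp.of_le ENat.LEInfty.out
  have e1 : fr.hessian s (fun X => fr.supp X ^ p) =
      p * (p - 1) * fr.supp X₀ ^ (p - 2) * pd (fr.b s.succ) fr.supp X₀ ^ 2 +
        p * fr.supp X₀ ^ (p - 1) * fr.hessian s fr.supp := by
    rw [hessian, pd_pd_rpow hS hu0.ne', pd_rpow (hS.differentiableAt (by simp)) hu0.ne', hessian]
    ring
  have e2 : fr.supp X₀ ^ (p - 2) = fr.supp X₀ ^ p / fr.supp X₀ ^ 2 := by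
    rw [Real.rpow_sub hu0]; norm_num
  rw [(fr.eq_of_eq_on ((fr.smooth_sig k).of_le ENat.LEInfty.out) (hU.mul hφ) heq s).2,
    fr.hessian_mul hU hφ, e1, pd_rpow (hS.differentiableAt (by simp)) hu0.ne',
    fr.sig_eq_rhs heq, e2, Real.rpow_sub_one hu0.ne']
  field_simp
  ring

end equation

/-- The sum of the second derivatives of the support function, weighted by the derivatives of
`σ_{k+1}`. -/
lemma sum_Q_mul_hessian_supp (k : ℕ) :
    ∑ s : Fin n, fr.Q k s.succ * fr.hessian s fr.supp =
      (k + 1) * fr.sig (k + 1) X₀ -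
        fr.supp X₀ * (∑ s : Fin n, fr.x s.succ ^ 2 * fr.Q k s.succ) +
        ∑ s : Fin n, fr.y s.succ * pd (fr.b s.succ) (fr.sig (k + 1)) X₀ := by
  simp only [fr.hessian_supp, fr.pd_sig_succ, fr.sig_eq, ← fr.sum_mul_Q, mul_add, mul_sub,
    Finset.sum_add_distrib, Finset.sum_sub_distrib, Finset.mul_sum]
  congr 1
  · congr 1
    · exact Finset.sum_congr rfl fun s _ => by ring
    · exact Finset.sum_congr rfl fun s _ => by ring
  · rw [Finset.sum_comm]
    exact Finset.sum_congr rfl fun s _ => Finset.sum_congr rfl fun i _ => by ring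

lemma sum_hessian_supp :
    ∑ s : Fin n, fr.hessian s fr.supp =
      fr.meanCurv X₀ - fr.supp X₀ * (∑ s : Fin n, fr.x s.succ ^ 2) +
        ∑ s : Fin n, fr.y s.succ * pd (fr.b s.succ) fr.meanCurv X₀ := by
  simp only [fr.hessian_supp, fr.pd_meanCurv_succ, fr.meanCurv_eq,
    Finset.sum_add_distrib, Finset.sum_sub_distrib, Finset.mul_sum]
  congr 1
  rw [Finset.sum_comm]

/-- The key inequality at a maximum point of the quotient of the mean curvature by the support
function. -/
lemma key_inequality {k : ℕ} {p : ℝ} {φ : E n → ℝ} (hp : p ≤ 1) (hφ : ContDiffAt ℝ 2 φ X₀)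
    (hφ0 : 0 < φ X₀) (hcone : Cone Finset.univ (k + 2) fr.x)
    (heq : ∀ᶠ X in 𝓝 X₀, X ∈ M.carrier → fr.sig (k + 2) X = fr.supp X ^ p * φ X)
    (hmax : ∀ᶠ X in 𝓝 X₀, X ∈ M.carrier →
      fr.meanCurv X ≤ fr.meanCurv X₀ / fr.supp X₀ * fr.supp X) :
    ((k : ℝ) + 2 - p) * (∑ s : Fin n, fr.x s.succ ^ 2) + p * (fr.meanCurv X₀ / fr.supp X₀) +
        ∑ s : Fin n, (fr.hessian s φ / φ X₀ - (pd (fr.b s.succ) φ X₀ / φ X₀) ^ 2) ≤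
      fr.meanCurv X₀ / fr.supp X₀ *
        ((∑ s : Fin n, fr.y s.succ * (pd (fr.b s.succ) φ X₀ / φ X₀)) + (k + 2)) := by
  have hu := fr.supp_pos
  have hF : 0 < fr.sig (k + 2) X₀ := by rw [fr.sig_eq]; exact hcone _ le_rfl
  have hH : 0 < fr.meanCurv X₀ := by rw [fr.meanCurv_eq_es]; exact hcone 1 (by omega)
  have hS : ContDiffAt ℝ 2 fr.supp X₀ := fr.smooth_supp.of_le ENat.LEInfty.out
  have hC : ContDiffAt ℝ 2 fr.meanCurv X₀ := fr.smooth_meanCurv.of_le ENat.LEInfty.out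
  set u := fr.supp X₀ with hu_def
  set H := fr.meanCurv X₀ with hH_def
  set F := fr.sig (k + 2) X₀ with hF_def
  set c := H / u with hc_def
  have hcu : c * u = H := div_mul_cancel₀ _ hu.ne'
  set a : Fin n → ℝ := fun s => pd (fr.b s.succ) fr.supp X₀ / u with ha
  set e : Fin n → ℝ := fun s => pd (fr.b s.succ) φ X₀ / φ X₀ with he
  set A := ∑ s : Fin n, fr.x s.succ ^ 2 with hA
  have htouch : ∀ s : Fin n, pd (fr.b s.succ) fr.meanCurv X₀ = c * pd (fr.b s.succ) fr.supp X₀ ∧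
      fr.hessian s fr.meanCurv ≤ c * fr.hessian s fr.supp := by
    intro s
    have h := fr.touching hC (contDiffAt_const.mul hS) hmax hcu.symm s
    have e1 : fr.hessian s (fun X => c * fr.supp X) = c * fr.hessian s fr.supp := by
      rw [hessian, pd_pd_const_mul c hS, pd_const_mul c (hS.differentiableAt (by simp)), hessian]
      ring
    rwa [e1, pd_const_mul c (hS.differentiableAt (by simp))] at h
  -- At the maximum of H/u the logarithmic gradients of H and u agree.
  have hHs : ∀ s : Fin n, pd (fr.b s.succ) fr.meanCurv X₀ / H = a s := by
    intro s
    rw [(htouch s).1, ha, ← hcu]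
    have hc : 0 < c := div_pos hH hu
    field_simp
  have hFs : ∀ s : Fin n, pd (fr.b s.succ) (fr.sig (k + 2)) X₀ = F * (p * a s + e s) :=
    fun s => fr.pd_sig_eq hφ hφ0 heq s
  have hTF : ∀ s : Fin n, fr.hessian s (fr.sig (k + 2)) =
      F * (p * (fr.hessian s fr.supp / u) + p * (p - 1) * a s ^ 2 + 2 * p * (a s * e s) +
        fr.hessian s φ / φ X₀) := fun s => fr.hessian_sig_eq hφ hφ0 heq s
  have hsum1 : ∑ s : Fin n, fr.Q (k + 1) s.succ * fr.hessian s fr.meanCurv ≤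
      c * ∑ s : Fin n, fr.Q (k + 1) s.succ * fr.hessian s fr.supp := by
    rw [Finset.mul_sum]
    refine Finset.sum_le_sum fun s _ => ?_
    have := mul_le_mul_of_nonneg_left (htouch s).2 (fr.Q_pos hcone s.succ).le
    linarith
  have hsum2 : ∑ s : Fin n, fr.hessian s (fr.sig (k + 2)) ≤ _ :=
    Finset.sum_le_sum fun s _ => fr.hessian_sig_le hcone s
  have hQ : ∑ s : Fin n, fr.x s.succ * fr.Q (k + 1) s.succ = (k + 2) * F := by
    rw [fr.sum_mul_Q, hF_def, fr.sig_eq]; push_cast; ring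
  set W := ∑ s : Fin n, fr.x s.succ ^ 2 * fr.Q (k + 1) s.succ with hW
  set S1 := ∑ s : Fin n, ∑ i : Fin n, fr.fourth i.succ s.succ * fr.Q (k + 1) i.succ with hS1
  set S2 := ∑ s : Fin n, 2 * fr.x s.succ ^ 3 * fr.Q (k + 1) s.succ with hS2
  set Sa := ∑ s, a s ^ 2 with hSa
  set Sae := ∑ s, a s * e s with hSae
  set See := ∑ s, e s ^ 2 with hSee
  set Tu := ∑ s, fr.hessian s fr.supp with hTu
  set Tφ := ∑ s, fr.hessian s φ / φ X₀ with hTφ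
  set Ya := ∑ s : Fin n, fr.y s.succ * a s with hYa
  set Ye := ∑ s : Fin n, fr.y s.succ * e s with hYe
  -- Symmetry of fourth derivatives turns the linearized operator on H into the fourth-order part of
  -- the Laplacian of F.
  have e1 : ∑ s : Fin n, fr.Q (k + 1) s.succ * fr.hessian s fr.meanCurv =
      S1 + S2 + A * ((k + 2) * F) := by
    rw [← hQ, hS1, hS2, Finset.sum_comm, Finset.mul_sum, ← Finset.sum_add_distrib,
      ← Finset.sum_add_distrib]
    refine Finset.sum_congr rfl fun s _ => ?_
    rw [fr.hessian_meanCurv, ← hA, mul_add, mul_add, Finset.mul_sum]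
    refine congrArg₂ (· + ·) (congrArg₂ (· + ·) (Finset.sum_congr rfl fun i _ => ?_) (by ring))
      (by ring)
    rw [fr.fourth_comm]; ring
  have e2 : ∑ s : Fin n, fr.y s.succ * pd (fr.b s.succ) (fr.sig (k + 2)) X₀ =
      F * (p * Ya + Ye) := by
    rw [hYa, hYe, Finset.mul_sum, ← Finset.sum_add_distrib, Finset.mul_sum]
    exact Finset.sum_congr rfl fun s _ => by rw [hFs]; ring
  have e3 : ∑ s : Fin n, fr.hessian s (fr.sig (k + 2)) =
      F * (p * (Tu / u) + p * (p - 1) * Sa + 2 * p * Sae + Tφ) := by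
    rw [hTu, hSa, hSae, hTφ, Finset.sum_div, Finset.mul_sum, Finset.mul_sum, Finset.mul_sum,
      ← Finset.sum_add_distrib, ← Finset.sum_add_distrib, ← Finset.sum_add_distrib,
      Finset.mul_sum]
    exact Finset.sum_congr rfl fun s _ => hTF s
  have e4 : ∑ s : Fin n, (pd (fr.b s.succ) (fr.sig (k + 2)) X₀ ^ 2 / F -
      F * (pd (fr.b s.succ) fr.meanCurv X₀ / H) ^ 2) =
      F * ((p ^ 2 - 1) * Sa + 2 * p * Sae + See) := by
    rw [hSa, hSae, hSee, Finset.mul_sum, Finset.mul_sum, ← Finset.sum_add_distrib,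
      ← Finset.sum_add_distrib, Finset.mul_sum]
    refine Finset.sum_congr rfl fun s _ => ?_
    rw [hFs, hHs]
    field_simp
    ring
  have e5 : Tu = H - u * A + H * Ya := by
    rw [hTu, fr.sum_hessian_supp, ← hA]
    refine congrArg₂ (· + ·) rfl ?_
    rw [hYa, Finset.mul_sum]
    refine Finset.sum_congr rfl fun s _ => ?_
    rw [← hHs]
    field_simp
  have e6 : ∑ s : Fin n, fr.x s.succ * W = H * W := by
    rw [← Finset.sum_mul, hH_def, fr.meanCurv_eq]
  have e7 : ((k + 1 : ℕ) : ℝ) + 1 = k + 2 := by push_cast; ring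
  rw [e1, fr.sum_Q_mul_hessian_supp, e2, ← hu_def, ← hF_def, ← hW, e7] at hsum1
  rw [Finset.sum_add_distrib, Finset.sum_add_distrib, Finset.sum_add_distrib, e3, e4, e6] at hsum2
  rw [Finset.sum_sub_distrib]
  -- The place where p ≤ 1 is needed: the coefficient is p(p - 1) from the equation minus p² - 1
  -- from concavity.
  have hSa0 : 0 ≤ (1 - p) * Sa :=
    mul_nonneg (by linarith) (Finset.sum_nonneg fun s _ => sq_nonneg _)
  -- The cubic curvature terms of H and of u thus cancel.
  have h3 : c * (u * W) = H * W := by rw [← mul_assoc, hcu]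
  have h4 : Tu / u = c - A + c * Ya := by rw [e5, hc_def]; field_simp
  rw [h4] at hsum2
  have h5 : F * (p * (c - A + c * Ya) + p * (p - 1) * Sa + 2 * p * Sae + Tφ -
      ((p ^ 2 - 1) * Sa + 2 * p * Sae + See) + (k + 2) * A) ≤
      F * (c * (k + 2) + c * (p * Ya + Ye)) := by
    nlinarith [hsum1, hsum2, h3]
  have h6 := le_of_mul_le_mul_left h5 hF
  linarith

end Frame

end RadialGraph

lemma abs_pd_le {n : ℕ} {φ : E n → ℝ} {X v : E n} {K : ℝ}
    (h : ∀ j : ℕ, j ≤ 2 → ‖iteratedFDeriv ℝ j φ X‖ ≤ K) (hv : ‖v‖ = 1) : |pd v φ X| ≤ K := by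
  have h1 := (iteratedFDeriv ℝ 1 φ X).le_opNorm fun _ => v
  rw [iteratedFDeriv_one_apply, Finset.prod_const, hv, one_pow, mul_one] at h1
  exact h1.trans (h 1 (by norm_num))

lemma abs_pd_pd_le {n : ℕ} {φ : E n → ℝ} {X v : E n} {K : ℝ} (hφ : ContDiffAt ℝ 2 φ X)
    (h : ∀ j : ℕ, j ≤ 2 → ‖iteratedFDeriv ℝ j φ X‖ ≤ K) (hv : ‖v‖ = 1) :
    |pd v (pd v φ) X| ≤ K := by
  have h1 := (iteratedFDeriv ℝ 2 φ X).le_opNorm fun _ => v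
  rw [iteratedFDeriv_two_apply, Finset.prod_const, hv, one_pow, mul_one] at h1
  rw [pd_pd_eq hφ]
  exact h1.trans (h 2 le_rfl)

namespace RadialGraph

variable {n : ℕ} {M : RadialGraph n}

/-! ### Compactness of the hypersurface -/

lemma isCompact_carrier (M : RadialGraph n) : IsCompact M.carrier := by
  refine isCompact_range ?_
  have h1 : Continuous fun x : S n => radialExt M.radius (x : E n) := by
    rw [continuous_iff_continuousAt]
    intro x
    have h0 : (x : E n) ≠ 0 := by
      intro h
      have := mem_sphere_zero_iff_norm.1 x.2
      rw [h, norm_zero] at this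
      exact zero_ne_one this
    exact ((M.smooth.contDiffAt h0).continuousAt).comp continuous_subtype_val.continuousAt
  simp only [radialExt_coe] at h1
  exact h1.smul continuous_subtype_val

lemma carrier_nonempty (M : RadialGraph n) : M.carrier.Nonempty := by
  obtain ⟨x, hx⟩ := NormedSpace.sphere_nonempty (E := E n) (x := 0) (r := 1) |>.2 zero_le_one
  exact ⟨_, ⟨x, hx⟩, rfl⟩

lemma continuousOn_support (M : RadialGraph n) : ContinuousOn M.support M.carrier := fun _ hX =>
  ((continuousAt_id.inner (𝕜 := ℝ) (M.contDiffAt_normal (ne_zero_of_mem hX)).continuousAt)).continuousWithinAt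

/-- Roots of a characteristic polynomial give no direct continuity; near each point σ_1 agrees on M
with the smooth function Δd. -/
lemma continuousOn_sigma_one (M : RadialGraph n) : ContinuousOn (M.sigma 1) M.carrier := by
  intro X hX
  obtain ⟨fr⟩ := exists_frame hX
  refine fr.smooth_meanCurv.continuousAt.continuousWithinAt.congr_of_eventuallyEq ?_
    (fr.trace_near.self_of_nhds hX)
  rw [EventuallyEq, eventually_nhdsWithin_iff]
  exact fr.trace_near

namespace Frame

variable {X₀ : E n} (fr : M.Frame X₀)

lemma abs_y_le (i : Fin (n + 1)) : |fr.y i| ≤ ‖X₀‖ := by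
  have := abs_real_inner_le_norm (fr.b i) X₀
  rwa [fr.norm_b, one_mul] at this

lemma cone {k : ℕ} (h : M.Admissible k) : Cone Finset.univ k fr.x := by
  intro j hj
  rcases Nat.eq_zero_or_pos j with rfl | hj'
  · simp
  · rw [← fr.sigma_eq]; exact h X₀ fr.mem j hj' hj

lemma equation_near {k : ℕ} {p : ℝ} {φ : E n → ℝ} (h : M.Solves k p φ) :
    ∀ᶠ X in 𝓝 X₀, X ∈ M.carrier → fr.sig k X = fr.supp X ^ p * φ X := by
  filter_upwards [fr.sigma_near, fr.support_near] with X h1 h2 hX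
  rw [sig, ← h1 hX, ← h2 hX, h X hX]

/-! ### The gradient inequality -/

lemma pd_exp (a N : ℝ) (X v : E n) : pd v (fun Y : E n => a * Real.exp (-(N / 2) * ‖Y‖ ^ 2)) X =
    -N * (⟪v, X⟫_ℝ * (a * Real.exp (-(N / 2) * ‖X‖ ^ 2))) := by
  have h1 : HasFDerivAt (fun Y : E n => ‖Y‖ ^ 2) (2 • innerSL ℝ X) X :=
    (hasStrictFDerivAt_norm_sq X).hasFDerivAt
  have h2 := ((h1.const_mul (-(N / 2))).exp).const_mul a
  rw [pd, h2.fderiv]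
  simp [real_inner_comm X v]
  ring

lemma contDiff_exp_norm_sq (a N : ℝ) :
    ContDiff ℝ 2 fun Y : E n => a * Real.exp (-(N / 2) * ‖Y‖ ^ 2) :=
  contDiff_const.mul (Real.contDiff_exp.comp (contDiff_const.mul (contDiff_norm_sq ℝ)))

lemma hessian_exp (a N : ℝ) (s : Fin n) :
    fr.hessian s (fun Y : E n => a * Real.exp (-(N / 2) * ‖Y‖ ^ 2)) =
      a * Real.exp (-(N / 2) * ‖X₀‖ ^ 2) *
        (-N + N ^ 2 * fr.y s.succ ^ 2 + N * (fr.x s.succ * fr.y 0)) := by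
  have hg : DifferentiableAt ℝ (fun Y : E n => a * Real.exp (-(N / 2) * ‖Y‖ ^ 2)) X₀ :=
    (contDiff_exp_norm_sq a N).contDiffAt.differentiableAt (by simp)
  have hi : DifferentiableAt ℝ (fun Y : E n => ⟪fr.b s.succ, Y⟫_ℝ) X₀ :=
    (contDiffAt_inner_left (m := ∞) _ _).differentiableAt_of_infty
  have h1 : pd (fr.b s.succ) (fun Y : E n => a * Real.exp (-(N / 2) * ‖Y‖ ^ 2)) =
      fun X => -N * (⟪fr.b s.succ, X⟫_ℝ * (a * Real.exp (-(N / 2) * ‖X‖ ^ 2))) :=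
    funext fun X => pd_exp a N X _
  rw [hessian, h1, pd_const_mul _ (hi.fun_mul hg), pd_mul hi hg, pd_exp, pd_exp, pd_inner,
    real_inner_self_eq_norm_sq, fr.norm_b, y, y]
  ring

/-- The inequality at a minimum point of `u exp (N |X|² / 2)`. -/
lemma gradient_inequality {k : ℕ} {p N : ℝ} {φ : E n → ℝ} (hφ : ContDiffAt ℝ 2 φ X₀)
    (hφ0 : 0 < φ X₀) (hcone : Cone Finset.univ (k + 2) fr.x)
    (heq : ∀ᶠ X in 𝓝 X₀, X ∈ M.carrier → fr.sig (k + 2) X = fr.supp X ^ p * φ X)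
    (hmin : ∀ X ∈ M.carrier, M.support X₀ * Real.exp (N / 2 * ‖X₀‖ ^ 2) ≤
      M.support X * Real.exp (N / 2 * ‖X‖ ^ 2)) :
    (∀ s : Fin n, fr.y s.succ * (fr.x s.succ + N * fr.supp X₀) = 0) ∧
    fr.supp X₀ * (N * (N * (∑ s : Fin n, fr.Q (k + 1) s.succ * fr.y s.succ ^ 2) -
        ∑ s : Fin n, fr.Q (k + 1) s.succ) +
        N * fr.supp X₀ * ((k + 2) * fr.sig (k + 2) X₀)) ≤
      fr.sig (k + 2) X₀ * (k + 2 - p * N * (∑ s : Fin n, fr.y s.succ ^ 2) +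
        (∑ s : Fin n, fr.y s.succ * (pd (fr.b s.succ) φ X₀ / φ X₀))) := by
  have hu := fr.supp_pos
  have hS : ContDiffAt ℝ 2 fr.supp X₀ := fr.smooth_supp.of_le ENat.LEInfty.out
  set a := M.support X₀ * Real.exp (N / 2 * ‖X₀‖ ^ 2) with ha
  have hval : a * Real.exp (-(N / 2) * ‖X₀‖ ^ 2) = fr.supp X₀ := by
    rw [ha, mul_assoc, ← Real.exp_add, fr.support_eq]; simp
  -- Minimality means that a exp(-N|X|²/2) touches u from below.
  have hle : ∀ᶠ X in 𝓝 X₀, X ∈ M.carrier → a * Real.exp (-(N / 2) * ‖X‖ ^ 2) ≤ fr.supp X := by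
    filter_upwards [fr.support_near] with X h hX
    have h1 := mul_le_mul_of_nonneg_right (hmin X hX) (Real.exp_pos (-(N / 2) * ‖X‖ ^ 2)).le
    rw [mul_assoc (M.support X), ← Real.exp_add, h hX] at h1
    simpa using h1
  have ht := fun s => fr.touching (contDiff_exp_norm_sq a N).contDiffAt hS hle hval s
  simp only [pd_exp, fr.hessian_exp, hval, fr.pd_supp_succ] at ht
  have hgrad : ∀ s : Fin n, fr.y s.succ * (fr.x s.succ + N * fr.supp X₀) = 0 := by
    intro s
    have := (ht s).1
    simp only [y] at this ⊢
    linarith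
  refine ⟨hgrad, ?_⟩
  have hsum := Finset.sum_le_sum fun s (_ : s ∈ (Finset.univ : Finset (Fin n))) =>
    mul_le_mul_of_nonneg_left (ht s).2 (fr.Q_pos hcone s.succ).le
  rw [fr.sum_Q_mul_hessian_supp] at hsum
  have hQ : ∑ s : Fin n, fr.x s.succ * fr.Q (k + 1) s.succ = (k + 2) * fr.sig (k + 2) X₀ := by
    rw [fr.sum_mul_Q, fr.sig_eq]; push_cast; ring
  have hW : 0 ≤ ∑ s : Fin n, fr.x s.succ ^ 2 * fr.Q (k + 1) s.succ :=
    Finset.sum_nonneg fun s _ => mul_nonneg (sq_nonneg _) (fr.Q_pos hcone s.succ).le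
  have e1 : ∑ s : Fin n, fr.Q (k + 1) s.succ * (fr.supp X₀ *
      (-N + N ^ 2 * fr.y s.succ ^ 2 + N * (fr.x s.succ * fr.y 0))) =
      fr.supp X₀ * (N * (N * (∑ s : Fin n, fr.Q (k + 1) s.succ * fr.y s.succ ^ 2) -
        ∑ s : Fin n, fr.Q (k + 1) s.succ) +
        N * fr.supp X₀ * ((k + 2) * fr.sig (k + 2) X₀)) := by
    rw [← hQ, ← fr.supp_eq]
    simp only [Finset.mul_sum, ← Finset.sum_sub_distrib, ← Finset.sum_add_distrib]
    exact Finset.sum_congr rfl fun s _ => by ring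
  have e2 : ∑ s : Fin n, fr.y s.succ * pd (fr.b s.succ) (fr.sig (k + 1 + 1)) X₀ =
      fr.sig (k + 2) X₀ * (-(p * N * (∑ s : Fin n, fr.y s.succ ^ 2)) +
        (∑ s : Fin n, fr.y s.succ * (pd (fr.b s.succ) φ X₀ / φ X₀))) := by
    rw [Finset.mul_sum, ← Finset.sum_neg_distrib, ← Finset.sum_add_distrib, Finset.mul_sum]
    refine Finset.sum_congr rfl fun s _ => ?_
    have h1 := fr.pd_sig_eq hφ hφ0 heq s
    rw [show k + 1 + 1 = k + 2 from rfl, h1, fr.pd_supp_succ]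
    -- The critical point equation removes the curvatures from the gradient of u.
    have h2 : fr.y s.succ * fr.x s.succ = -(N * fr.y s.succ * fr.supp X₀) := by
      linarith [hgrad s]
    rw [h2, neg_div, mul_div_assoc, div_self hu.ne']
    ring
  rw [e1, e2] at hsum
  have h3 := mul_nonneg hu.le hW
  push_cast at hsum
  linarith

/-- In directions of nonpositive curvature the derivative of `σ_k` is comparable to the trace. -/
lemma sum_Q_le {k : ℕ} (hcone : Cone Finset.univ (k + 2) fr.x) {s : Fin n}
    (hs : fr.x s.succ ≤ 0) :
    ∑ i : Fin n, fr.Q (k + 1) i.succ ≤ n * fr.Q (k + 1) s.succ := by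
  have h1 := sum_es_erase Finset.univ fr.x (k + 1)
  rw [Fin.sum_univ_succ] at h1
  have h2 : 0 < fr.Q (k + 1) 0 := fr.Q_pos hcone 0
  have h3 := es_erase (Finset.mem_univ s.succ) fr.x k
  have h4 : 0 < es (Finset.univ.erase s.succ) fr.x k :=
    (hcone.mono (Nat.le_succ _)).es_erase_pos (Finset.mem_univ _)
  -- Expanding in x_s, the term x_s σ_k without s is nonpositive.
  have h5 : es Finset.univ fr.x (k + 1) ≤ fr.Q (k + 1) s.succ := by
    rw [h3, Q]; nlinarith
  have h6 := hcone (k + 1) (Nat.le_succ _)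
  have h7 : ∑ i : Fin n, fr.Q (k + 1) i.succ =
      ((n : ℝ) - k) * es Finset.univ fr.x (k + 1) - fr.Q (k + 1) 0 := by
    simp only [Q] at h1 ⊢
    simp only [Finset.card_univ, Fintype.card_fin] at h1
    push_cast at h1
    linarith
  rw [h7]
  have hk : (0 : ℝ) ≤ k := Nat.cast_nonneg k
  have hn : (0 : ℝ) ≤ n := Nat.cast_nonneg n
  nlinarith [mul_le_mul_of_nonneg_left h5 hn, mul_nonneg hk h6.le]

lemma sum_y_mul_le {φ : E n → ℝ} {m K R : ℝ} (hm : 0 < m) (hmφ : m ≤ φ X₀)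
    (hK : ∀ j : ℕ, j ≤ 2 → ‖iteratedFDeriv ℝ j φ X₀‖ ≤ K) (hR : ‖X₀‖ ≤ R) :
    ∑ s : Fin n, fr.y s.succ * (pd (fr.b s.succ) φ X₀ / φ X₀) ≤ n * (R * (K / m)) := by
  have hK0 : 0 ≤ K := (norm_nonneg _).trans (hK 0 (by norm_num))
  have hR0 : 0 ≤ R := (norm_nonneg _).trans hR
  have : ∀ s ∈ (Finset.univ : Finset (Fin n)),
      fr.y s.succ * (pd (fr.b s.succ) φ X₀ / φ X₀) ≤ R * (K / m) := by
    intro s _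
    refine (le_abs_self _).trans ?_
    rw [abs_mul, abs_div, abs_of_pos (hm.trans_le hmφ)]
    refine mul_le_mul ((fr.abs_y_le _).trans hR) ?_
      (div_nonneg (abs_nonneg _) (hm.trans_le hmφ).le) hR0
    exact div_le_div₀ hK0 (abs_pd_le hK (fr.norm_b _)) hm hmφ
  refine (Finset.sum_le_sum this).trans (le_of_eq ?_)
  simp

end Frame

/-! ### The gradient estimate -/

lemma exists_min_support_mul_exp (M : RadialGraph n) (N : ℝ) :
    ∃ X₀ ∈ M.carrier, ∀ X ∈ M.carrier, M.support X₀ * Real.exp (N / 2 * ‖X₀‖ ^ 2) ≤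
      M.support X * Real.exp (N / 2 * ‖X‖ ^ 2) := by
  have hc : ContinuousOn (fun X => M.support X * Real.exp (N / 2 * ‖X‖ ^ 2)) M.carrier :=
    M.continuousOn_support.mul (Continuous.continuousOn (by fun_prop))
  obtain ⟨X₀, h0, h1⟩ := M.isCompact_carrier.exists_isMinOn M.carrier_nonempty hc
  exact ⟨X₀, h0, fun X hX => h1 hX⟩

lemma support_lower_bound_of_min {N R δ : ℝ} {X₀ : E n} (hδ : 0 ≤ δ)
    (hR : ∀ X ∈ M.carrier, ‖X‖ ≤ R) (hX₀ : X₀ ∈ M.carrier)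
    (hmin : ∀ X ∈ M.carrier, M.support X₀ * Real.exp (N / 2 * ‖X₀‖ ^ 2) ≤
      M.support X * Real.exp (N / 2 * ‖X‖ ^ 2)) (h0 : δ ≤ M.support X₀) {X : E n}
    (hX : X ∈ M.carrier) : δ * Real.exp (-(|N| * R ^ 2)) ≤ M.support X := by
  have h1 := mul_le_mul_of_nonneg_right (hmin X hX) (Real.exp_pos (-(N / 2 * ‖X‖ ^ 2))).le
  rw [mul_assoc, mul_assoc, ← Real.exp_add, ← Real.exp_add, add_neg_cancel, Real.exp_zero,
    mul_one] at h1
  refine le_trans (mul_le_mul h0 (Real.exp_le_exp.2 ?_) (Real.exp_pos _).le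
    (hδ.trans h0)) h1
  have a1 : ‖X₀‖ ^ 2 ≤ R ^ 2 := pow_le_pow_left₀ (norm_nonneg _) (hR X₀ hX₀) 2
  have a2 : ‖X‖ ^ 2 ≤ R ^ 2 := pow_le_pow_left₀ (norm_nonneg _) (hR X hX) 2
  have a3 := sq_nonneg ‖X₀‖
  have a4 := sq_nonneg ‖X‖
  have a5 := neg_abs_le N
  have a6 := le_abs_self N
  nlinarith [mul_le_mul_of_nonneg_left a1 (abs_nonneg N), mul_le_mul_of_nonneg_left a2 (abs_nonneg N),
    mul_nonneg (sub_nonneg.2 a6) a3, mul_nonneg (sub_nonneg.2 a6) a4,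
    mul_nonneg (neg_le_iff_add_nonneg'.1 a5) a3, mul_nonneg (neg_le_iff_add_nonneg'.1 a5) a4]

set_option maxHeartbeats 400000 in
-- The exponent is -N with N > 0, so that -|p| N |X^T|² helps. B bounds the terms of order zero, and
-- |p| N r² = 2B. As |X^T|² + u² ≥ r², the inequality at the minimum fails unless u ≥ δ₀.
lemma exists_support_lower_bound_of_neg (n k : ℕ) {p m r : ℝ} (K R : ℝ) (hneg : p < 0)
    (hm : 0 < m) (hr : 0 < r) :
    ∃ δ : ℝ, 0 < δ ∧ ∀ (M : RadialGraph n) (φ : E n → ℝ),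
      (∀ X ∈ M.carrier, ContDiffAt ℝ 2 φ X) → (∀ X ∈ M.carrier, m ≤ φ X) →
      (∀ X ∈ M.carrier, ∀ j : ℕ, j ≤ 2 → ‖iteratedFDeriv ℝ j φ X‖ ≤ K) →
      (∀ X ∈ M.carrier, r ≤ ‖X‖ ∧ ‖X‖ ≤ R) →
      M.Admissible (k + 2) → M.Solves (k + 2) p φ →
      ∀ X ∈ M.carrier, δ ≤ M.support X := by
  set B : ℝ := k + 2 + n * (|R| * (|K| / m)) with hB
  have hB0 : 0 < B := by positivity
  set N : ℝ := 2 * B / (|p| * r ^ 2) with hN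
  have hp' : 0 < |p| := abs_pos.2 hneg.ne
  have hNpos : 0 < N := by positivity
  set δ₀ : ℝ := Real.sqrt (|p| * r ^ 2 / (2 * (k + 2 + |p|))) with hδ₀
  have hδ₀pos : 0 < δ₀ := Real.sqrt_pos.2 (by positivity)
  refine ⟨δ₀ * Real.exp (-(|(-N)| * R ^ 2)), by positivity, ?_⟩
  intro M φ hφ hmφ hK hrR hadm hsol X hX
  obtain ⟨X₀, h0, hmin⟩ := M.exists_min_support_mul_exp (-N)
  refine support_lower_bound_of_min hδ₀pos.le (fun X hX => (hrR X hX).2) h0 hmin ?_ hX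
  obtain ⟨fr⟩ := exists_frame h0
  have hcone := fr.cone hadm
  have hF : 0 < fr.sig (k + 2) X₀ := by rw [fr.sig_eq]; exact hcone _ le_rfl
  have hφ0 := hm.trans_le (hmφ X₀ h0)
  obtain ⟨-, h1⟩ := fr.gradient_inequality (hφ X₀ h0) hφ0 hcone (fr.equation_near hsol) hmin
  have hu := fr.supp_pos
  have hY := fr.sum_y_mul_le hm (hmφ X₀ h0) (hK X₀ h0) (hrR X₀ h0).2
  have hYB : ∑ s : Fin n, fr.y s.succ * (pd (fr.b s.succ) φ X₀ / φ X₀) ≤ B - (k + 2) := by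
    refine hY.trans ?_
    rw [hB]
    have hR0 : 0 ≤ R := (norm_nonneg _).trans (hrR X₀ h0).2
    have hK0 : 0 ≤ K := (norm_nonneg _).trans (hK X₀ h0 0 (by norm_num))
    rw [abs_of_nonneg hR0, abs_of_nonneg hK0]
    linarith
  have hsq := fr.sum_y_sq
  rw [← fr.supp_eq] at hsq
  have hr2 : r ^ 2 ≤ ‖X₀‖ ^ 2 := pow_le_pow_left₀ hr.le (hrR X₀ h0).1 2
  have hQy : 0 ≤ ∑ s : Fin n, fr.Q (k + 1) s.succ * fr.y s.succ ^ 2 :=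
    Finset.sum_nonneg fun s _ => mul_nonneg (fr.Q_pos hcone _).le (sq_nonneg _)
  have hQ : 0 ≤ ∑ s : Fin n, fr.Q (k + 1) s.succ :=
    Finset.sum_nonneg fun s _ => (fr.Q_pos hcone _).le
  rw [fr.support_eq, hδ₀]
  refine Real.sqrt_le_iff.2 ⟨hu.le, ?_⟩
  rw [div_le_iff₀ (by positivity)]
  set F := fr.sig (k + 2) X₀
  set u := fr.supp X₀
  set Y := ∑ s : Fin n, fr.y s.succ ^ 2
  set Ye := ∑ s : Fin n, fr.y s.succ * (pd (fr.b s.succ) φ X₀ / φ X₀)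
  set Q1 := ∑ s : Fin n, fr.Q (k + 1) s.succ * fr.y s.succ ^ 2
  set Q2 := ∑ s : Fin n, fr.Q (k + 1) s.succ
  have hpabs : |p| = -p := abs_of_neg hneg
  have h2 : 0 ≤ u * (N * (N * Q1 + Q2)) := by positivity
  have h3 : F * (-(N * u ^ 2 * (k + 2))) ≤ F * (k + 2 - |p| * N * Y + Ye) := by
    rw [hpabs]; nlinarith
  have h4 := le_of_mul_le_mul_left h3 hF
  have h5 : N * (|p| * r ^ 2) = 2 * B := by rw [hN]; field_simp
  have h6 : |p| * N * r ^ 2 ≤ |p| * N * (Y + u ^ 2) :=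
    mul_le_mul_of_nonneg_left (by linarith) (by positivity)
  have h7 : N * (|p| * r ^ 2) ≤ N * (u ^ 2 * (2 * (k + 2 + |p|))) := by nlinarith
  exact le_of_mul_le_mul_left h7 hNpos

set_option maxHeartbeats 400000 in
-- If u < r/2 at the minimum, then |X^T|² ≥ r²/2. The first part of N makes N Σ Q_s y_s² exceed Σ
-- Q_s, so the left side is nonnegative; the second makes p N |X^T|² larger than B, a contradiction.
lemma exists_support_lower_bound_of_pos (n k : ℕ) {p m r : ℝ} (K R : ℝ) (hpos : 0 < p)
    (hm : 0 < m) (hr : 0 < r) :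
    ∃ δ : ℝ, 0 < δ ∧ ∀ (M : RadialGraph n) (φ : E n → ℝ),
      (∀ X ∈ M.carrier, ContDiffAt ℝ 2 φ X) → (∀ X ∈ M.carrier, m ≤ φ X) →
      (∀ X ∈ M.carrier, ∀ j : ℕ, j ≤ 2 → ‖iteratedFDeriv ℝ j φ X‖ ≤ K) →
      (∀ X ∈ M.carrier, r ≤ ‖X‖ ∧ ‖X‖ ≤ R) →
      M.Admissible (k + 2) → M.Solves (k + 2) p φ →
      ∀ X ∈ M.carrier, δ ≤ M.support X := by
  set B : ℝ := k + 2 + n * (|R| * (|K| / m)) with hB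
  have hB0 : 0 < B := by positivity
  set N : ℝ := 2 * n / r ^ 2 + 4 * B / (p * r ^ 2) with hN
  have hNpos : 0 < N := by positivity
  refine ⟨r / 2 * Real.exp (-(|N| * R ^ 2)), by positivity, ?_⟩
  intro M φ hφ hmφ hK hrR hadm hsol X hX
  obtain ⟨X₀, h0, hmin⟩ := M.exists_min_support_mul_exp N
  refine support_lower_bound_of_min (by positivity) (fun X hX => (hrR X hX).2) h0 hmin ?_ hX
  obtain ⟨fr⟩ := exists_frame h0
  have hcone := fr.cone hadm
  have hF : 0 < fr.sig (k + 2) X₀ := by rw [fr.sig_eq]; exact hcone _ le_rfl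
  have hφ0 := hm.trans_le (hmφ X₀ h0)
  obtain ⟨hg, h1⟩ := fr.gradient_inequality (hφ X₀ h0) hφ0 hcone (fr.equation_near hsol) hmin
  have hu := fr.supp_pos
  have hY := fr.sum_y_mul_le hm (hmφ X₀ h0) (hK X₀ h0) (hrR X₀ h0).2
  have hYB : ∑ s : Fin n, fr.y s.succ * (pd (fr.b s.succ) φ X₀ / φ X₀) ≤ B - (k + 2) := by
    refine hY.trans ?_
    rw [hB]
    have hR0 : 0 ≤ R := (norm_nonneg _).trans (hrR X₀ h0).2
    have hK0 : 0 ≤ K := (norm_nonneg _).trans (hK X₀ h0 0 (by norm_num))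
    rw [abs_of_nonneg hR0, abs_of_nonneg hK0]
    linarith
  have hsq := fr.sum_y_sq
  rw [← fr.supp_eq] at hsq
  have hr2 : r ^ 2 ≤ ‖X₀‖ ^ 2 := pow_le_pow_left₀ hr.le (hrR X₀ h0).1 2
  rw [fr.support_eq]
  by_contra hcon
  push Not at hcon
  have hQ : 0 ≤ ∑ s : Fin n, fr.Q (k + 1) s.succ :=
    Finset.sum_nonneg fun s _ => (fr.Q_pos hcone _).le
  -- Each s has y_s = 0 or curvature -N u < 0; in the latter case `sum_Q_le` applies.
  have hQy : (∑ s : Fin n, fr.Q (k + 1) s.succ) * (∑ s : Fin n, fr.y s.succ ^ 2) ≤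
      n * ∑ s : Fin n, fr.Q (k + 1) s.succ * fr.y s.succ ^ 2 := by
    rw [Finset.mul_sum, Finset.mul_sum]
    refine Finset.sum_le_sum fun s _ => ?_
    rcases mul_eq_zero.1 (hg s) with h | h
    · simp [h]
    · have h2 : fr.x s.succ ≤ 0 := by nlinarith [mul_pos hNpos hu]
      have := mul_le_mul_of_nonneg_right (fr.sum_Q_le hcone h2) (sq_nonneg (fr.y s.succ))
      linarith
  set F := fr.sig (k + 2) X₀
  set u := fr.supp X₀
  set Y := ∑ s : Fin n, fr.y s.succ ^ 2
  set Ye := ∑ s : Fin n, fr.y s.succ * (pd (fr.b s.succ) φ X₀ / φ X₀)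
  set Q1 := ∑ s : Fin n, fr.Q (k + 1) s.succ * fr.y s.succ ^ 2
  set Q2 := ∑ s : Fin n, fr.Q (k + 1) s.succ
  have hYr : r ^ 2 / 2 ≤ Y := by nlinarith
  have hNr : N * (r ^ 2 / 2) = n + 2 * B / p := by rw [hN]; field_simp; ring
  have hBp : 0 < 2 * B / p := by positivity
  have hn0 : (0 : ℝ) < n := by
    rcases Nat.eq_zero_or_pos n with h | h
    · exfalso
      subst h
      have : Y = 0 := by simp [Y]
      have := sq_pos_of_pos hr
      linarith
    · exact_mod_cast h
  have hNY : n + 2 * B / p ≤ N * Y := by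
    rw [← hNr]; exact mul_le_mul_of_nonneg_left hYr hNpos.le
  have h2 : Q2 ≤ N * Q1 := by
    have h3 : n * Q2 ≤ n * (N * Q1) := by
      have h4 : Q2 * n ≤ Q2 * (N * Y) := mul_le_mul_of_nonneg_left (by linarith) hQ
      have h5 := mul_le_mul_of_nonneg_left hQy hNpos.le
      nlinarith
    exact le_of_mul_le_mul_left h3 hn0
  have h3 : 0 ≤ u * (N * (N * Q1 - Q2) + N * u * ((k + 2) * F)) := by
    have : 0 ≤ N * Q1 - Q2 := by linarith
    positivity
  have h4 : 0 ≤ k + 2 - p * N * Y + Ye := by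
    have := h3.trans h1
    exact nonneg_of_mul_nonneg_right this hF
  have h5 : p * (n + 2 * B / p) ≤ p * (N * Y) := mul_le_mul_of_nonneg_left hNY hpos.le
  have h6 : p * (n + 2 * B / p) = p * n + 2 * B := by field_simp
  have h7 : 0 < p * n := mul_pos hpos hn0
  linarith

lemma exists_support_lower_bound (n k : ℕ) {p m r : ℝ} (K R : ℝ) (hp0 : p ≠ 0)
    (hm : 0 < m) (hr : 0 < r) :
    ∃ δ : ℝ, 0 < δ ∧ ∀ (M : RadialGraph n) (φ : E n → ℝ),
      (∀ X ∈ M.carrier, ContDiffAt ℝ 2 φ X) → (∀ X ∈ M.carrier, m ≤ φ X) →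
      (∀ X ∈ M.carrier, ∀ j : ℕ, j ≤ 2 → ‖iteratedFDeriv ℝ j φ X‖ ≤ K) →
      (∀ X ∈ M.carrier, r ≤ ‖X‖ ∧ ‖X‖ ≤ R) →
      M.Admissible (k + 2) → M.Solves (k + 2) p φ →
      ∀ X ∈ M.carrier, δ ≤ M.support X := by
  rcases lt_or_gt_of_ne hp0 with h | h
  · exact exists_support_lower_bound_of_neg n k K R h hm hr
  · exact exists_support_lower_bound_of_pos n k K R h hm hr

/-! ### The curvature estimate -/

/-- With a = |A| at a maximum of σ_1/u, `key_inequality` becomes a² ≤ a B + D, since H ≤ n a and u ≥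
δ. The bound on H/u spreads to all of M through u ≤ R. -/
lemma exists_sigma_one_bound (n k : ℕ) {p m δ : ℝ} (K R : ℝ) (hp : p ≤ 1) (hm : 0 < m)
    (hδ : 0 < δ) :
    ∃ C : ℝ, ∀ (M : RadialGraph n) (φ : E n → ℝ),
      (∀ X ∈ M.carrier, ContDiffAt ℝ 2 φ X) → (∀ X ∈ M.carrier, m ≤ φ X) →
      (∀ X ∈ M.carrier, ∀ j : ℕ, j ≤ 2 → ‖iteratedFDeriv ℝ j φ X‖ ≤ K) →
      (∀ X ∈ M.carrier, ‖X‖ ≤ R) → (∀ X ∈ M.carrier, δ ≤ M.support X) →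
      M.Admissible (k + 2) → M.Solves (k + 2) p φ →
      ∀ X ∈ M.carrier, M.sigma 1 X ≤ C := by
  set B : ℝ := n / δ * (n * (R * (K / m)) + (k + 2) + |p|) + n * (K / m) with hB
  set D : ℝ := n * (K / m + (K / m) ^ 2) with hD
  refine ⟨n * (B + D + 1) / δ * R, ?_⟩
  intro M φ hφ hmφ hK hR hu hadm hsol X hX
  have hc : ContinuousOn (fun X => M.sigma 1 X / M.support X) M.carrier :=
    M.continuousOn_sigma_one.div M.continuousOn_support fun X hX =>
      (M.support_pos (ne_zero_of_mem hX)).ne'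
  obtain ⟨X₀, h0, hmax⟩ := M.isCompact_carrier.exists_isMaxOn M.carrier_nonempty hc
  have hmax' : ∀ X ∈ M.carrier, M.sigma 1 X ≤ M.sigma 1 X₀ / M.support X₀ * M.support X := by
    intro X hX
    have := hmax hX
    rwa [Set.mem_ofPred_eq, div_le_iff₀ (M.support_pos (ne_zero_of_mem hX))] at this
  obtain ⟨fr⟩ := exists_frame h0
  have hcone := fr.cone hadm
  have hφ0 := hm.trans_le (hmφ X₀ h0)
  have hH : 0 < fr.meanCurv X₀ := by rw [fr.meanCurv_eq_es]; exact hcone 1 (by omega)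
  have hus := fr.supp_pos
  have huδ : δ ≤ fr.supp X₀ := by rw [← fr.support_eq]; exact hu X₀ h0
  have hK0 : 0 ≤ K := (norm_nonneg _).trans (hK X₀ h0 0 (by norm_num))
  have hR0 : 0 ≤ R := (norm_nonneg _).trans (hR X₀ h0)
  have hs0 : M.sigma 1 X₀ = fr.meanCurv X₀ := fr.trace_near.self_of_nhds h0
  have hmaxfr : ∀ᶠ X in 𝓝 X₀, X ∈ M.carrier →
      fr.meanCurv X ≤ fr.meanCurv X₀ / fr.supp X₀ * fr.supp X := by
    filter_upwards [fr.trace_near, fr.support_near] with X h1 h2 hX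
    have := hmax' X hX
    rwa [h1 hX, h2 hX, hs0, fr.support_eq] at this
  have key := fr.key_inequality hp (hφ X₀ h0) hφ0 hcone (fr.equation_near hsol) hmaxfr
  have hY := fr.sum_y_mul_le hm (hmφ X₀ h0) (hK X₀ h0) (hR X₀ h0)
  set A := ∑ s : Fin n, fr.x s.succ ^ 2 with hA
  have hA0 : 0 ≤ A := Finset.sum_nonneg fun s _ => sq_nonneg _
  set a := Real.sqrt A with ha
  have ha0 : 0 ≤ a := Real.sqrt_nonneg A
  have haA : a ^ 2 = A := Real.sq_sqrt hA0
  have hxa : ∀ s : Fin n, |fr.x s.succ| ≤ a := by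
    intro s
    refine Real.abs_le_sqrt ?_
    exact Finset.single_le_sum (f := fun s : Fin n => fr.x s.succ ^ 2)
      (fun s _ => sq_nonneg _) (Finset.mem_univ s)
  have hHa : fr.meanCurv X₀ ≤ n * a := by
    rw [fr.meanCurv_eq]
    refine (Finset.sum_le_sum fun s _ => (le_abs_self _).trans (hxa s)).trans (le_of_eq ?_)
    simp
  set c := fr.meanCurv X₀ / fr.supp X₀ with hc
  have hc0 : 0 ≤ c := (div_pos hH hus).le
  have hca : c ≤ n * a / δ := div_le_div₀ (by positivity) hHa hδ huδ
  have hterm : ∀ s ∈ (Finset.univ : Finset (Fin n)),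
      -((K + a * K) / m + (K / m) ^ 2) ≤
        fr.hessian s φ / φ X₀ - (pd (fr.b s.succ) φ X₀ / φ X₀) ^ 2 := by
    intro s _
    have h1 : (pd (fr.b s.succ) φ X₀ / φ X₀) ^ 2 ≤ (K / m) ^ 2 := by
      rw [← sq_abs, abs_div, abs_of_pos hφ0]
      refine pow_le_pow_left₀ (by positivity) ?_ 2
      exact div_le_div₀ hK0 (abs_pd_le (hK X₀ h0) (fr.norm_b _)) hm (hmφ X₀ h0)
    have h2 : |fr.hessian s φ| ≤ K + a * K := by
      rw [Frame.hessian]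
      refine (abs_sub _ _).trans (add_le_add (abs_pd_pd_le (hφ X₀ h0) (hK X₀ h0) (fr.norm_b _)) ?_)
      rw [abs_mul]
      exact mul_le_mul (hxa s) (abs_pd_le (hK X₀ h0) (fr.norm_b _)) (abs_nonneg _) ha0
    have h3 : |fr.hessian s φ / φ X₀| ≤ (K + a * K) / m := by
      rw [abs_div, abs_of_pos hφ0]
      exact div_le_div₀ (by positivity) h2 hm (hmφ X₀ h0)
    linarith [neg_le_of_abs_le h3]
  have hsum := Finset.sum_le_sum hterm
  rw [Finset.sum_const, Finset.card_univ, Fintype.card_fin, nsmul_eq_mul] at hsum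
  -- The index is shifted by two, so the coefficient is at least 2 - p ≥ 1.
  have hkp : A ≤ ((k : ℝ) + 2 - p) * A := by
    have : (0 : ℝ) ≤ k := Nat.cast_nonneg k
    nlinarith
  have hpc : -(|p| * c) ≤ p * c := by nlinarith [neg_abs_le p]
  have hcY : c * ((∑ s : Fin n, fr.y s.succ * (pd (fr.b s.succ) φ X₀ / φ X₀)) + (k + 2)) ≤
      c * (n * (R * (K / m)) + (k + 2)) := mul_le_mul_of_nonneg_left (by linarith) hc0
  have hcB : c * (n * (R * (K / m)) + (k + 2) + |p|) ≤
      n * a / δ * (n * (R * (K / m)) + (k + 2) + |p|) :=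
    mul_le_mul_of_nonneg_right hca (by positivity)
  have hquad : a ^ 2 ≤ a * B + D := by
    have e1 : (n : ℝ) * a / δ * (n * (R * (K / m)) + (k + 2) + |p|) +
        n * ((K + a * K) / m + (K / m) ^ 2) = a * B + D := by
      rw [hB, hD]; ring
    rw [haA, ← e1]
    linarith
  have hB0 : 0 ≤ B := by positivity
  have hD0 : 0 ≤ D := by positivity
  have haBD : a ≤ B + D + 1 := by
    by_contra hcon
    push Not at hcon
    nlinarith [mul_nonneg hB0 ha0, mul_nonneg hD0 ha0]
  have hXR : M.support X ≤ R := by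
    have h1 := real_inner_le_norm X (M.normal X)
    rw [M.norm_normal (ne_zero_of_mem hX), mul_one] at h1
    exact h1.trans (hR X hX)
  calc M.sigma 1 X ≤ c * M.support X := by
        have := hmax' X hX
        rwa [hs0, fr.support_eq] at this
    _ ≤ n * (B + D + 1) / δ * R := by
        refine mul_le_mul (hca.trans ?_) hXR (M.support_pos (ne_zero_of_mem hX)).le (by positivity)
        gcongr

end RadialGraph

/-! ### Right-hand sides given by a density on the sphere -/

section Density

variable {n : ℕ} {f : S n → ℝ}

/-- The extension is invariant under scaling, hence its j-th derivative is homogeneous of degree -j;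
the chain rule with the dilation by 1/|X| reduces to the sphere. -/
lemma norm_iteratedFDeriv_radialExt_le {j : ℕ} {K : ℝ} (hf : IsCSphere j f)
    (hK : ∀ x : S n, ‖iteratedFDeriv ℝ j (radialExt f) (x : E n)‖ ≤ K) {X : E n} (hX : X ≠ 0) :
    ‖iteratedFDeriv ℝ j (radialExt f) X‖ ≤ K * ‖X‖⁻¹ ^ j := by
  have hc : 0 < ‖X‖⁻¹ := inv_pos.2 (norm_pos_iff.2 hX)
  obtain ⟨x, -, hx⟩ := exists_radialExt_eq f hX
  set L : E n →L[ℝ] E n := ‖X‖⁻¹ • ContinuousLinearMap.id ℝ (E n) with hL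
  have hcomp : radialExt f ∘ L = radialExt f := funext fun Y => radialExt_smul f hc Y
  have hpre : L ⁻¹' {0}ᶜ = {0}ᶜ := by
    ext Y
    simp [hL, hX]
  have hopen : IsOpen ({0}ᶜ : Set (E n)) := isOpen_compl_singleton
  have hLX : L X = x := hx.symm
  have hLmem : L X ∈ ({0}ᶜ : Set (E n)) := by
    rw [← Set.mem_preimage, hpre]; exact hX
  have h := L.iteratedFDerivWithin_comp_right hf hopen.uniqueDiffOn
    (by rw [hpre]; exact hopen.uniqueDiffOn) hLmem le_rfl
  rw [hcomp, hpre, iteratedFDerivWithin_of_isOpen j hopen hX,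
    iteratedFDerivWithin_of_isOpen j hopen hLmem, hLX] at h
  rw [h]
  refine (ContinuousMultilinearMap.norm_compContinuousLinearMap_le _ _).trans ?_
  rw [Finset.prod_const, Finset.card_univ, Fintype.card_fin]
  have hLn : ‖L‖ ≤ ‖X‖⁻¹ := 
    ContinuousLinearMap.opNorm_le_bound _ hc.le fun Y => by simp [hL, norm_smul]
  exact mul_le_mul (hK x) (pow_le_pow_left₀ (norm_nonneg _) hLn j) (by positivity)
    ((norm_nonneg _).trans (hK x))

lemma contDiffAt_inv_norm_pow (N : ℕ) {X : E n} (hX : X ≠ 0) :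
    ContDiffAt ℝ ∞ (fun Y : E n => (‖Y‖ ^ N)⁻¹) X :=
  ((contDiffAt_norm ℝ hX).pow N).inv (pow_ne_zero _ (norm_ne_zero_iff.2 hX))

lemma contDiffAt_densityRHS (hf : IsCSphere 2 f) {X : E n} (hX : X ≠ 0) :
    ContDiffAt ℝ 2 (densityRHS f) X :=
  ((contDiffAt_inv_norm_pow _ hX).of_le ENat.LEInfty.out).mul (hf.contDiffAt hX)

lemma exists_bound_inv_norm_pow (n N : ℕ) {r : ℝ} (R : ℝ) (hr : 0 < r) :
    ∃ W : ℝ, 0 ≤ W ∧ ∀ j : ℕ, j ≤ 2 → ∀ X : E n, r ≤ ‖X‖ → ‖X‖ ≤ R →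
      ‖iteratedFDeriv ℝ j (fun Y : E n => (‖Y‖ ^ N)⁻¹) X‖ ≤ W := by
  have hcomp : IsCompact (Metric.closedBall (0 : E n) R ∩ {X | r ≤ ‖X‖}) :=
    (isCompact_closedBall _ _).inter_right (isClosed_le continuous_const continuous_norm)
  have hb : ∀ j : ℕ, ∃ W : ℝ, ∀ X ∈ Metric.closedBall (0 : E n) R ∩ {X | r ≤ ‖X‖},
      ‖iteratedFDeriv ℝ j (fun Y : E n => (‖Y‖ ^ N)⁻¹) X‖ ≤ W := by
    intro j
    refine hcomp.exists_bound_of_continuousOn fun X hX => ?_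
    have h0 : X ≠ 0 := norm_pos_iff.1 (hr.trans_le hX.2)
    exact ((contDiffAt_inv_norm_pow N h0).continuousAt_iteratedFDeriv
      (by exact_mod_cast le_top)).continuousWithinAt
  choose W hW using hb
  refine ⟨∑ j ∈ Finset.range 3, |W j|, Finset.sum_nonneg fun j _ => abs_nonneg _, ?_⟩
  intro j hj X h1 h2
  refine (hW j X ⟨by simpa using h2, h1⟩).trans ((le_abs_self _).trans ?_)
  exact Finset.single_le_sum (f := fun j => |W j|) (fun j _ => abs_nonneg _)
    (Finset.mem_range.2 (by omega))

lemma exists_bound_densityRHS (n : ℕ) {r : ℝ} (K R : ℝ) (hr : 0 < r) :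
    ∃ K' : ℝ, ∀ f : S n → ℝ, IsCSphere 2 f → C2BoundSphere f K →
      ∀ X : E n, r ≤ ‖X‖ → ‖X‖ ≤ R → ∀ j : ℕ, j ≤ 2 →
        ‖iteratedFDeriv ℝ j (densityRHS f) X‖ ≤ K' := by
  obtain ⟨W, hW0, hW⟩ := exists_bound_inv_norm_pow n (n + 1) R hr
  -- Leibniz' rule: the binomial coefficients of order at most two sum to at most 4, and (1 + 1/r)²
  -- covers every negative power of |X| that occurs.
  refine ⟨4 * W * (|K| * (1 + r⁻¹) ^ 2), ?_⟩
  intro f hf hK X h1 h2 j hj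
  have hX : X ≠ 0 := norm_pos_iff.1 (hr.trans_le h1)
  have hopen : IsOpen ({0}ᶜ : Set (E n)) := isOpen_compl_singleton
  have hw : ContDiffOn ℝ 2 (fun Y : E n => (‖Y‖ ^ (n + 1))⁻¹) {0}ᶜ := fun Y hY =>
    ((contDiffAt_inv_norm_pow _ hY).of_le ENat.LEInfty.out).contDiffWithinAt
  have h := norm_iteratedFDerivWithin_mul_le hw hf hopen.uniqueDiffOn
    (Set.mem_compl_singleton_iff.2 hX) (n := j) (by exact_mod_cast hj)
  rw [iteratedFDerivWithin_of_isOpen j hopen hX] at h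
  refine h.trans ?_
  have hterm : ∀ i ∈ Finset.range (j + 1),
      (j.choose i : ℝ) * ‖iteratedFDerivWithin ℝ i (fun Y : E n => (‖Y‖ ^ (n + 1))⁻¹) {0}ᶜ X‖ *
        ‖iteratedFDerivWithin ℝ (j - i) (radialExt f) {0}ᶜ X‖ ≤
      (j.choose i : ℝ) * (W * (|K| * (1 + r⁻¹) ^ 2)) := by
    intro i hi
    have hi' := Finset.mem_range.1 hi
    rw [iteratedFDerivWithin_of_isOpen i hopen hX, iteratedFDerivWithin_of_isOpen (j - i) hopen hX,
      mul_assoc]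
    refine mul_le_mul_of_nonneg_left ?_ (Nat.cast_nonneg _)
    refine mul_le_mul (hW i (by omega) X h1 h2) ?_ (norm_nonneg _) hW0
    have hij : j - i ≤ 2 := by omega
    refine (norm_iteratedFDeriv_radialExt_le (j := j - i) (hf.of_le (by exact_mod_cast hij))
      (fun x => hK x _ hij) hX).trans ?_
    have hr1 : 1 ≤ 1 + r⁻¹ := by linarith [inv_pos.2 hr]
    refine mul_le_mul (le_abs_self K) ?_ (by positivity) (abs_nonneg _)
    refine (pow_le_pow_left₀ (by positivity) ?_ _).trans (pow_le_pow_right₀ hr1 hij)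
    linarith [inv_anti₀ hr h1]
  refine (Finset.sum_le_sum hterm).trans ?_
  rw [← Finset.sum_mul, ← Nat.cast_sum, Nat.sum_range_choose, mul_assoc 4]
  refine mul_le_mul_of_nonneg_right ?_ (by positivity)
  have : 2 ^ j ≤ 2 ^ 2 := Nat.pow_le_pow_right (by norm_num) hj
  exact_mod_cast this

lemma densityRHS_smul (f : S n → ℝ) {c : ℝ} (hc : 0 < c) (X : E n) :
    densityRHS f (c • X) = (c ^ (n + 1))⁻¹ * densityRHS f X := by
  rw [densityRHS, densityRHS, radialExt_smul f hc, norm_smul, Real.norm_of_nonneg hc.le, mul_pow,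
    mul_inv, mul_assoc]

/-- Euler's relation for a right-hand side that is homogeneous of degree `-(n + 1)`. -/
lemma fderiv_densityRHS_self (hf : IsCSphere 2 f) {X : E n} (hX : X ≠ 0) :
    fderiv ℝ (densityRHS f) X X = -((n : ℝ) + 1) * densityRHS f X := by
  have h1 : HasDerivAt (fun t : ℝ => densityRHS f (t • X)) (fderiv ℝ (densityRHS f) X X) 1 := by
    have hc : HasDerivAt (fun t : ℝ => t • X) X 1 := by
      simpa using (hasDerivAt_id (1 : ℝ)).smul_const X
    have hd : HasFDerivAt (densityRHS f) (fderiv ℝ (densityRHS f) X) ((1 : ℝ) • X) := by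
      rw [one_smul]
      exact ((contDiffAt_densityRHS hf hX).differentiableAt (by simp)).hasFDerivAt
    exact hd.comp_hasDerivAt 1 hc
  have h2 : HasDerivAt (fun t : ℝ => densityRHS f (t • X))
      (-((n : ℝ) + 1) * densityRHS f X) 1 := by
    have h3 := (((hasDerivAt_id (1 : ℝ)).pow (n + 1)).inv (by simp)).mul_const (densityRHS f X)
    have h4 : HasDerivAt (fun t : ℝ => (t ^ (n + 1))⁻¹ * densityRHS f X)
        (-((n : ℝ) + 1) * densityRHS f X) 1 := h3.congr_deriv (by simp)
    refine h4.congr_of_eventuallyEq ?_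
    filter_upwards [eventually_gt_nhds (zero_lt_one' ℝ)] with t ht
    exact densityRHS_smul f ht X
  exact h1.unique h2

lemma radialExt_le {K : ℝ} (hK : C2BoundSphere f K) {X : E n} (hX : X ≠ 0) : radialExt f X ≤ K := by
  obtain ⟨x, h1, -⟩ := exists_radialExt_eq f hX
  have := hK x 0 (by norm_num)
  rw [norm_iteratedFDeriv_zero, radialExt_coe] at this
  rw [h1]
  exact (le_abs_self _).trans this

lemma le_radialExt {m : ℝ} (hm : ∀ x, m ≤ f x) {X : E n} (hX : X ≠ 0) : m ≤ radialExt f X := by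
  obtain ⟨x, h1, -⟩ := exists_radialExt_eq f hX
  rw [h1]
  exact hm x

lemma le_densityRHS {m R : ℝ} (hm0 : 0 ≤ m) (hm : ∀ x, m ≤ f x) {X : E n} (hX : X ≠ 0)
    (hR : ‖X‖ ≤ R) : m / R ^ (n + 1) ≤ densityRHS f X := by
  have h0 := norm_pos_iff.2 hX
  rw [densityRHS, inv_mul_eq_div]
  exact div_le_div₀ (hm0.trans (le_radialExt hm hX)) (le_radialExt hm hX) (by positivity)
    (pow_le_pow_left₀ h0.le hR _)

end Density

/-! ### Nearest and farthest points from the origin -/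

namespace RadialGraph

variable {n : ℕ} {M : RadialGraph n}

namespace Frame

variable {X₀ : E n} (fr : M.Frame X₀)

lemma hessian_norm_sq (s : Fin n) :
    fr.hessian s (fun Y : E n => ‖Y‖ ^ 2) = 2 - 2 * (fr.x s.succ * fr.y 0) := by
  have h (v : E n) : pd v (fun Y : E n => ‖Y‖ ^ 2) = fun X => 2 * ⟪v, X⟫_ℝ := by
    funext X
    rw [pd, (hasStrictFDerivAt_norm_sq X).hasFDerivAt.fderiv]
    simp [real_inner_comm X v]
  have hi : DifferentiableAt ℝ (fun Y : E n => ⟪fr.b s.succ, Y⟫_ℝ) X₀ :=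
    (contDiffAt_inner_left (m := ∞) _ _).differentiableAt_of_infty
  rw [hessian, h, h, pd_const_mul _ hi, pd_inner, real_inner_self_eq_norm_sq, fr.norm_b, y]
  ring

lemma pd_norm_sq (i : Fin (n + 1)) : pd (fr.b i) (fun Y : E n => ‖Y‖ ^ 2) X₀ = 2 * fr.y i := by
  rw [pd, (hasStrictFDerivAt_norm_sq X₀).hasFDerivAt.fderiv]
  simp [real_inner_comm X₀ (fr.b i), y]

lemma supp_eq_norm (hy : ∀ s : Fin n, fr.y s.succ = 0) : fr.supp X₀ = ‖X₀‖ := by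
  have h := fr.sum_y_sq
  simp only [hy, ne_eq, OfNat.ofNat_ne_zero, not_false_eq_true, zero_pow, Finset.sum_const_zero,
    add_zero] at h
  rw [← fr.supp_eq] at h
  exact (pow_left_inj₀ fr.supp_pos.le (norm_nonneg _) two_ne_zero).1 h

/-- At a farthest point M lies inside the centred sphere through that point, touches it there, and
is at least as curved. -/
lemma of_max_norm (hmax : ∀ X ∈ M.carrier, ‖X‖ ≤ ‖X₀‖) :
    fr.supp X₀ = ‖X₀‖ ∧ ∀ s : Fin n, 1 ≤ fr.x s.succ * ‖X₀‖ := by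
  have h := fr.max_principle (f := fun Y : E n => ‖Y‖ ^ 2) (contDiff_norm_sq ℝ).contDiffAt
    (Eventually.of_forall fun X hX => pow_le_pow_left₀ (norm_nonneg _) (hmax X hX) 2)
  have hy : ∀ s : Fin n, fr.y s.succ = 0 := fun s => by
    have := (h s).1
    rw [fr.pd_norm_sq] at this
    linarith
  have hs := fr.supp_eq_norm hy
  refine ⟨hs, fun s => ?_⟩
  have := (h s).2
  rw [fr.hessian_norm_sq, ← fr.supp_eq, hs] at this
  linarith

/-- Here the touching sphere is inside M, and the comparison of curvatures is reversed. -/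
lemma of_min_norm (hmin : ∀ X ∈ M.carrier, ‖X₀‖ ≤ ‖X‖) :
    fr.supp X₀ = ‖X₀‖ ∧ ∀ s : Fin n, fr.x s.succ * ‖X₀‖ ≤ 1 := by
  have h := fr.touching (f := fun _ => ‖X₀‖ ^ 2) (g := fun Y : E n => ‖Y‖ ^ 2) contDiffAt_const
    (contDiff_norm_sq ℝ).contDiffAt
    (Eventually.of_forall fun X hX => pow_le_pow_left₀ (norm_nonneg _) (hmin X hX) 2) rfl
  have hy : ∀ s : Fin n, fr.y s.succ = 0 := fun s => by
    have := (h s).1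
    rw [fr.pd_norm_sq, pd_const] at this
    linarith
  have hs := fr.supp_eq_norm hy
  refine ⟨hs, fun s => ?_⟩
  have := (h s).2
  have hc (v : E n) : pd v (fun _ : E n => ‖X₀‖ ^ 2) = fun _ => 0 := funext fun _ => pd_const _
  rw [fr.hessian_norm_sq, ← fr.supp_eq, hs, hessian, hc, hc, pd_const] at this
  linarith

/-- All products are nonnegative, and one product over k principal directions is at least 1. Such a
product needs k ≤ n, because the normal entry is 0. -/
lemma one_le_es_mul_pow {k : ℕ} (hk : k ≤ n) {ρ : ℝ}
    (h : ∀ s : Fin n, 1 ≤ fr.x s.succ * ρ) : 1 ≤ es Finset.univ fr.x k * ρ ^ k := by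
  have hx : ∀ i, 0 ≤ fr.x i * ρ := fun i => by
    refine Fin.cases ?_ (fun s => zero_le_one.trans (h s)) i
    rw [fr.x_zero, zero_mul]
  have hes : es Finset.univ fr.x k * ρ ^ k =
      ∑ t ∈ Finset.univ.powersetCard k, ∏ i ∈ t, fr.x i * ρ := by
    rw [es, Finset.sum_mul]
    refine Finset.sum_congr rfl fun t ht => ?_
    rw [Finset.prod_mul_distrib, Finset.prod_const, (Finset.mem_powersetCard.1 ht).2]
  obtain ⟨t, -, ht⟩ := Finset.exists_subset_card_eq (s := (Finset.univ : Finset (Fin n))) (n := k)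
    (by simpa using hk)
  have hmem : t.map (Fin.succEmb n) ∈ (Finset.univ : Finset (Fin (n + 1))).powersetCard k :=
    Finset.mem_powersetCard.2 ⟨Finset.subset_univ _, by rw [Finset.card_map, ht]⟩
  rw [hes]
  refine le_trans ?_ (Finset.single_le_sum (f := fun t => ∏ i ∈ t, fr.x i * ρ)
    (fun t _ => Finset.prod_nonneg fun i _ => hx i) hmem)
  rw [Finset.prod_map]
  calc (1 : ℝ) = ∏ _s ∈ t, (1 : ℝ) := Finset.prod_const_one.symm
    _ ≤ _ := Finset.prod_le_prod (fun _ _ => zero_le_one) fun s _ => h s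

/-- Upper bounds suffice: positivity of σ_1 makes each entry larger than minus the sum of the
others, so all are bounded in absolute value. -/
lemma es_mul_pow_le {k : ℕ} (hcone : Cone Finset.univ 1 fr.x) {ρ : ℝ} (hρ : 0 < ρ)
    (h : ∀ s : Fin n, fr.x s.succ * ρ ≤ 1) :
    es Finset.univ fr.x k * ρ ^ k ≤ (n + 1).choose k * ((n : ℝ) + 1) ^ k := by
  have hx : ∀ i, fr.x i * ρ ≤ 1 := fun i => by
    refine Fin.cases ?_ h i
    rw [fr.x_zero, zero_mul]
    exact zero_le_one
  have hsum : 0 < ∑ i, fr.x i * ρ := by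
    rw [← Finset.sum_mul, ← es_one]
    exact mul_pos (hcone 1 le_rfl) hρ
  have habs : ∀ i, |fr.x i * ρ| ≤ (n : ℝ) + 1 := fun i => by
    have hn : (0 : ℝ) ≤ n := Nat.cast_nonneg n
    refine abs_le.2 ⟨?_, (hx i).trans (by linarith)⟩
    have h1 : ∑ j ∈ Finset.univ.erase i, fr.x j * ρ ≤ ∑ j ∈ Finset.univ.erase i, (1 : ℝ) :=
      Finset.sum_le_sum fun j _ => hx j
    rw [Finset.sum_const, Finset.card_erase_of_mem (Finset.mem_univ i), Finset.card_univ,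
      Fintype.card_fin, nsmul_eq_mul, mul_one, Nat.add_sub_cancel] at h1
    rw [← Finset.add_sum_erase _ _ (Finset.mem_univ i)] at hsum
    linarith
  have hes : es Finset.univ fr.x k * ρ ^ k =
      ∑ t ∈ Finset.univ.powersetCard k, ∏ i ∈ t, fr.x i * ρ := by
    rw [es, Finset.sum_mul]
    refine Finset.sum_congr rfl fun t ht => ?_
    rw [Finset.prod_mul_distrib, Finset.prod_const, (Finset.mem_powersetCard.1 ht).2]
  rw [hes]
  have hterm : ∀ t ∈ (Finset.univ : Finset (Fin (n + 1))).powersetCard k,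
      ∏ i ∈ t, fr.x i * ρ ≤ ((n : ℝ) + 1) ^ k := by
    intro t ht
    refine (le_abs_self _).trans ?_
    rw [Finset.abs_prod, ← (Finset.mem_powersetCard.1 ht).2, ← Finset.prod_const]
    exact Finset.prod_le_prod (fun i _ => abs_nonneg _) fun i _ => habs i
  refine (Finset.sum_le_sum hterm).trans (le_of_eq ?_)
  rw [Finset.sum_const, Finset.card_powersetCard, Finset.card_univ, Fintype.card_fin, nsmul_eq_mul]

lemma fderiv_self (φ : E n → ℝ) : fderiv ℝ φ X₀ X₀ =
    fr.supp X₀ * pd (fr.b 0) φ X₀ + ∑ s : Fin n, fr.y s.succ * pd (fr.b s.succ) φ X₀ := by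
  conv_lhs => rw [← fr.b.sum_repr' X₀]
  rw [map_sum, Fin.sum_univ_succ, map_smul, smul_eq_mul, fr.supp_eq, y]
  simp only [map_smul, smul_eq_mul]
  rw [fr.b.sum_repr' X₀]
  rfl

end Frame

end RadialGraph

namespace RadialGraph

variable {n : ℕ} {M : RadialGraph n}

/-! ### The size of the hypersurface -/

lemma sigma_mul_pow_eq {k : ℕ} {p : ℝ} {f : S n → ℝ} (hsol : M.Solves k p (densityRHS f)) {X : E n}
    (hX : X ∈ M.carrier) (hs : M.support X = ‖X‖) :
    M.sigma k X * ‖X‖ ^ k * ‖X‖ ^ ((n : ℝ) + 1 - k - p) = radialExt f X := by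
  have h0 : 0 < ‖X‖ := norm_pos_iff.2 (ne_zero_of_mem hX)
  rw [hsol X hX, hs, densityRHS, Real.rpow_sub h0, Real.rpow_sub h0, Real.rpow_natCast,
    show (n : ℝ) + 1 = ((n + 1 : ℕ) : ℝ) by push_cast; rfl, Real.rpow_natCast]
  have := Real.rpow_pos_of_pos h0 p
  field_simp

/-- At an extremal point of |X| one has u = |X|, so the equation reads σ_k |X|^k |X|^q = f with q =
n + 1 - k - p. There σ_k |X|^k is bounded below (farthest point) or above (nearest point), and q > 0
allows solving for |X|. -/
lemma exists_norm_bounds (n k : ℕ) {p m : ℝ} (K : ℝ) (hk1 : 1 ≤ k) (hkn : k ≤ n)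
    (hq : (k : ℝ) + p < n + 1) (hm : 0 < m) :
    ∃ r R : ℝ, 0 < r ∧ ∀ f : S n → ℝ, (∀ x, m ≤ f x) → C2BoundSphere f K →
      ∀ M : RadialGraph n, M.Admissible k → M.Solves k p (densityRHS f) →
        ∀ X ∈ M.carrier, r ≤ ‖X‖ ∧ ‖X‖ ≤ R := by
  set q : ℝ := (n : ℝ) + 1 - k - p with hqdef
  have hq0 : 0 < q := by linarith
  set B : ℝ := (n + 1).choose k * ((n : ℝ) + 1) ^ k with hB
  have hB0 : 0 < B := by
    have : 0 < (n + 1).choose k := Nat.choose_pos (by omega)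
    positivity
  refine ⟨(m / B) ^ q⁻¹, K ^ q⁻¹, by positivity, ?_⟩
  intro f hf hK M hadm hsol X hX
  constructor
  · obtain ⟨X₀, h0, hmin⟩ := M.isCompact_carrier.exists_isMinOn M.carrier_nonempty
      continuous_norm.continuousOn
    obtain ⟨fr⟩ := exists_frame h0
    obtain ⟨hs, hx⟩ := fr.of_min_norm hmin
    rw [← fr.support_eq] at hs
    have hρ : 0 < ‖X₀‖ := norm_pos_iff.2 fr.ne_zero
    have h1 := fr.es_mul_pow_le (k := k) ((fr.cone hadm).mono hk1) hρ hx
    rw [← fr.sigma_eq] at h1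
    have h2 := sigma_mul_pow_eq hsol h0 hs
    have h3 : m ≤ B * ‖X₀‖ ^ q := by
      refine (le_radialExt hf fr.ne_zero).trans ?_
      rw [← h2]
      exact mul_le_mul_of_nonneg_right h1 (Real.rpow_nonneg hρ.le _)
    refine le_trans ?_ (hmin hX)
    rw [Real.rpow_inv_le_iff_of_pos (by positivity) hρ.le hq0, div_le_iff₀ hB0]
    linarith
  · obtain ⟨X₀, h0, hmax⟩ := M.isCompact_carrier.exists_isMaxOn M.carrier_nonempty
      continuous_norm.continuousOn
    obtain ⟨fr⟩ := exists_frame h0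
    obtain ⟨hs, hx⟩ := fr.of_max_norm hmax
    rw [← fr.support_eq] at hs
    have hρ : 0 < ‖X₀‖ := norm_pos_iff.2 fr.ne_zero
    have h1 := fr.one_le_es_mul_pow hkn hx
    rw [← fr.sigma_eq] at h1
    have h2 := sigma_mul_pow_eq hsol h0 hs
    have h3 := radialExt_le hK fr.ne_zero
    have h4 : ‖X₀‖ ^ q ≤ K := by
      refine le_trans ?_ h3
      rw [← h2]
      exact le_mul_of_one_le_left (Real.rpow_nonneg hρ.le _) h1
    refine le_trans (hmax hX) ?_
    rw [Real.le_rpow_inv_iff_of_pos hρ.le ((Real.rpow_nonneg hρ.le _).trans h4) hq0]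
    exact h4

/-! ### The gradient estimate for densities -/

/-- At a minimum of u itself (N = 0) the inequality is 0 ≤ k + Σ y_s φ_s/φ, with k the true index.
Euler's relation replaces Σ y_s φ_s by -(n + 1) φ - u φ_ν, so (n + 1 - k) φ ≤ -u φ_ν ≤ u K, and n +
1 - k ≥ 1. -/
lemma div_le_support_of_density {k : ℕ} {p m K : ℝ} {f : S n → ℝ} (hkn : k + 2 ≤ n) (hm : 0 < m)
    (hf : IsCSphere 2 f) (hmφ : ∀ X ∈ M.carrier, m ≤ densityRHS f X)
    (hK : ∀ X ∈ M.carrier, ∀ j : ℕ, j ≤ 2 → ‖iteratedFDeriv ℝ j (densityRHS f) X‖ ≤ K)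
    (hadm : M.Admissible (k + 2)) (hsol : M.Solves (k + 2) p (densityRHS f)) {X : E n}
    (hX : X ∈ M.carrier) : m / (K + 1) ≤ M.support X := by
  obtain ⟨X₀, h0, hmin⟩ := M.exists_min_support_mul_exp 0
  obtain ⟨fr⟩ := exists_frame h0
  have hcone := fr.cone hadm
  have hF : 0 < fr.sig (k + 2) X₀ := by rw [fr.sig_eq]; exact hcone _ le_rfl
  have hφ := contDiffAt_densityRHS hf fr.ne_zero
  have hφ0 := hm.trans_le (hmφ X₀ h0)
  obtain ⟨-, h1⟩ := fr.gradient_inequality hφ hφ0 hcone (fr.equation_near hsol) hmin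
  simp only [zero_mul, zero_add, mul_zero, sub_zero] at h1
  have h2 := nonneg_of_mul_nonneg_right h1 hF
  have h3 := fr.fderiv_self (densityRHS f)
  rw [fderiv_densityRHS_self hf fr.ne_zero] at h3
  have h4 : (∑ s : Fin n, fr.y s.succ * (pd (fr.b s.succ) (densityRHS f) X₀ / densityRHS f X₀)) *
      densityRHS f X₀ = ∑ s : Fin n, fr.y s.succ * pd (fr.b s.succ) (densityRHS f) X₀ := by
    rw [Finset.sum_mul]
    refine Finset.sum_congr rfl fun s _ => ?_
    field_simp
  have h5 := mul_nonneg h2 hφ0.le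
  rw [add_mul, h4] at h5
  have hu := fr.supp_pos
  have hK0 : 0 ≤ K := (norm_nonneg _).trans (hK X₀ h0 0 (by norm_num))
  have h6 : -(fr.supp X₀ * pd (fr.b 0) (densityRHS f) X₀) ≤ fr.supp X₀ * K := by
    rw [← mul_neg]
    exact mul_le_mul_of_nonneg_left ((neg_le_abs _).trans (abs_pd_le (hK X₀ h0) (fr.norm_b 0))) hu.le
  have hkn' : (k : ℝ) + 2 ≤ n := by exact_mod_cast hkn
  have h7 : m ≤ fr.supp X₀ * (K + 1) := by
    have h8 : densityRHS f X₀ ≤ ((n : ℝ) + 1 - (k + 2)) * densityRHS f X₀ :=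
      le_mul_of_one_le_left hφ0.le (by linarith)
    linarith [hmφ X₀ h0]
  have h9 := hmin X hX
  simp only [zero_div, zero_mul, Real.exp_zero, mul_one] at h9
  refine le_trans ?_ h9
  rw [fr.support_eq, div_le_iff₀ (by linarith)]
  exact h7

lemma exists_sigma_one_bound_of_density (n k : ℕ) {p m : ℝ} (K : ℝ) (hkn : k + 2 ≤ n) (hp : p ≤ 1)
    (hm : 0 < m) (h : k + 2 < n ∨ p < 1) :
    ∃ C : ℝ, ∀ f : S n → ℝ, IsCSphere 2 f → (∀ x, m ≤ f x) → C2BoundSphere f K →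
      ∀ M : RadialGraph n, M.Admissible (k + 2) → M.Solves (k + 2) p (densityRHS f) →
        ∀ X ∈ M.carrier, M.sigma 1 X ≤ C := by
  have hq : ((k + 2 : ℕ) : ℝ) + p < n + 1 := by
    have h1 : ((k + 2 : ℕ) : ℝ) ≤ n := by exact_mod_cast hkn
    rcases h with h | h
    · have h2 : ((k + 2 : ℕ) : ℝ) < n := by exact_mod_cast h
      linarith
    · linarith
  obtain ⟨r, R, hr, hrR⟩ := exists_norm_bounds n (k + 2) K (by omega) hkn hq hm
  obtain ⟨K', hK'⟩ := exists_bound_densityRHS n K R hr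
  rcases le_or_gt R 0 with hR | hR
  -- With R ≤ 0 the bounds 0 < r ≤ |X| ≤ R are contradictory, so there is no solution.
  · refine ⟨0, fun f hf hmf hK M hadm hsol X hX => ?_⟩
    have := hrR f hmf hK M hadm hsol X hX
    linarith
  set m' : ℝ := m / R ^ (n + 1) with hm'
  have hm0 : 0 < m' := by positivity
  obtain ⟨C, hC⟩ := exists_sigma_one_bound n k (p := p) (m := m') (δ := m' / (|K'| + 1)) |K'| R hp hm0
    (by positivity)
  refine ⟨C, fun f hf hmf hK M hadm hsol => ?_⟩
  have hb := hrR f hmf hK M hadm hsol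
  have hφ : ∀ X ∈ M.carrier, m' ≤ densityRHS f X := fun X hX =>
    le_densityRHS hm.le hmf (ne_zero_of_mem hX) (hb X hX).2
  have hD : ∀ X ∈ M.carrier, ∀ j : ℕ, j ≤ 2 → ‖iteratedFDeriv ℝ j (densityRHS f) X‖ ≤ |K'| :=
    fun X hX j hj => (hK' f hf hK X (hb X hX).1 (hb X hX).2 j hj).trans (le_abs_self _)
  exact hC M _ (fun X hX => contDiffAt_densityRHS hf (ne_zero_of_mem hX)) hφ hD
    (fun X hX => (hb X hX).2)
    (fun X hX => div_le_support_of_density hkn hm0 hf hφ hD hadm hsol hX) hadm hsol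

end RadialGraph

end CurvatureMeasure
end


theorem theorem3p2 (n k : ℕ) (hk : 2 ≤ k) (hkn : k ≤ n) (p : ℝ) (hp : p ≤ 1)
    (m K : ℝ) (hm : 0 < m) :
    -- right-hand side given by a density `f` on the sphere: bound in terms of `f` alone
    ((k < n ∨ p < 1) →
      ∃ C : ℝ, ∀ f : CurvatureMeasure.S n → ℝ,
        CurvatureMeasure.IsCSphere 2 f → (∀ x, m ≤ f x) → CurvatureMeasure.C2BoundSphere f K →
        ∀ M : CurvatureMeasure.RadialGraph n,
          M.Admissible k → M.Solves k p (CurvatureMeasure.densityRHS f) →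
          ∀ X ∈ M.carrier, M.sigma 1 X ≤ C) ∧
    -- general right-hand side `φ`: bound in terms of `φ` and of the size of the hypersurface
    (∀ r R : ℝ, 0 < r →
      ∃ C : ℝ, ∀ (M : CurvatureMeasure.RadialGraph n) (φ : CurvatureMeasure.E n → ℝ),
        (∀ X ∈ M.carrier, ContDiffAt ℝ 2 φ X) → (∀ X ∈ M.carrier, m ≤ φ X) →
        (∀ X ∈ M.carrier, ∀ j : ℕ, j ≤ 2 → ‖iteratedFDeriv ℝ j φ X‖ ≤ K) →
        (∀ X ∈ M.carrier, r ≤ ‖X‖ ∧ ‖X‖ ≤ R) →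
        (p = 0 → ∀ X ∈ M.carrier, r ≤ M.support X) →
        M.Admissible k → M.Solves k p φ →
        ∀ X ∈ M.carrier, M.sigma 1 X ≤ C) := by
  obtain ⟨k, rfl⟩ : ∃ l, k = l + 2 := ⟨k - 2, by omega⟩
  refine ⟨CurvatureMeasure.RadialGraph.exists_sigma_one_bound_of_density n k K hkn hp hm,
    fun r R hr => ?_⟩
  obtain ⟨δ, hδ, hb⟩ : ∃ δ : ℝ, 0 < δ ∧ ∀ (M : CurvatureMeasure.RadialGraph n)
      (φ : CurvatureMeasure.E n → ℝ),
      (∀ X ∈ M.carrier, ContDiffAt ℝ 2 φ X) → (∀ X ∈ M.carrier, m ≤ φ X) →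
      (∀ X ∈ M.carrier, ∀ j : ℕ, j ≤ 2 → ‖iteratedFDeriv ℝ j φ X‖ ≤ K) →
      (∀ X ∈ M.carrier, r ≤ ‖X‖ ∧ ‖X‖ ≤ R) →
      (p = 0 → ∀ X ∈ M.carrier, r ≤ M.support X) →
      M.Admissible (k + 2) → M.Solves (k + 2) p φ →
      ∀ X ∈ M.carrier, δ ≤ M.support X := by
    -- For p = 0 the equation does not involve u, and the gradient bound is the extra hypothesis.
    rcases eq_or_ne p 0 with h0 | h0
    · exact ⟨r, hr, fun M φ _ _ _ _ h _ _ => h h0⟩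
    · obtain ⟨δ, hδ, hb⟩ :=
        CurvatureMeasure.RadialGraph.exists_support_lower_bound n k (p := p) K R h0 hm hr
      exact ⟨δ, hδ, fun M φ h1 h2 h3 h4 _ => hb M φ h1 h2 h3 h4⟩
  obtain ⟨C, hC⟩ :=
    CurvatureMeasure.RadialGraph.exists_sigma_one_bound n k (p := p) K R hp hm hδ
  exact ⟨C, fun M φ h1 h2 h3 h4 h5 h6 h7 => hC M φ h1 h2 h3 (fun X hX => (h4 X hX).2)
    (hb M φ h1 h2 h3 h4 h5 h6 h7) h6 h7⟩
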